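/- Let $A$ be a finite set of $k\ge 1$ actions. A process is a state of a finite, loop-free labelled transition system over $A$; its depth is the length of its longest trace. The trace simulation preorder $\lesssim_{TS}$ is the largest relation such that $p\lesssim_{TS}q$ implies that $p$ and $q$ have the same traces and that for every $p\xrightarrow{a}p'$ there is $q\xrightarrow{a}q'$ with $p'\lesssim_{TS}q'$. The logic $\mathcal L_{TS}$ consists of the formulae $\varphi::=\mathbf{tt}\mid\mathbf{ff}\mid\varphi\wedge\varphi\mid\varphi\vee\varphi\mid\langle a\rangle\varphi\mid\psi$ with $\psi::=\mathbf{ff}\mid[a]\psi$ ($a\in A$), with the usual Hennessy–Milner semantics on processes; $|\varphi|$ is the number of symbols of $\varphi$, and its modal depth $\mathrm{md}(\varphi)$ is the maximal nesting of modalities. A formula is satisfiable if some process satisfies it. We write $\varphi\models\psi$ if every process that satisfies $\varphi$ satisfies $\psi$. A formula $\varphi$ is prime in $\mathcal L_{TS}$ if, for all $\varphi_1,\varphi_2\in\mathcal L_{TS}$, $\varphi\models\varphi_1\vee\varphi_2$ implies $\varphi\models\varphi_1$ or $\varphi\models\varphi_2$. A formula $\varphi\in\mathcal L_{TS}$ is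 characteristic if there is a process $p$ such that a process $q$ satisfies $\varphi$ if and only if $q$ satisfies every formula of $\mathcal L_{TS}$ that $p$ satisfies. 1. Fix $k$ and $d$. There is an algorithm (a multi-tape Turing machine depending on $k$ and $d$) that decides, for formulae $\varphi\in\mathcal L_{TS}$ with $\mathrm{md}(\varphi)=d$, whether $\varphi$ is satisfiable and prime, in time $O(2^{2k^{d+1}}\cdot k^{d+1}\cdot|\varphi|)$, hence linear in $|\varphi|$; the constant in the $O$ is absolute. The same holds for deciding whether $\varphi$ is satisfiable, whether it is prime, and whether it is characteristic. 2. A formula $\varphi\in\mathcal L_{TS}$ with $\mathrm{md}(\varphi)=d$ is satisfiable and prime if and only if there is a process $p$ of depth at most $d$ such that $p\models\varphi$ and $p\lesssim_{TS}q$ for every process $q$ of depth at most $d+1$ with $q\models\varphi$. 3. For fixed $k$, the problems of deciding whether a formula of $\mathcal L_{TS}$ is satisfiable, prime, and characteristic are fixed-parameter tractable with the modal depth as the parameter: for each of them there are a constant $\alpha$, a computable function $f$ and one algorithm that, given a string $x$ and a number $d$ in unary, decides in time $f(d)\cdot|x|^{\alpha}$ whether $x$ is a formula of $\mathcal L_{TS}$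 of modal depth $d$ with the property in question. -/

import Mathlib

namespace TraceSim

/-! ### Finite, loop-free labelled transition systems -/

/-- `Path tr p t q`: there is a sequence of transitions labelled with the word `t` from `p` to
`q`. -/
inductive Path {A P : Type} (tr : P → A → P → Prop) : P → List A → P → Prop
  | nil (p : P) : Path tr p [] p
  | cons {p q r : P} {a : A} {t : List A} :
      tr p a q → Path tr q t r → Path tr p (a :: t) r

/-- A finite, loop-free labelled transition system over the action set `A`. -/
structure FinLTS (A : Type) where
  State : Type
  finite_state : Finite State
  tr : State → A → State → Prop
  loop_free : ∀ (p : State) (t : List A), Path tr p t p → t = []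

/-- A process over `A`: a state of some finite, loop-free labelled transition system. -/
structure Proc (A : Type) where
  lts : FinLTS A
  state : lts.State

/-- The traces of a state of a labelled transition system. -/
def FinLTS.traces {A : Type} (S : FinLTS A) (p : S.State) : Set (List A) :=
  {t | ∃ q, Path S.tr p t q}

/-- The length of a longest trace of `p` (the supremum is a maximum, since a finite, loop-free
process has no trace longer than its number of states). -/
noncomputable def Proc.depth {A : Type} (p : Proc A) : ℕ :=
  sSup (List.length '' p.lts.traces p.state)

/-- The trace simulation preorder: the largest relation `R` such that `R s t` implies that every
transition of `s` is matched by `t` up to `R` and that `s` and `t` have the same traces. -/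
def TraceSimulated {A : Type} (p q : Proc A) : Prop :=
  ∃ R : p.lts.State → q.lts.State → Prop,
    R p.state q.state ∧
    ∀ s t, R s t →
      (∀ a s', p.lts.tr s a s' → ∃ t', q.lts.tr t a t' ∧ R s' t') ∧
      p.lts.traces s = q.lts.traces t

/-! ### Hennessy–Milner logic and its fragment for trace simulation -/

/-- Formulae of Hennessy–Milner logic over `A`. -/
inductive HML (A : Type) where
  | tt : HML A
  | ff : HML A
  | and : HML A → HML A → HML A
  | or : HML A → HML A → HML A
  | dia : A → HML A → HML A
  | box : A → HML A → HML A
  | neg : HML A → HML A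

/-- Satisfaction of a formula in a state. -/
def FinLTS.Sat {A : Type} (S : FinLTS A) : S.State → HML A → Prop
  | _, .tt => True
  | _, .ff => False
  | p, .and φ ψ => S.Sat p φ ∧ S.Sat p ψ
  | p, .or φ ψ => S.Sat p φ ∨ S.Sat p ψ
  | p, .dia a φ => ∃ q, S.tr p a q ∧ S.Sat q φ
  | p, .box a φ => ∀ q, S.tr p a q → S.Sat q φ
  | p, .neg φ => ¬ S.Sat p φ

/-- `p ⊨ φ`. -/
def Proc.Sat {A : Type} (p : Proc A) (φ : HML A) : Prop :=
  p.lts.Sat p.state φ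

/-- Modal depth. -/
def HML.md {A : Type} : HML A → ℕ
  | .tt => 0
  | .ff => 0
  | .and φ ψ => max φ.md ψ.md
  | .or φ ψ => max φ.md ψ.md
  | .dia _ φ => φ.md + 1
  | .box _ φ => φ.md + 1
  | .neg φ => φ.md

/-- The grammar `ψ ::= ff | [a]ψ`. -/
inductive IsTSBox {A : Type} : HML A → Prop
  | ff : IsTSBox .ff
  | box (a : A) {ψ : HML A} : IsTSBox ψ → IsTSBox (.box a ψ)

/-- The grammar `φ ::= tt | ff | φ ∧ φ | φ ∨ φ | ⟨a⟩φ | ψ` with `ψ ::= ff | [a]ψ`. -/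
inductive IsTS {A : Type} : HML A → Prop
  | tt : IsTS .tt
  | ff : IsTS .ff
  | and {φ ψ : HML A} : IsTS φ → IsTS ψ → IsTS (.and φ ψ)
  | or {φ ψ : HML A} : IsTS φ → IsTS ψ → IsTS (.or φ ψ)
  | dia (a : A) {φ : HML A} : IsTS φ → IsTS (.dia a φ)
  | ofBox {ψ : HML A} : IsTSBox ψ → IsTS ψ

/-- The logic `L_TS` characterizing the trace simulation preorder. -/
def LTS (A : Type) : Set (HML A) := {φ | IsTS φ}

def Satisfiable {A : Type} (φ : HML A) : Prop :=
  ∃ p : Proc A, p.Sat φ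

/-- Every process that satisfies `φ` also satisfies `ψ`. -/
def Entails {A : Type} (φ ψ : HML A) : Prop :=
  ∀ p : Proc A, p.Sat φ → p.Sat ψ

/-- `φ` is prime in the logic `L`. -/
def PrimeIn {A : Type} (L : Set (HML A)) (φ : HML A) : Prop :=
  ∀ φ₁ ∈ L, ∀ φ₂ ∈ L, Entails φ (.or φ₁ φ₂) → Entails φ φ₁ ∨ Entails φ φ₂

/-- `φ` is characteristic for `p` within the logic `L`. -/
def CharacteristicFor {A : Type} (L : Set (HML A)) (φ : HML A) (p : Proc A) : Prop :=
  φ ∈ L ∧ ∀ q : Proc A, q.Sat φ ↔ {ψ ∈ L | p.Sat ψ} ⊆ {ψ ∈ L | q.Sat ψ}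

/-- `φ` is characteristic within the logic `L`, for some process. -/
def CharacteristicIn {A : Type} (L : Set (HML A)) (φ : HML A) : Prop :=
  ∃ p : Proc A, CharacteristicFor L φ p

/-! ### Formulae as strings of symbols -/

/-- The symbols in which formulae are written; each modality `⟨a⟩` or `[a]` is one symbol. -/
inductive Symb (A : Type) where
  | tt : Symb A
  | ff : Symb A
  | and : Symb A
  | or : Symb A
  | dia : A → Symb A
  | box : A → Symb A
  | neg : Symb A

/-- A formula written as a string of symbols, every operator before its arguments (Polish
notation, so that no parentheses are needed). -/
def HML.encode {A : Type} : HML A → List (Symb A)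
  | .tt => [.tt]
  | .ff => [.ff]
  | .and φ ψ => .and :: (φ.encode ++ ψ.encode)
  | .or φ ψ => .or :: (φ.encode ++ ψ.encode)
  | .dia a φ => .dia a :: φ.encode
  | .box a φ => .box a :: φ.encode
  | .neg φ => .neg :: φ.encode

/-- The size of a formula: the number of symbols that appear in it, parentheses not counted. -/
def HML.size {A : Type} : HML A → ℕ
  | .tt => 1
  | .ff => 1
  | .and φ ψ => φ.size + ψ.size + 1
  | .or φ ψ => φ.size + ψ.size + 1
  | .dia _ φ => φ.size + 1
  | .box _ φ => φ.size + 1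
  | .neg φ => φ.size + 1

theorem HML.length_encode {A : Type} (φ : HML A) : φ.encode.length = φ.size := by
  induction φ <;> simp_all [HML.encode, HML.size]

/-! ### Turing machines with a step count -/

/-- The multi-stack Turing machine `M`, with finite stack alphabets, decides membership in `L`:
started with `enc i` on its input stack, it halts after at most `t i` steps with the single symbol
`true` on its output stack if `i ∈ L`, and with the single symbol `false` if `i ∉ L`. -/
def DecidesInTime {I Γ : Type} (M : Turing.TM2ComputableAux Γ Bool) (enc : I → List Γ)
    (L : Set I) (t : I → ℕ) : Prop :=
  (∀ κ, Finite (M.tm.Γ κ)) ∧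
  ∀ i : I, ∃ b : Bool, (b = true ↔ i ∈ L) ∧
    Nonempty (Turing.TM2OutputsInTime M.tm ((enc i).map M.inputAlphabet.symm)
      (some [M.outputAlphabet.symm b]) (t i))

/-- The language `L` is decided by a Turing machine in at most `t n` steps, `n` the input length. -/
def DecidableInTime {Γ : Type} (L : Set (List Γ)) (t : ℕ → ℕ) : Prop :=
  ∃ M : Turing.TM2ComputableAux Γ Bool, DecidesInTime M id L (fun x => t x.length)

/-- A pair of strings as one string. -/
def encodePair {Γ Δ : Type} (z : List Γ × List Δ) : List (Γ ⊕ Δ) :=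
  z.1.map Sum.inl ++ z.2.map Sum.inr

/-- The parameterized problem `L` (instance first, parameter second) is fixed-parameter tractable:
for a computable function `f` and a constant `α`, a single Turing machine decides `(x, y) ∈ L` in
time `f(|y|) · |x|^α` (with `|x| + 1` for `|x|`, to allow for an empty `x`). -/
def IsFPT {Γ Δ : Type} (L : Set (List Γ × List Δ)) : Prop :=
  ∃ (M : Turing.TM2ComputableAux (Γ ⊕ Δ) Bool) (f : ℕ → ℕ) (α : ℕ), Computable f ∧
    DecidesInTime M encodePair L (fun z => f z.2.length * (z.1.length + 1) ^ α)

/-- The formulae of `L_TS` of modal depth `d` with the property `Q`, as a language. -/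
def tsLanguage {A : Type} (d : ℕ) (Q : HML A → Prop) : Set (List (Symb A)) :=
  {x | ∃ φ ∈ LTS A, φ.md = d ∧ Q φ ∧ x = φ.encode}

/-- The problem whether a formula of `L_TS` has the property `Q`, parameterized by the modal depth
of the formula (in unary). -/
def tsParameterized {A : Type} (Q : HML A → Prop) : Set (List (Symb A) × List Unit) :=
  {z | ∃ φ ∈ LTS A, Q φ ∧ z.1 = φ.encode ∧ z.2 = List.replicate φ.md ()}

end TraceSim

open TraceSim

namespace TraceSim

variable {A : Type}

/-! ### Traces, depth and trace simulation -/

/-! Primality is a matter of least models. The logic characterizes the preorder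
(`traceSimulated_of_sat`), so a formula with a least model is satisfiable, prime and characteristic
for that model. Conversely, let `φ` be satisfiable and prime of modal depth `d`, and suppose that
none of its models of depth at most `d`, finitely many up to bisimilarity, is least. Each of these
satisfies a formula that `φ` does not entail. The disjunction of these formulae and of "some trace
has length `d + 1`" is entailed by `φ`, yet no disjunct is, because a model cut off at depth `d` is
still a model (`sat_code`). This contradicts primality and gives `exists_isLeastModel`. Leastness of
a `p` of depth at most `d` need only be tested on models of depth at most `d + 1`: a model cut off
at `d + 1` has the traces of `p`, none longer than `d`, so the cut removed nothing
(`isLeastModel_of_bounded`).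

For the algorithms, processes of bounded depth are coded by numbers, as in Ackermann's coding of
hereditarily finite sets: the binary digits of a number list its transitions. The models of `φ`
among the codes of depth at most `d + 1` form a bit mask that is computed from the masks of the
subformulae. Mask, modal depth and syntactic rank make up a value; a string in Polish notation is
evaluated from right to left on a stack of values, and each property is a predicate of the final
value (`acceptVal_evalStack_iff`).

For fixed `k` and `d` there are finitely many values. They serve as stack symbols, all tables sit in
the finite control, and `10 * n + 8` steps suffice whatever `k` and `d` are
(`decidableInTime_tsLanguage`).

For fixed-parameter tractability one machine must serve all `d`. Values are then kept in unary and
handled by counter programs, which compute every primitive recursive function in primitive recursive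
time (`exists_counterComputable`). The criteria are primitive recursive because trace simulation of
codes can be written with bounded quantifiers (`natSim_iff`). Each symbol thus costs at most a
computable function of `d`, and the exponent `α` is `1`. -/

theorem FinLTS.nil_mem_traces (S : FinLTS A) (p : S.State) : [] ∈ S.traces p := ⟨p, .nil p⟩

theorem FinLTS.cons_mem_traces (S : FinLTS A) {p : S.State} {a : A} {w : List A} :
    a :: w ∈ S.traces p ↔ ∃ q, S.tr p a q ∧ w ∈ S.traces q := by
  constructor
  · rintro ⟨r, h⟩
    cases h with
    | cons h₁ h₂ => exact ⟨_, h₁, _, h₂⟩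
  · rintro ⟨q, h, r, hr⟩
    exact ⟨r, .cons h hr⟩

theorem FinLTS.traces_of_append (S : FinLTS A) {p : S.State} {v w : List A}
    (h : v ++ w ∈ S.traces p) : v ∈ S.traces p := by
  induction v generalizing p with
  | nil => exact S.nil_mem_traces p
  | cons a v ih =>
    rw [List.cons_append, S.cons_mem_traces] at h
    obtain ⟨q, hq, h⟩ := h
    exact S.cons_mem_traces.2 ⟨q, hq, ih h⟩

theorem Path.trans {P : Type} {tr : P → A → P → Prop} {p q r : P} {v w : List A}
    (h₁ : Path tr p v q) (h₂ : Path tr q w r) : Path tr p (v ++ w) r := by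
  induction h₁ with
  | nil => exact h₂
  | cons h _ ih => exact .cons h (ih h₂)

/-- Every trace of `p` has length at most `n`. -/
def FinLTS.DepthLE (S : FinLTS A) (p : S.State) (n : ℕ) : Prop :=
  ∀ w ∈ S.traces p, w.length ≤ n

theorem FinLTS.DepthLE.mono {S : FinLTS A} {p : S.State} {m n : ℕ} (h : S.DepthLE p m)
    (hmn : m ≤ n) : S.DepthLE p n := fun w hw => (h w hw).trans hmn

theorem FinLTS.DepthLE.of_tr {S : FinLTS A} {p q : S.State} {a : A} {n : ℕ}
    (h : S.DepthLE p (n + 1)) (hq : S.tr p a q) : S.DepthLE q n := fun w hw => by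
  simpa using h (a :: w) (S.cons_mem_traces.2 ⟨q, hq, hw⟩)

theorem FinLTS.depthLE_succ {S : FinLTS A} {p : S.State} {n : ℕ}
    (h : ∀ a q, S.tr p a q → S.DepthLE q n) : S.DepthLE p (n + 1) := by
  intro w hw
  cases w with
  | nil => simp
  | cons a w =>
    obtain ⟨q, hq, hw⟩ := S.cons_mem_traces.1 hw
    simpa using h a q hq w hw

/-- A state of a finite, loop-free transition system has bounded depth. -/
theorem FinLTS.exists_depthLE (S : FinLTS A) (p : S.State) : ∃ n, S.DepthLE p n := by
  have := S.finite_state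
  -- Reachability by a nonempty word is transitive, and irreflexive by loop-freeness, hence well
  -- founded on finitely many states.
  let r : S.State → S.State → Prop := fun q p => ∃ w, w ≠ [] ∧ Path S.tr p w q
  have htr : IsTrans S.State r := ⟨fun x y z ⟨v, hv, h₁⟩ ⟨w, _, h₂⟩ =>
    ⟨w ++ v, by simp [hv], h₂.trans h₁⟩⟩
  have hir : Std.Irrefl r := ⟨fun x ⟨w, hw, h⟩ => hw (S.loop_free x w h)⟩
  have hwf : WellFounded r := Finite.wellFounded_of_trans_of_irrefl r
  induction p using hwf.induction with
  | _ p ih =>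
    -- The bound is chosen for every state, vacuously for non-successors, so that a maximum over the
    -- finite state set can be taken.
    have h : ∀ q, ∃ n, (∃ a, S.tr p a q) → S.DepthLE q n := by
      intro q
      by_cases hq : ∃ a, S.tr p a q
      · obtain ⟨a, ha⟩ := hq
        obtain ⟨n, hn⟩ := ih q ⟨[a], by simp, .cons ha (.nil q)⟩
        exact ⟨n, fun _ => hn⟩
      · exact ⟨0, fun h => absurd h hq⟩
    choose N hN using h
    have := Fintype.ofFinite S.State
    exact ⟨Finset.univ.sup N + 1, FinLTS.depthLE_succ fun a q hq =>
      (hN q ⟨a, hq⟩).mono (Finset.le_sup (Finset.mem_univ q))⟩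

/-- Boundedness from `exists_depthLE` is essential: the supremum of an unbounded set of naturals is
`0`. -/
theorem Proc.depth_le_iff {p : Proc A} {n : ℕ} :
    p.depth ≤ n ↔ p.lts.DepthLE p.state n := by
  obtain ⟨m, hm⟩ := p.lts.exists_depthLE p.state
  constructor
  · intro h w hw
    have hb : BddAbove (List.length '' p.lts.traces p.state) :=
      ⟨m, by rintro _ ⟨v, hv, rfl⟩; exact hm v hv⟩
    exact (le_csSup hb (Set.mem_image_of_mem _ hw)).trans h
  · intro h
    refine csSup_le ⟨0, [], p.lts.nil_mem_traces _, rfl⟩ ?_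
    rintro _ ⟨v, hv, rfl⟩
    exact h v hv

theorem TraceSimulated.traces_eq {p q : Proc A} (h : TraceSimulated p q) :
    p.lts.traces p.state = q.lts.traces q.state := by
  obtain ⟨R, h₀, h⟩ := h
  exact (h _ _ h₀).2

theorem TraceSimulated.trans {p q r : Proc A} (h₁ : TraceSimulated p q)
    (h₂ : TraceSimulated q r) : TraceSimulated p r := by
  obtain ⟨R, hR, h₁⟩ := h₁
  obtain ⟨R', hR', h₂⟩ := h₂
  refine ⟨fun s u => ∃ t, R s t ∧ R' t u, ⟨_, hR, hR'⟩, ?_⟩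
  rintro s u ⟨t, hst, htu⟩
  refine ⟨fun a s' hs => ?_, (h₁ _ _ hst).2.trans (h₂ _ _ htu).2⟩
  obtain ⟨t', ht, hst'⟩ := (h₁ _ _ hst).1 a s' hs
  obtain ⟨u', hu, htu'⟩ := (h₂ _ _ htu).1 a t' ht
  exact ⟨u', hu, t', hst', htu'⟩

/-! ### The logic and the preorder -/

/-- A nest of boxes around `ff` forbids exactly one trace, the word of its labels. Boxes therefore
see nothing but the set of traces. -/
theorem IsTSBox.exists_word {ψ : HML A} (h : IsTSBox ψ) :
    ∃ w : List A, ∀ (S : FinLTS A) (p : S.State), S.Sat p ψ ↔ w ∉ S.traces p := by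
  induction h with
  | ff => exact ⟨[], fun S p => by simp [FinLTS.Sat, S.nil_mem_traces]⟩
  | box a _ ih =>
    obtain ⟨w, hw⟩ := ih
    refine ⟨a :: w, fun S p => ?_⟩
    simp only [FinLTS.Sat, S.cons_mem_traces, hw, not_exists, not_and]

/-- Diamonds are carried along by the simulation clause, boxes by the equality of traces. -/
theorem IsTS.sat_mono {φ : HML A} (h : IsTS φ) {S T : FinLTS A} {R : S.State → T.State → Prop}
    (hR : ∀ s t, R s t →
      (∀ a s', S.tr s a s' → ∃ t', T.tr t a t' ∧ R s' t') ∧ S.traces s = T.traces t)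
    {s : S.State} {t : T.State} (hst : R s t) (hs : S.Sat s φ) : T.Sat t φ := by
  induction h generalizing s t with
  | tt => trivial
  | ff => exact hs
  | and _ _ ih₁ ih₂ => exact ⟨ih₁ hst hs.1, ih₂ hst hs.2⟩
  | or _ _ ih₁ ih₂ => exact hs.imp (ih₁ hst) (ih₂ hst)
  | dia a _ ih =>
    obtain ⟨s', hs', h⟩ := hs
    obtain ⟨t', ht', hR'⟩ := (hR _ _ hst).1 a s' hs'
    exact ⟨t', ht', ih hR' h⟩
  | ofBox hb =>
    obtain ⟨w, hw⟩ := hb.exists_word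
    rw [hw] at hs ⊢
    rwa [← (hR _ _ hst).2]

theorem TraceSimulated.sat {p q : Proc A} (h : TraceSimulated p q) {φ : HML A} (hφ : IsTS φ)
    (hp : p.Sat φ) : q.Sat φ := by
  obtain ⟨R, h₀, h⟩ := h
  exact hφ.sat_mono h h₀ hp

/-- `⟨a₁⟩⋯⟨aₙ⟩tt`. -/
def HML.diaWord : List A → HML A
  | [] => .tt
  | a :: w => .dia a (diaWord w)

/-- `[a₁]⋯[aₙ]ff`. -/
def HML.boxWord : List A → HML A
  | [] => .ff
  | a :: w => .box a (boxWord w)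

theorem isTS_diaWord (w : List A) : IsTS (HML.diaWord w) := by
  induction w with
  | nil => exact .tt
  | cons a w ih => exact .dia a ih

theorem isTSBox_boxWord (w : List A) : IsTSBox (HML.boxWord w) := by
  induction w with
  | nil => exact .ff
  | cons a w ih => exact .box a ih

theorem FinLTS.sat_diaWord (S : FinLTS A) {p : S.State} {w : List A} :
    S.Sat p (HML.diaWord w) ↔ w ∈ S.traces p := by
  induction w generalizing p with
  | nil => simp [HML.diaWord, FinLTS.Sat, S.nil_mem_traces]
  | cons a w ih => simp [HML.diaWord, FinLTS.Sat, S.cons_mem_traces, ih]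

theorem FinLTS.sat_boxWord (S : FinLTS A) {p : S.State} {w : List A} :
    S.Sat p (HML.boxWord w) ↔ w ∉ S.traces p := by
  induction w generalizing p with
  | nil => simp [HML.boxWord, FinLTS.Sat, S.nil_mem_traces]
  | cons a w ih => simp [HML.boxWord, FinLTS.Sat, S.cons_mem_traces, ih]

/-- The conjunction of a list of formulae. -/
def HML.conj (l : List (HML A)) : HML A := l.foldr .and .tt

/-- The disjunction of a list of formulae. -/
def HML.disj (l : List (HML A)) : HML A := l.foldr .or .ff

theorem FinLTS.sat_conj (S : FinLTS A) {p : S.State} {l : List (HML A)} :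
    S.Sat p (HML.conj l) ↔ ∀ φ ∈ l, S.Sat p φ := by
  induction l with
  | nil => simp [HML.conj, FinLTS.Sat]
  | cons φ l ih =>
    rw [List.forall_mem_cons, ← ih]
    rfl

theorem FinLTS.sat_disj (S : FinLTS A) {p : S.State} {l : List (HML A)} :
    S.Sat p (HML.disj l) ↔ ∃ φ ∈ l, S.Sat p φ := by
  induction l with
  | nil => simp [HML.disj, FinLTS.Sat]
  | cons φ l ih =>
    rw [List.exists_mem_cons_iff, ← ih]
    rfl

theorem isTS_conj {l : List (HML A)} (h : ∀ φ ∈ l, IsTS φ) : IsTS (HML.conj l) := by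
  induction l with
  | nil => exact .tt
  | cons φ l ih => exact .and (h φ (by simp)) (ih fun ψ hψ => h ψ (by simp [hψ]))

theorem isTS_disj {l : List (HML A)} (h : ∀ φ ∈ l, IsTS φ) : IsTS (HML.disj l) := by
  induction l with
  | nil => exact .ff
  | cons φ l ih => exact .or (h φ (by simp)) (ih fun ψ hψ => h ψ (by simp [hψ]))

/-- A Hennessy–Milner theorem: inclusion of the satisfied formulae implies trace simulation. -/
theorem traceSimulated_of_sat {p q : Proc A}
    (h : ∀ φ, IsTS φ → p.Sat φ → q.Sat φ) : TraceSimulated p q := by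
  refine ⟨fun s t => ∀ φ, IsTS φ → p.lts.Sat s φ → q.lts.Sat t φ, h, fun s t hst => ⟨?_, ?_⟩⟩
  · intro a s' hs'
    by_contra hcon
    -- If no successor of `t` matches `s'`, each is separated from `s'` by a formula. There are
    -- finitely many states, so the conjunction under one diamond is a formula that `s` satisfies
    -- and `t` does not. Non-successors receive `tt`.
    have hsep : ∀ t' : q.lts.State, ∃ ψ, IsTS ψ ∧ p.lts.Sat s' ψ ∧
        (q.lts.tr t a t' → ¬ q.lts.Sat t' ψ) := by
      intro t'
      by_cases ht : q.lts.tr t a t'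
      · by_contra hne
        refine hcon ⟨t', ht, fun φ hφ hs => ?_⟩
        by_contra hn
        exact hne ⟨φ, hφ, hs, fun _ => hn⟩
      · exact ⟨.tt, .tt, trivial, fun h => absurd h ht⟩
    choose ψ h₁ h₂ h₃ using hsep
    have := q.lts.finite_state
    have := Fintype.ofFinite q.lts.State
    obtain ⟨t', ht', hc⟩ := hst (.dia a (HML.conj (Finset.univ.toList.map ψ)))
      (.dia a (isTS_conj (by simpa using h₁)))
      ⟨s', hs', p.lts.sat_conj.2 (by simpa using h₂)⟩
    exact h₃ t' ht' (q.lts.sat_conj.1 hc _ (by simp))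
  · ext w
    constructor
    · intro hw
      exact q.lts.sat_diaWord.1 (hst _ (isTS_diaWord w) (p.lts.sat_diaWord.2 hw))
    · intro hw
      by_contra hn
      exact q.lts.sat_boxWord.1 (hst _ (.ofBox (isTSBox_boxWord w)) (p.lts.sat_boxWord.2 hn)) hw

/-- The formula saying that there is a trace of length `n`. -/
noncomputable def HML.someTrace (A : Type) [Fintype A] : ℕ → HML A
  | 0 => .tt
  | n + 1 => HML.disj (Finset.univ.toList.map fun a => .dia a (someTrace A n))

theorem isTS_someTrace [Fintype A] (n : ℕ) : IsTS (HML.someTrace A n) := by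
  induction n with
  | zero => exact .tt
  | succ n ih => exact isTS_disj (by simpa using fun a => IsTS.dia a ih)

theorem FinLTS.sat_someTrace [Fintype A] (S : FinLTS A) {p : S.State} {n : ℕ} :
    S.Sat p (HML.someTrace A n) ↔ ∃ w ∈ S.traces p, w.length = n := by
  induction n generalizing p with
  | zero =>
    simp only [HML.someTrace, FinLTS.Sat, true_iff]
    exact ⟨[], S.nil_mem_traces p, rfl⟩
  | succ n ih =>
    simp only [HML.someTrace, S.sat_disj, List.mem_map, Finset.mem_toList, Finset.mem_univ,
      true_and, exists_exists_eq_and, FinLTS.Sat, ih]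
    constructor
    · rintro ⟨a, q, hq, w, hw, hn⟩
      exact ⟨a :: w, S.cons_mem_traces.2 ⟨q, hq, hw⟩, by simp [hn]⟩
    · rintro ⟨w, hw, hn⟩
      cases w with
      | nil => simp at hn
      | cons a w =>
        obtain ⟨q, hq, hw⟩ := S.cons_mem_traces.1 hw
        exact ⟨a, q, hq, w, hw, by simpa using hn⟩

/-- Traces are closed under prefixes, so a trace that is too long has a prefix of length exactly `n
+ 1`. -/
theorem FinLTS.depthLE_of_no_trace (S : FinLTS A) {p : S.State} {n : ℕ}
    (h : ∀ w ∈ S.traces p, w.length ≠ n + 1) : S.DepthLE p n := by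
  intro w hw
  by_contra hlt
  rw [← List.take_append_drop (n + 1) w] at hw
  exact h _ (S.traces_of_append hw) (by simp; omega)

/-- Primality passes from two disjuncts to a list by induction; satisfiability takes care of the
empty disjunction. -/
theorem PrimeIn.exists_of_disj {φ : HML A} (h : PrimeIn (LTS A) φ) (hs : Satisfiable φ)
    {l : List (HML A)} (hl : ∀ ψ ∈ l, IsTS ψ) (he : Entails φ (HML.disj l)) :
    ∃ ψ ∈ l, Entails φ ψ := by
  induction l with
  | nil =>
    obtain ⟨p, hp⟩ := hs
    exact (he p hp).elim
  | cons ψ l ih =>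
    rcases h ψ (hl ψ (by simp)) (HML.disj l) (isTS_disj fun χ hχ => hl χ (by simp [hχ])) he with
      h' | h'
    · exact ⟨ψ, by simp, h'⟩
    · obtain ⟨χ, hχ, h''⟩ := ih (fun χ hχ => hl χ (by simp [hχ])) h'
      exact ⟨χ, by simp [hχ], h''⟩

end TraceSim

namespace TraceSim

variable {A : Type}

/-! ### Natural numbers as finite sets -/

/-- The number whose binary digits below position `n` are given by `b`. -/
def mask (b : ℕ → Bool) : ℕ → ℕ
  | 0 => 0
  | n + 1 => mask b n + (b n).toNat * 2 ^ n

theorem mask_lt (b : ℕ → Bool) (n : ℕ) : mask b n < 2 ^ n := by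
  induction n with
  | zero => simp [mask]
  | succ n ih =>
    have : (b n).toNat * 2 ^ n ≤ 1 * 2 ^ n := Nat.mul_le_mul_right _ (Bool.toNat_le _)
    rw [mask, pow_succ]
    omega

theorem testBit_mask (b : ℕ → Bool) (n i : ℕ) :
    (mask b n).testBit i = (decide (i < n) && b i) := by
  induction n with
  | zero => simp [mask]
  | succ n ih =>
    rw [mask, add_comm, mul_comm, Nat.testBit_two_pow_mul_add _ (mask_lt b n), ih]
    split_ifs with h
    · simp [h, Nat.lt_succ_of_lt h]
    · rcases eq_or_lt_of_le (not_lt.1 h) with rfl | h'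
      · cases b n <;> simp
      · have h₂ : ¬ i < n + 1 := by omega
        have h₃ : i - n ≠ 0 := by omega
        have h₄ : Nat.testBit 1 (i - n) = false :=
          Nat.testBit_lt_two_pow (Nat.one_lt_two_pow h₃)
        cases b n <;> simp [h₂, h₄]

/-! ### Natural numbers as processes -/

/-- The number of processes of depth at most `n` over `k` actions, up to bisimilarity. -/
def univSize (k : ℕ) : ℕ → ℕ
  | 0 => 1
  | n + 1 => 2 ^ (k * univSize k n)

theorem univSize_le_succ {k : ℕ} (hk : 1 ≤ k) (n : ℕ) : univSize k n ≤ univSize k (n + 1) := by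
  rw [univSize]
  exact (Nat.le_mul_of_pos_left _ hk).trans Nat.lt_two_pow_self.le

theorem lt_of_testBit {t i : ℕ} (h : t.testBit i = true) : i < t :=
  Nat.lt_two_pow_self.trans_le (Nat.ge_two_pow_of_testBit h)

variable {k : ℕ}

/-- The number `t` has an `a`-transition to `s` if its binary digit at `k * s + a` is `1`. -/
def NatTr (c : A ≃ Fin k) (t : ℕ) (a : A) (s : ℕ) : Prop :=
  t.testBit (k * s + c a) = true

/-- A digit at position `i` forces `t ≥ 2 ^ i > i`. Transitions thus strictly decrease numbers,
which makes the system of numbers loop-free. -/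
theorem NatTr.lt {c : A ≃ Fin k} {t s : ℕ} {a : A} (h : NatTr c t a s) : s < t := by
  have hk : 0 < k := (c a).pos
  have := lt_of_testBit h
  have := Nat.le_mul_of_pos_left s hk
  omega

theorem NatTr.lt_univSize {c : A ≃ Fin k} {t s n : ℕ} {a : A} (h : NatTr c t a s)
    (ht : t < univSize k (n + 1)) : s < univSize k n := by
  have h₁ := (Nat.ge_two_pow_of_testBit h).trans_lt ht
  rw [univSize, Nat.pow_lt_pow_iff_right (by norm_num)] at h₁
  exact Nat.lt_of_mul_lt_mul_left ((Nat.le_add_right _ _).trans_lt h₁)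

theorem mul_add_fin_inj (c : A ≃ Fin k) {s t : ℕ} {a b : A}
    (h : k * s + c a = k * t + c b) : s = t ∧ a = b := by
  have hk : 0 < k := (c a).pos
  have h₁ := congrArg (· / k) h
  have h₂ := congrArg (· % k) h
  simp only [Nat.mul_add_div hk, Nat.div_eq_of_lt (c _).isLt, Nat.add_zero] at h₁
  simp only [Nat.mul_add_mod, Nat.mod_eq_of_lt (c _).isLt] at h₂
  exact ⟨h₁, c.injective (Fin.ext h₂)⟩

theorem mul_add_fin_lt (c : A ≃ Fin k) {s n : ℕ} (a : A) (h : s < n) : k * s + c a < k * n :=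
  calc k * s + c a < k * s + k := Nat.add_lt_add_left (c a).isLt _
    _ = k * (s + 1) := rfl
    _ ≤ k * n := Nat.mul_le_mul_left _ h

/-- The transition system of the numbers below `N`. -/
abbrev natLTS (c : A ≃ Fin k) (N : ℕ) : FinLTS A where
  State := Fin N
  finite_state := inferInstance
  tr := fun (t : Fin N) a (s : Fin N) => NatTr c t a s
  loop_free := by
    have key : ∀ (p q : Fin N) (w : List A),
        Path (fun (t : Fin N) a (s : Fin N) => NatTr c t a s) p w q → w = [] ∨ q < p := by
      intro p q w h
      induction h with
      | nil => exact .inl rfl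
      | cons h₁ h₂ ih =>
        right
        have := h₁.lt
        cases h₂ with
        | nil => exact this
        | cons => exact (ih.resolve_left (by simp)).trans this
    intro p w h
    exact (key p p w h).resolve_right (lt_irrefl p)

/-- A number below `N` as a process. -/
def natProc (c : A ≃ Fin k) {N : ℕ} (t : Fin N) : Proc A := ⟨natLTS c N, t⟩

theorem natLTS_depthLE (c : A ≃ Fin k) {N n : ℕ} {t : Fin N} (h : t.val < univSize k n) :
    (natLTS c N).DepthLE t n := by
  induction n generalizing t with
  | zero =>
    have h0 : t.val = 0 := by simpa [univSize] using h
    intro w hw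
    cases w with
    | nil => simp
    | cons a w =>
      obtain ⟨q, hq, -⟩ := (natLTS c N).cons_mem_traces.1 hw
      exact absurd (NatTr.lt hq) (by omega)
  | succ n ih => exact FinLTS.depthLE_succ fun a q hq => ih (NatTr.lt_univSize hq h)

open Classical in
/-- The number coding the state `p`, cut off at depth `n`. -/
noncomputable def FinLTS.code (c : A ≃ Fin k) (S : FinLTS A) : ℕ → S.State → ℕ
  | 0, _ => 0
  | n + 1, p => mask (fun i => decide (∃ a q, S.tr p a q ∧ i = k * S.code c n q + c a))
      (k * univSize k n)

/-! ### Codes of states, cut off at a given depth -/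

section Code

variable (c : A ≃ Fin k) (S : FinLTS A)

theorem code_lt (n : ℕ) (p : S.State) : S.code c n p < univSize k n := by
  cases n with
  | zero => simp [FinLTS.code, univSize]
  | succ n => exact mask_lt _ _

theorem natTr_code {n : ℕ} {p : S.State} {a : A} {s : ℕ} :
    NatTr c (S.code c (n + 1) p) a s ↔ ∃ q, S.tr p a q ∧ S.code c n q = s := by
  simp only [NatTr, FinLTS.code, testBit_mask, Bool.and_eq_true, decide_eq_true_eq]
  constructor
  · rintro ⟨-, b, q, hq, h⟩
    obtain ⟨rfl, rfl⟩ := mul_add_fin_inj c h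
    exact ⟨q, hq, rfl⟩
  · rintro ⟨q, hq, rfl⟩
    exact ⟨mul_add_fin_lt c a (code_lt c S n q), a, q, hq, rfl⟩

theorem not_natTr_zero {a : A} {s : ℕ} : ¬ NatTr c 0 a s := by simp [NatTr]

variable {S} {N : ℕ}

/-- Modal depth `n` cannot look further than `n` steps, so the cut-off does no harm, even for full
Hennessy–Milner logic. The universe `N` need only be large enough, so it can stay fixed while `n`
decreases in the induction. -/
theorem sat_code (hk : 1 ≤ k) {φ : HML A} {n : ℕ} (hφ : φ.md ≤ n) {p : S.State} {t : Fin N}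
    (ht : t.val = S.code c n p) (hN : univSize k n ≤ N) :
    (natLTS c N).Sat t φ ↔ S.Sat p φ := by
  induction φ generalizing n p t with
  | tt => simp [FinLTS.Sat]
  | ff => simp [FinLTS.Sat]
  | and φ ψ ih₁ ih₂ =>
    simp only [HML.md, max_le_iff] at hφ
    simp only [FinLTS.Sat, ih₁ hφ.1 ht hN, ih₂ hφ.2 ht hN]
  | or φ ψ ih₁ ih₂ =>
    simp only [HML.md, max_le_iff] at hφ
    simp only [FinLTS.Sat, ih₁ hφ.1 ht hN, ih₂ hφ.2 ht hN]
  | neg φ ih => simp only [FinLTS.Sat, ih hφ ht hN]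
  | dia a φ ih =>
    obtain ⟨n, rfl⟩ : ∃ m, n = m + 1 := ⟨n - 1, by simp [HML.md] at hφ; omega⟩
    have hN' := (univSize_le_succ hk n).trans hN
    have hφ' : φ.md ≤ n := by simpa [HML.md] using hφ
    constructor
    · rintro ⟨s, hs, h⟩
      have hs' : NatTr c t a s := hs
      rw [ht, natTr_code] at hs'
      obtain ⟨q, hq, hqs⟩ := hs'
      exact ⟨q, hq, (ih hφ' hqs.symm hN').1 h⟩
    · rintro ⟨q, hq, h⟩
      refine ⟨⟨S.code c n q, (code_lt c S n q).trans_le hN'⟩, ?_, (ih hφ' rfl hN').2 h⟩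
      change NatTr c t a _
      rw [ht, natTr_code]
      exact ⟨q, hq, rfl⟩
  | box a φ ih =>
    obtain ⟨n, rfl⟩ : ∃ m, n = m + 1 := ⟨n - 1, by simp [HML.md] at hφ; omega⟩
    have hN' := (univSize_le_succ hk n).trans hN
    have hφ' : φ.md ≤ n := by simpa [HML.md] using hφ
    constructor
    · intro h q hq
      refine (ih hφ' (t := ⟨S.code c n q, (code_lt c S n q).trans_le hN'⟩) rfl hN').1 (h _ ?_)
      change NatTr c t a _
      rw [ht, natTr_code]
      exact ⟨q, hq, rfl⟩
    · intro h s hs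
      have hs' : NatTr c t a s := hs
      rw [ht, natTr_code] at hs'
      obtain ⟨q, hq, hqs⟩ := hs'
      exact (ih hφ' hqs.symm hN').2 (h q hq)

theorem mem_traces_code (hk : 1 ≤ k) {n : ℕ} {p : S.State} {t : Fin N}
    (ht : t.val = S.code c n p) (hN : univSize k n ≤ N) {w : List A} (hw : w.length ≤ n) :
    w ∈ (natLTS c N).traces t ↔ w ∈ S.traces p := by
  have hmd : (HML.diaWord w).md = w.length := by
    induction w with
    | nil => rfl
    | cons a w ih => simp [HML.diaWord, HML.md, ih (by simp at hw; omega)]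
  rw [← FinLTS.sat_diaWord, ← FinLTS.sat_diaWord, sat_code c hk (hmd.trans_le hw) ht hN]

theorem traces_code (hk : 1 ≤ k) {n : ℕ} {p : S.State} {t : Fin N} (hd : S.DepthLE p n)
    (ht : t.val = S.code c n p) (hN : univSize k n ≤ N) :
    (natLTS c N).traces t = S.traces p := by
  have ht' := natLTS_depthLE c (ht.trans_lt (code_lt c S n p))
  ext w
  by_cases hw : w.length ≤ n
  · exact mem_traces_code c hk ht hN hw
  · exact ⟨fun h => absurd (ht' w h) hw, fun h => absurd (hd w h) hw⟩

/-- If the cut-off is not below the depth, nothing is lost and the code is bisimilar to the state.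
The level `m` is existentially quantified because it drops by one with each transition. -/
theorem code_simulation (hk : 1 ≤ k) {n : ℕ} {p : S.State} {t : Fin N} (hd : S.DepthLE p n)
    (ht : t.val = S.code c n p) (hN : univSize k n ≤ N) :
    (∀ a s, (natLTS c N).tr t a s → ∃ q, S.tr p a q ∧
      ∃ m, S.DepthLE q m ∧ s.val = S.code c m q ∧ univSize k m ≤ N) ∧
    ∀ a q, S.tr p a q → ∃ s, (natLTS c N).tr t a s ∧
      ∃ m, S.DepthLE q m ∧ s.val = S.code c m q ∧ univSize k m ≤ N := by
  cases n with
  | zero =>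
    constructor
    · intro a s hs
      have hs' : NatTr c t a s := hs
      rw [ht] at hs'
      exact absurd hs' (not_natTr_zero c)
    · intro a q hq
      simpa using hd [a] (S.cons_mem_traces.2 ⟨q, hq, S.nil_mem_traces q⟩)
  | succ n =>
    have hN' := (univSize_le_succ hk n).trans hN
    constructor
    · intro a s hs
      have hs' : NatTr c t a s := hs
      rw [ht, natTr_code] at hs'
      obtain ⟨q, hq, hqs⟩ := hs'
      exact ⟨q, hq, n, hd.of_tr hq, hqs.symm, hN'⟩
    · intro a q hq
      refine ⟨⟨S.code c n q, (code_lt c S n q).trans_le hN'⟩, ?_, n, hd.of_tr hq, rfl, hN'⟩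
      change NatTr c t a _
      rw [ht, natTr_code]
      exact ⟨q, hq, rfl⟩

theorem traceSimulated_code (hk : 1 ≤ k) {n : ℕ} {p : S.State} {t : Fin N} (hd : S.DepthLE p n)
    (ht : t.val = S.code c n p) (hN : univSize k n ≤ N) :
    TraceSimulated (natProc c t) ⟨S, p⟩ ∧ TraceSimulated ⟨S, p⟩ (natProc c t) := by
  constructor
  · refine ⟨fun t p => ∃ m, S.DepthLE p m ∧ t.val = S.code c m p ∧ univSize k m ≤ N,
      ⟨n, hd, ht, hN⟩, ?_⟩
    rintro t p ⟨m, hd, ht, hN⟩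
    exact ⟨(code_simulation c hk hd ht hN).1, traces_code c hk hd ht hN⟩
  · refine ⟨fun p t => ∃ m, S.DepthLE p m ∧ t.val = S.code c m p ∧ univSize k m ≤ N,
      ⟨n, hd, ht, hN⟩, ?_⟩
    rintro p t ⟨m, hd, ht, hN⟩
    exact ⟨(code_simulation c hk hd ht hN).2, (traces_code c hk hd ht hN).symm⟩

end Code

/-! ### Satisfiability and primality on processes of bounded depth -/

section Bounded

variable (c : A ≃ Fin k)

theorem exists_natProc {n N : ℕ} (hN : univSize k n ≤ N) (q : Proc A) :
    ∃ t : Fin N, t.val < univSize k n ∧ t.val = q.lts.code c n q.state :=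
  ⟨⟨_, (code_lt c q.lts n q.state).trans_le hN⟩, code_lt c q.lts n q.state, rfl⟩

theorem satisfiable_iff (hk : 1 ≤ k) {φ : HML A} {n : ℕ} (hn : φ.md ≤ n) :
    Satisfiable φ ↔ ∃ t : Fin (univSize k n), (natLTS c _).Sat t φ := by
  constructor
  · rintro ⟨q, hq⟩
    obtain ⟨t, -, ht⟩ := exists_natProc c le_rfl q
    exact ⟨t, (sat_code c hk hn ht le_rfl).2 hq⟩
  · rintro ⟨t, ht⟩
    exact ⟨natProc c t, ht⟩

/-- `p` is a least model of `φ` for the trace simulation preorder. -/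
def IsLeastModel (φ : HML A) (p : Proc A) : Prop :=
  p.Sat φ ∧ ∀ q : Proc A, q.Sat φ → TraceSimulated p q

/-- Whichever disjunct holds in the least model is inherited by all models. -/
theorem IsLeastModel.satisfiable_prime {φ : HML A} {p : Proc A} (h : IsLeastModel φ p) :
    Satisfiable φ ∧ PrimeIn (LTS A) φ := by
  refine ⟨⟨p, h.1⟩, fun φ₁ h₁ φ₂ h₂ he => ?_⟩
  exact (he p h.1).imp (fun hp q hq => (h.2 q hq).sat h₁ hp) fun hp q hq => (h.2 q hq).sat h₂ hp

theorem IsLeastModel.characteristicFor {φ : HML A} {p : Proc A} (h : IsLeastModel φ p)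
    (hφ : IsTS φ) : CharacteristicFor (LTS A) φ p :=
  ⟨hφ, fun q => ⟨fun hq _ hψ => ⟨hψ.1, (h.2 q hq).sat hψ.1 hψ.2⟩,
    fun hs => (hs (a := φ) ⟨hφ, h.1⟩).2⟩⟩

/-- Inclusion of satisfied formulae is turned into trace simulation by `traceSimulated_of_sat`. -/
theorem CharacteristicFor.isLeastModel {φ : HML A} {p : Proc A}
    (h : CharacteristicFor (LTS A) φ p) : IsLeastModel φ p :=
  ⟨(h.2 p).2 subset_rfl, fun q hq => traceSimulated_of_sat fun _ hψ hp =>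
    ((h.2 q).1 hq ⟨hψ, hp⟩).2⟩

/-- A satisfiable prime formula has a least model, whose depth is at most its modal depth. -/
theorem exists_isLeastModel [Fintype A] (c : A ≃ Fin k) (hk : 1 ≤ k) {φ : HML A}
    (hs : Satisfiable φ) (hp : PrimeIn (LTS A) φ) :
    ∃ p, p.depth ≤ φ.md ∧ IsLeastModel φ p := by
  classical
  by_contra hcon
  set d := φ.md with hd
  -- A model `t` that is not least fails to lie below some model `q`, and then a formula true in `t`
  -- and false in `q` is not entailed by `φ`.
  have hsep : ∀ t : Fin (univSize k d), ∃ ψ, IsTS ψ ∧ ((natLTS c _).Sat t φ →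
      (natLTS c _).Sat t ψ ∧ ¬ Entails φ ψ) := by
    intro t
    by_cases ht : (natLTS c _).Sat t φ
    · by_contra hne
      refine hcon ⟨natProc c t, Proc.depth_le_iff.2 (natLTS_depthLE c t.isLt), ht, fun q hq =>
        traceSimulated_of_sat fun ψ hψ htψ => ?_⟩
      by_contra hqψ
      exact hne ⟨ψ, hψ, fun _ => ⟨htψ, fun he => hqψ (he q hq)⟩⟩
    · exact ⟨.tt, .tt, fun h => absurd h ht⟩
  choose ψ h₁ h₂ using hsep
  -- The first disjunct covers the models deeper than `d`; the others cover the remaining models,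
  -- each equivalent to its code.
  let l : List (HML A) := HML.someTrace A (d + 1) ::
    ((Finset.univ.filter fun t => (natLTS c _).Sat t φ).toList.map ψ)
  have hl : ∀ χ ∈ l, IsTS χ := by
    intro χ hχ
    simp only [l, List.mem_cons, List.mem_map] at hχ
    rcases hχ with rfl | ⟨t, -, rfl⟩
    · exact isTS_someTrace _
    · exact h₁ t
  have he : Entails φ (HML.disj l) := by
    intro q hq
    refine q.lts.sat_disj.2 ?_
    by_cases hdq : ∃ w ∈ q.lts.traces q.state, w.length = d + 1
    · exact ⟨_, by simp [l], q.lts.sat_someTrace.2 hdq⟩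
    · have hD : q.lts.DepthLE q.state d :=
        q.lts.depthLE_of_no_trace fun w hw hn => hdq ⟨w, hw, hn⟩
      obtain ⟨t, -, ht⟩ := exists_natProc c (le_refl (univSize k d)) q
      have hsim := (traceSimulated_code c hk hD ht le_rfl).1
      have htφ := (sat_code c hk hd.ge ht le_rfl).2 hq
      exact ⟨ψ t, by simp [l]; exact .inr ⟨t, htφ, rfl⟩, hsim.sat (h₁ t) (h₂ t htφ).1⟩
  obtain ⟨χ, hχ, hent⟩ := hp.exists_of_disj hs hl he
  simp only [l, List.mem_cons, List.mem_map, Finset.mem_toList, Finset.mem_filter,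
    Finset.mem_univ, true_and] at hχ
  rcases hχ with rfl | ⟨t, ht, rfl⟩
  -- `φ` cannot force a trace of length `d + 1`: being satisfiable, it has a model among the codes
  -- of depth at most `d`.
  · obtain ⟨t, ht⟩ := (satisfiable_iff c hk hd.ge).1 hs
    obtain ⟨w, hw, hn⟩ := (natLTS c _).sat_someTrace.1 (hent (natProc c t) ht)
    have := natLTS_depthLE c t.isLt w hw
    omega
  · exact (h₂ t ht).2 hent

/-- Every model `q` turns out to have depth at most `φ.md`. Its cut-off at `φ.md + 1` is a model of
admissible depth and thus has the traces of `p`, none of length `φ.md + 1`; up to that length `q`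
and its cut-off have the same traces. -/
theorem isLeastModel_of_bounded (c : A ≃ Fin k) (hk : 1 ≤ k) {φ : HML A} {p : Proc A}
    (hpd : p.depth ≤ φ.md) (hp : p.Sat φ)
    (h : ∀ q : Proc A, q.depth ≤ φ.md + 1 → q.Sat φ → TraceSimulated p q) :
    IsLeastModel φ p := by
  refine ⟨hp, fun q hq => h q ?_ hq⟩
  obtain ⟨t, htn, ht⟩ := exists_natProc c (le_refl (univSize k (φ.md + 1))) q
  have hsim : TraceSimulated p (natProc c t) := h _ (Proc.depth_le_iff.2 (natLTS_depthLE c htn))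
    ((sat_code c hk (Nat.le_succ _) ht le_rfl).2 hq)
  rw [Proc.depth_le_iff] at hpd ⊢
  refine FinLTS.DepthLE.mono (q.lts.depthLE_of_no_trace fun w hw hn => ?_) (Nat.le_succ φ.md)
  rw [← mem_traces_code c hk ht le_rfl hn.le] at hw
  have := hpd w (by rw [hsim.traces_eq]; exact hw)
  omega

theorem satisfiable_prime_iff_exists_isLeastModel [Fintype A] (c : A ≃ Fin k) (hk : 1 ≤ k)
    {φ : HML A} : (Satisfiable φ ∧ PrimeIn (LTS A) φ) ↔ ∃ p, IsLeastModel φ p :=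
  ⟨fun h => (exists_isLeastModel c hk h.1 h.2).imp fun _ h => h.2,
    fun ⟨_, h⟩ => h.satisfiable_prime⟩

theorem satisfiable_prime_iff_bounded [Fintype A] (c : A ≃ Fin k) (hk : 1 ≤ k) {φ : HML A} :
    (Satisfiable φ ∧ PrimeIn (LTS A) φ) ↔ ∃ p : Proc A, p.depth ≤ φ.md ∧ p.Sat φ ∧
      ∀ q : Proc A, q.depth ≤ φ.md + 1 → q.Sat φ → TraceSimulated p q := by
  constructor
  · intro h
    obtain ⟨p, hd, hp⟩ := exists_isLeastModel c hk h.1 h.2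
    exact ⟨p, hd, hp.1, fun q _ => hp.2 q⟩
  · rintro ⟨p, hd, hp, h⟩
    exact (isLeastModel_of_bounded c hk hd hp h).satisfiable_prime

theorem characteristicIn_iff [Fintype A] (c : A ≃ Fin k) (hk : 1 ≤ k) {φ : HML A}
    (hφ : IsTS φ) :
    CharacteristicIn (LTS A) φ ↔ Satisfiable φ ∧ PrimeIn (LTS A) φ := by
  rw [satisfiable_prime_iff_exists_isLeastModel c hk]
  exact ⟨fun ⟨p, h⟩ => ⟨p, h.isLeastModel⟩, fun ⟨p, h⟩ => ⟨p, h.characteristicFor hφ⟩⟩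

/-- Satisfiability together with primality, on the numbers coding processes of depth at most the
modal depth plus one. -/
theorem satisfiable_prime_iff_nat [Fintype A] (c : A ≃ Fin k) (hk : 1 ≤ k) {φ : HML A} :
    (Satisfiable φ ∧ PrimeIn (LTS A) φ) ↔ ∃ t : Fin (univSize k (φ.md + 1)),
      t.val < univSize k φ.md ∧ (natLTS c _).Sat t φ ∧
      ∀ s : Fin (univSize k (φ.md + 1)), (natLTS c _).Sat s φ →
        TraceSimulated (natProc c t) (natProc c s) := by
  have hU := univSize_le_succ hk φ.md
  constructor
  · intro h
    obtain ⟨p, hd, hp⟩ := exists_isLeastModel c hk h.1 h.2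
    obtain ⟨t, htn, ht⟩ := exists_natProc c hU p
    have hsim := (traceSimulated_code c hk (Proc.depth_le_iff.1 hd) ht hU).1
    exact ⟨t, htn, (sat_code c hk le_rfl ht hU).2 hp.1, fun s hs => hsim.trans (hp.2 _ hs)⟩
  · rintro ⟨t, htn, ht, h⟩
    refine (satisfiable_prime_iff_bounded c hk).2
      ⟨natProc c t, Proc.depth_le_iff.2 (natLTS_depthLE c htn), ht, fun q hqd hq => ?_⟩
    obtain ⟨s, -, hs⟩ := exists_natProc c (le_refl (univSize k (φ.md + 1))) q
    have hsim := (traceSimulated_code c hk (Proc.depth_le_iff.1 hqd) hs le_rfl).1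
    exact (h s ((sat_code c hk (Nat.le_succ _) hs le_rfl).2 hq)).trans hsim

/-- An unsatisfiable formula entails everything and so is prime. -/
theorem primeIn_iff_or (φ : HML A) :
    PrimeIn (LTS A) φ ↔ ¬ Satisfiable φ ∨ (Satisfiable φ ∧ PrimeIn (LTS A) φ) := by
  by_cases hs : Satisfiable φ
  · simp [hs]
  · simp only [hs, not_false_eq_true, false_and, or_false, iff_true]
    exact fun φ₁ _ φ₂ _ _ => .inl fun p hp => absurd ⟨p, hp⟩ hs

end Bounded

end TraceSim

namespace TraceSim

variable {A : Type} {k : ℕ}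

/-! ### Values of formulae and evaluation of strings -/

/-- The value with model set `m`, modal depth `e` and syntactic rank `r`, as a number. The rank of
a formula is `2` if it is of the form `[a₁]⋯[aₙ]ff`, `1` if it is another formula of `L_TS`, and
`0` if it is not in `L_TS`. -/
def mkVal (m e r : ℕ) : ℕ := Nat.pair m (Nat.pair e r)

def valMask (v : ℕ) : ℕ := v.unpair.1

def valDepth (v : ℕ) : ℕ := v.unpair.2.unpair.1

def valRank (v : ℕ) : ℕ := v.unpair.2.unpair.2

@[simp] theorem valMask_mkVal (m e r : ℕ) : valMask (mkVal m e r) = m := by simp [valMask, mkVal]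

@[simp] theorem valDepth_mkVal (m e r : ℕ) : valDepth (mkVal m e r) = e := by
  simp [valDepth, mkVal]

@[simp] theorem valRank_mkVal (m e r : ℕ) : valRank (mkVal m e r) = r := by simp [valRank, mkVal]

/-- Values of formulae are below this bound. -/
def valBound (k d : ℕ) : ℕ := mkVal (2 ^ univSize k (d + 1)) (d + 1) 2

/-- Pairing is strictly monotone in each argument, and the mask is strictly below its bound. -/
theorem mkVal_lt_valBound {k d m e r : ℕ} (hm : m < 2 ^ univSize k (d + 1)) (he : e ≤ d + 1)
    (hr : r ≤ 2) : mkVal m e r < valBound k d := by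
  have h₁ : Nat.pair e r ≤ Nat.pair (d + 1) 2 :=
    calc Nat.pair e r ≤ Nat.pair (d + 1) r := by
          rcases he.eq_or_lt with rfl | h
          · rfl
          · exact (Nat.pair_lt_pair_left r h).le
      _ ≤ Nat.pair (d + 1) 2 := by
          rcases hr.eq_or_lt with rfl | h
          · rfl
          · exact (Nat.pair_lt_pair_right _ h).le
  refine lt_of_lt_of_le (Nat.pair_lt_pair_left _ hm) ?_
  rcases h₁.eq_or_lt with h | h
  · rw [h]; rfl
  · exact (Nat.pair_lt_pair_right _ h).le

theorem valBound_pos (k d : ℕ) : 0 < valBound k d :=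
  (Nat.zero_le _).trans_lt (mkVal_lt_valBound (m := 0) (e := 0) (r := 0) (by positivity)
    (by omega) (by omega))

/-- The value of a formula from the values of its immediate subformulae; modal depths are cut off
at `d + 1`. -/
def symbVal (c : A ≃ Fin k) (d : ℕ) (s : Symb A) (v w : ℕ) : ℕ :=
  let N := univSize k (d + 1)
  match s with
  | .tt => mkVal (mask (fun _ => true) N) 0 1
  | .ff => mkVal 0 0 2
  | .and => mkVal (mask (fun i => (valMask v).testBit i && (valMask w).testBit i) N)
      (min (max (valDepth v) (valDepth w)) (d + 1)) (min 1 (min (valRank v) (valRank w)))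
  | .or => mkVal (mask (fun i => (valMask v).testBit i || (valMask w).testBit i) N)
      (min (max (valDepth v) (valDepth w)) (d + 1)) (min 1 (min (valRank v) (valRank w)))
  | .dia a => mkVal
      (mask (fun t => decide (∃ s < N, t.testBit (k * s + c a) ∧ (valMask v).testBit s)) N)
      (min (valDepth v + 1) (d + 1)) (min 1 (valRank v))
  | .box a => mkVal
      (mask (fun t => decide (∀ s < N, t.testBit (k * s + c a) → (valMask v).testBit s)) N)
      (min (valDepth v + 1) (d + 1)) (if valRank v = 2 then 2 else 0)
  | .neg => mkVal (mask (fun i => !(valMask v).testBit i) N) (min (valDepth v) (d + 1)) 0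

theorem symbVal_lt (c : A ≃ Fin k) (d : ℕ) (s : Symb A) (v w : ℕ) :
    symbVal c d s v w < valBound k d := by
  cases s <;> simp only [symbVal] <;> refine mkVal_lt_valBound ?_ ?_ ?_ <;>
    first
    | exact mask_lt _ _
    | positivity
    | omega
    | (split_ifs <;> omega)

/-- The value of a formula. -/
def formVal (c : A ≃ Fin k) (d : ℕ) : HML A → ℕ
  | .tt => symbVal c d .tt 0 0
  | .ff => symbVal c d .ff 0 0
  | .and φ ψ => symbVal c d .and (formVal c d φ) (formVal c d ψ)
  | .or φ ψ => symbVal c d .or (formVal c d φ) (formVal c d ψ)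
  | .dia a φ => symbVal c d (.dia a) (formVal c d φ) 0
  | .box a φ => symbVal c d (.box a) (formVal c d φ) 0
  | .neg φ => symbVal c d .neg (formVal c d φ) 0

theorem isTSBox_box_iff {a : A} {φ : HML A} : IsTSBox (.box a φ) ↔ IsTSBox φ :=
  ⟨fun h => by cases h; assumption, .box a⟩

/-- Cutting off at `d + 1` and not at `d` keeps the values finite in number while modal depth
exactly `d` remains recognizable. -/
theorem valDepth_formVal (c : A ≃ Fin k) (d : ℕ) (φ : HML A) :
    valDepth (formVal c d φ) = min φ.md (d + 1) := by
  induction φ <;> simp only [formVal, symbVal, HML.md, valDepth_mkVal] <;> omega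

theorem isTS_and_iff {φ ψ : HML A} : IsTS (.and φ ψ) ↔ IsTS φ ∧ IsTS ψ := by
  constructor
  · intro h
    cases h with
    | and h₁ h₂ => exact ⟨h₁, h₂⟩
    | ofBox h => cases h
  · exact fun h => .and h.1 h.2

theorem isTS_or_iff {φ ψ : HML A} : IsTS (.or φ ψ) ↔ IsTS φ ∧ IsTS ψ := by
  constructor
  · intro h
    cases h with
    | or h₁ h₂ => exact ⟨h₁, h₂⟩
    | ofBox h => cases h
  · exact fun h => .or h.1 h.2

theorem isTS_dia_iff {a : A} {φ : HML A} : IsTS (.dia a φ) ↔ IsTS φ := by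
  constructor
  · intro h
    cases h with
    | dia _ h => exact h
    | ofBox h => cases h
  · exact .dia a

theorem isTS_box_iff {a : A} {φ : HML A} : IsTS (.box a φ) ↔ IsTSBox φ := by
  constructor
  · intro h
    cases h with
    | ofBox h => exact isTSBox_box_iff.1 h
  · exact fun h => .ofBox (.box a h)

theorem not_isTS_neg {φ : HML A} : ¬ IsTS (.neg φ) := by
  intro h
  cases h with
  | ofBox h => cases h

/-- Both equivalences are proved at once: a box belongs to the logic only if its body has rank `2`,
not merely rank at least `1`. -/
theorem valRank_formVal (c : A ≃ Fin k) (d : ℕ) (φ : HML A) :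
    (1 ≤ valRank (formVal c d φ) ↔ IsTS φ) ∧ (valRank (formVal c d φ) = 2 ↔ IsTSBox φ) := by
  induction φ with
  | tt => exact ⟨by simp [formVal, symbVal, IsTS.tt], by simp [formVal, symbVal]; nofun⟩
  | ff => simp [formVal, symbVal, IsTS.ff, IsTSBox.ff]
  | and φ ψ ih₁ ih₂ =>
    refine ⟨?_, iff_of_false ?_ nofun⟩
    · rw [isTS_and_iff, ← ih₁.1, ← ih₂.1]
      simp only [formVal, symbVal, valRank_mkVal]
      omega
    · simp only [formVal, symbVal, valRank_mkVal]
      omega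
  | or φ ψ ih₁ ih₂ =>
    refine ⟨?_, iff_of_false ?_ nofun⟩
    · rw [isTS_or_iff, ← ih₁.1, ← ih₂.1]
      simp only [formVal, symbVal, valRank_mkVal]
      omega
    · simp only [formVal, symbVal, valRank_mkVal]
      omega
  | dia a φ ih =>
    refine ⟨?_, iff_of_false ?_ nofun⟩
    · rw [isTS_dia_iff, ← ih.1]
      simp only [formVal, symbVal, valRank_mkVal]
      omega
    · simp only [formVal, symbVal, valRank_mkVal]
      omega
  | box a φ ih =>
    rw [isTS_box_iff, isTSBox_box_iff, ← ih.2]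
    simp only [formVal, symbVal, valRank_mkVal]
    split_ifs with h <;> simp [h]
  | neg φ ih => exact ⟨iff_of_false (by simp [formVal, symbVal]) not_isTS_neg,
      iff_of_false (by simp [formVal, symbVal]) nofun⟩

/-- The numbers below `univSize k (d + 1)` are closed under transitions, so one universe serves all
subformulae and the mask is compositional. No bound on the modal depth of `φ` is needed here. -/
theorem testBit_valMask_formVal (c : A ≃ Fin k) (d : ℕ) (φ : HML A)
    (t : Fin (univSize k (d + 1))) :
    (valMask (formVal c d φ)).testBit t = true ↔ (natLTS c _).Sat t φ := by
  induction φ generalizing t with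
  | tt => simp [formVal, symbVal, testBit_mask, FinLTS.Sat]
  | ff => simp [formVal, symbVal, FinLTS.Sat]
  | and φ ψ ih₁ ih₂ => simp [formVal, symbVal, testBit_mask, FinLTS.Sat, ← ih₁, ← ih₂]
  | or φ ψ ih₁ ih₂ => simp [formVal, symbVal, testBit_mask, FinLTS.Sat, ← ih₁, ← ih₂]
  | dia a φ ih =>
    simp only [formVal, symbVal, valMask_mkVal, testBit_mask, t.isLt, decide_true, Bool.true_and,
      decide_eq_true_eq, FinLTS.Sat, ← ih]
    exact ⟨fun ⟨s, hs, h₁, h₂⟩ => ⟨⟨s, hs⟩, h₁, h₂⟩, fun ⟨s, h₁, h₂⟩ => ⟨s, s.isLt, h₁, h₂⟩⟩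
  | box a φ ih =>
    simp only [formVal, symbVal, valMask_mkVal, testBit_mask, t.isLt, decide_true, Bool.true_and,
      decide_eq_true_eq, FinLTS.Sat, ← ih]
    exact ⟨fun h s hs => h s s.isLt hs, fun h s hs h₁ => h ⟨s, hs⟩ h₁⟩
  | neg φ ih => simp [formVal, symbVal, testBit_mask, FinLTS.Sat, ← ih]

/-- The number of arguments of a symbol. -/
def Symb.arity : Symb A → Fin 3
  | .tt => 0
  | .ff => 0
  | .and => 2
  | .or => 2
  | .dia _ => 1
  | .box _ => 1
  | .neg => 1

/-- Replaces the arguments of an operator on a stack of values by its result; missing arguments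
count as `z`. -/
def applyOp {α : Type} (z : α) (n : Fin 3) (f : α → α → α) (l : List α) : List α :=
  match n with
  | 0 => f z z :: l
  | 1 => f (l.headD z) z :: l.tail
  | 2 => f (l.headD z) (l.tail.headD z) :: l.tail.tail

theorem map_headD {α β : Type} (h : α → β) (z : α) (l : List α) :
    (l.map h).headD (h z) = h (l.headD z) := by
  cases l <;> rfl

/-- This relates the stack of bounded values held by the linear-time machine to the stack of plain
numbers. -/
theorem map_applyOp {α β : Type} (h : α → β) (z : α) (n : Fin 3) {f : α → α → α}
    {f' : β → β → β} (hf : ∀ v w, h (f v w) = f' (h v) (h w)) (l : List α) :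
    (applyOp z n f l).map h = applyOp (h z) n f' (l.map h) := by
  match n with
  | 0 | 1 | 2 => simp [applyOp, hf, ← List.map_tail]

theorem applyOp_lt {n : Fin 3} {f : ℕ → ℕ → ℕ} {B : ℕ} (hf : ∀ v w, f v w < B) {l : List ℕ}
    (hl : ∀ v ∈ l, v < B) : ∀ v ∈ applyOp 0 n f l, v < B := by
  have h₁ : ∀ v ∈ l.tail, v < B := fun v hv => hl v (List.mem_of_mem_tail hv)
  have h₂ : ∀ v ∈ l.tail.tail, v < B := fun v hv => h₁ v (List.mem_of_mem_tail hv)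
  intro v hv
  match n with
  | 0 | 1 | 2 =>
    rcases List.mem_cons.1 hv with rfl | hv
    · exact hf _ _
    · first
      | exact hl v hv
      | exact h₁ v hv
      | exact h₂ v hv

theorem length_applyOp_le {α : Type} (z : α) (n : Fin 3) (f : α → α → α) (l : List α) :
    (applyOp z n f l).length ≤ l.length + 1 := by
  match n with
  | 0 | 1 | 2 => simp [applyOp] <;> omega

/-- The stack of values obtained by evaluating a string from right to left. -/
def evalStack (c : A ≃ Fin k) (d : ℕ) (x : List (Symb A)) : List ℕ :=
  x.foldr (fun s => applyOp 0 s.arity (symbVal c d s)) []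

theorem evalStack_lt (c : A ≃ Fin k) (d : ℕ) (x : List (Symb A)) :
    ∀ v ∈ evalStack c d x, v < valBound k d := by
  induction x with
  | nil => simp [evalStack]
  | cons s x ih => exact applyOp_lt (symbVal_lt c d s) ih

theorem length_evalStack_le (c : A ≃ Fin k) (d : ℕ) (x : List (Symb A)) :
    (evalStack c d x).length ≤ x.length := by
  induction x with
  | nil => simp [evalStack]
  | cons s x ih => exact (length_applyOp_le _ _ _ _).trans (by simpa [evalStack] using ih)

/-- Read from right to left, Polish notation puts the arguments on the stack before their operator,
the first argument on top. -/
theorem evalStack_encode_append (c : A ≃ Fin k) (d : ℕ) (φ : HML A) (x : List (Symb A)) :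
    evalStack c d (φ.encode ++ x) = formVal c d φ :: evalStack c d x := by
  induction φ generalizing x with
  | tt => rfl
  | ff => rfl
  | and φ ψ ih₁ ih₂ | or φ ψ ih₁ ih₂ =>
    simp only [HML.encode, List.cons_append, List.append_assoc]
    simp only [evalStack, List.foldr_cons] at ih₁ ih₂ ⊢
    rw [ih₁, ih₂]
    rfl
  | dia a φ ih | box a φ ih | neg φ ih =>
    simp only [HML.encode, List.cons_append]
    simp only [evalStack, List.foldr_cons] at ih ⊢
    rw [ih]
    rfl

/-- A value comes from the formula `φ`, or, if there is none, has rank `0`. -/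
def ValOf (c : A ≃ Fin k) (d : ℕ) (v : ℕ) : Option (HML A) → Prop
  | none => valRank v = 0
  | some φ => v = formVal c d φ

theorem valOf_headD (c : A ≃ Fin k) (d : ℕ) {l : List ℕ} {o : List (Option (HML A))}
    (h : List.Forall₂ (ValOf c d) l o) : ValOf c d (l.headD 0) (o.headD none) := by
  cases h with
  | nil => simp [ValOf, valRank]
  | cons h _ => exact h

theorem forall₂_tail {α β : Type*} {R : α → β → Prop} {l : List α} {o : List β}
    (h : List.Forall₂ R l o) : List.Forall₂ R l.tail o.tail := by
  cases h with
  | nil => exact .nil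
  | cons _ h => exact h

/-- The concatenation of the strings of a list of formulae. -/
def unparse (o : List (Option (HML A))) : List (Symb A) :=
  (o.map fun p => (p.map HML.encode).getD []).flatten

/-- This is what rejects ill-formed strings. A missing argument is read as `0`, whose rank is `0`,
and every operator passes rank `0` on. A value of positive rank therefore comes from a real formula,
and if no entry is `none` the string is the concatenation of the formulae on the stack. -/
theorem exists_parse (c : A ≃ Fin k) (d : ℕ) (x : List (Symb A)) :
    ∃ o : List (Option (HML A)), List.Forall₂ (ValOf c d) (evalStack c d x) o ∧
      (none ∉ o → x = unparse o) := by
  induction x with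
  | nil => exact ⟨[], .nil, fun _ => rfl⟩
  | cons s x ih =>
    obtain ⟨o, h, hx⟩ := ih
    have hv := valOf_headD c d h
    have hw := valOf_headD c d (forall₂_tail h)
    change ∃ o', List.Forall₂ _ (applyOp 0 s.arity (symbVal c d s) (evalStack c d x)) o' ∧ _
    generalize evalStack c d x = l at h hv hw
    cases s with
    | tt => exact ⟨some .tt :: o, .cons rfl h, fun hn => by
        simp [hx (by simp_all), unparse, HML.encode]⟩
    | ff => exact ⟨some .ff :: o, .cons rfl h, fun hn => by
        simp [hx (by simp_all), unparse, HML.encode]⟩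
    | and =>
      refine ⟨(o.headD none).bind (fun φ => (o.tail.headD none).map (.and φ)) :: o.tail.tail,
        .cons ?_ (forall₂_tail (forall₂_tail h)), ?_⟩
      · rcases h₁ : o.headD none with _ | φ
        · rw [h₁] at hv
          simp_all [ValOf, symbVal]
        · rcases h₂ : o.tail.headD none with _ | ψ
          · rw [h₂] at hw
            simp_all [ValOf, symbVal]
          · rw [h₁] at hv
            rw [h₂] at hw
            simp_all [ValOf, formVal]
      · rcases o with _ | ⟨_ | φ, _ | ⟨_ | ψ, o⟩⟩ <;> simp_all [unparse, HML.encode]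
    | or =>
      refine ⟨(o.headD none).bind (fun φ => (o.tail.headD none).map (.or φ)) :: o.tail.tail,
        .cons ?_ (forall₂_tail (forall₂_tail h)), ?_⟩
      · rcases h₁ : o.headD none with _ | φ
        · rw [h₁] at hv
          simp_all [ValOf, symbVal]
        · rcases h₂ : o.tail.headD none with _ | ψ
          · rw [h₂] at hw
            simp_all [ValOf, symbVal]
          · rw [h₁] at hv
            rw [h₂] at hw
            simp_all [ValOf, formVal]
      · rcases o with _ | ⟨_ | φ, _ | ⟨_ | ψ, o⟩⟩ <;> simp_all [unparse, HML.encode]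
    | dia a =>
      refine ⟨(o.headD none).map (.dia a) :: o.tail, .cons ?_ (forall₂_tail h), ?_⟩
      · rcases h₁ : o.headD none with _ | φ <;> rw [h₁] at hv <;> simp_all [ValOf, symbVal, formVal]
      · rcases o with _ | ⟨_ | φ, o⟩ <;> simp_all [unparse, HML.encode]
    | box a =>
      refine ⟨(o.headD none).map (.box a) :: o.tail, .cons ?_ (forall₂_tail h), ?_⟩
      · rcases h₁ : o.headD none with _ | φ <;> rw [h₁] at hv <;> simp_all [ValOf, symbVal, formVal]
      · rcases o with _ | ⟨_ | φ, o⟩ <;> simp_all [unparse, HML.encode]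
    | neg =>
      refine ⟨(o.headD none).map .neg :: o.tail, .cons ?_ (forall₂_tail h), ?_⟩
      · rcases h₁ : o.headD none with _ | φ <;> rw [h₁] at hv <;> simp_all [ValOf, symbVal, formVal]
      · rcases o with _ | ⟨_ | φ, o⟩ <;> simp_all [unparse, HML.encode]

/-- The value `v` is that of a formula of `L_TS` of modal depth `d` whose model set satisfies
`P`. -/
def AcceptVal (P : ℕ → ℕ → Prop) (d v : ℕ) : Prop :=
  1 ≤ valRank v ∧ valDepth v = d ∧ P d (valMask v)

theorem acceptVal_evalStack_iff (c : A ≃ Fin k) {P : ℕ → ℕ → Prop} {Q : HML A → Prop}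
    (hP : ∀ φ, IsTS φ → (P φ.md (valMask (formVal c φ.md φ)) ↔ Q φ)) (d : ℕ)
    (x : List (Symb A)) :
    ((evalStack c d x).tail = [] ∧ AcceptVal P d ((evalStack c d x).headD 0)) ↔
      ∃ φ, IsTS φ ∧ φ.md = d ∧ Q φ ∧ x = φ.encode := by
  constructor
  · rintro ⟨ht, hr, hd, hp⟩
    obtain ⟨o, ho, hx⟩ := exists_parse c d x
    generalize evalStack c d x = l at *
    rcases l with _ | ⟨v, _ | _⟩
    -- The empty stack yields the default `0`, which has rank `0` and is not accepted.
    · simp [valRank] at hr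
    · simp only [List.headD_cons] at hr hd hp
      rcases o with _ | ⟨_ | φ, o⟩
      · cases ho
      · simp only [List.forall₂_cons, ValOf] at ho
        omega
      · simp only [List.forall₂_cons, ValOf, List.forall₂_nil_left_iff] at ho
        obtain ⟨rfl, rfl⟩ := ho
        have hts := (valRank_formVal c d φ).1.1 hr
        rw [valDepth_formVal] at hd
        have hd' : φ.md = d := by omega
        subst hd'
        exact ⟨φ, hts, rfl, (hP φ hts).1 hp, by simpa [unparse] using hx⟩
    · simp at ht
  · rintro ⟨φ, hts, rfl, hq, rfl⟩
    have := evalStack_encode_append c φ.md φ []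
    rw [List.append_nil] at this
    rw [this]
    refine ⟨rfl, (valRank_formVal c _ φ).1.2 hts, ?_, (hP φ hts).2 hq⟩
    simp [valDepth_formVal]

end TraceSim

namespace TraceSim

variable {A : Type} {k : ℕ}

/-! ### The preorder on numbers by bounded quantifiers -/

/-- `E` is the code of a relation on the numbers below `N` that witnesses inclusion of traces: the
process `u'` has no transitions but those of the `a`-successors of `u`. -/
def TraceInclWitness (k N E : ℕ) : Prop :=
  ∀ t < N, ∀ u < N, E.testBit (t * N + u) → ∀ a < k, ∀ t' < N, t.testBit (k * t' + a) →
    (∃ u' < N, u.testBit (k * u' + a)) ∧ ∃ u' < N, E.testBit (t' * N + u') ∧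
      ∀ b < k, ∀ v < N, u'.testBit (k * v + b) →
        ∃ u'' < N, u.testBit (k * u'' + a) ∧ u''.testBit (k * v + b)

/-- Inclusion of the traces of the numbers `t` and `u` below `N`. -/
def NatTraceIncl (k N t u : ℕ) : Prop :=
  ∃ E < 2 ^ (N * N), E.testBit (t * N + u) ∧ TraceInclWitness k N E

/-- `R` is the code of a trace simulation on the numbers below `N`. -/
def SimWitness (k N R : ℕ) : Prop :=
  ∀ s < N, ∀ t < N, R.testBit (s * N + t) →
    (∀ a < k, ∀ s' < N, s.testBit (k * s' + a) →
      ∃ t' < N, t.testBit (k * t' + a) ∧ R.testBit (s' * N + t')) ∧ NatTraceIncl k N t s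

/-- The trace simulation preorder on the numbers below `N`. -/
def NatSim (k N p q : ℕ) : Prop :=
  ∃ R < 2 ^ (N * N), R.testBit (p * N + q) ∧ SimWitness k N R

theorem exists_relCode {N : ℕ} (r : ℕ → ℕ → Prop) :
    ∃ E < 2 ^ (N * N), ∀ s < N, ∀ t < N, (E.testBit (s * N + t) = true ↔ r s t) := by
  classical
  refine ⟨mask (fun i => decide (r (i / N) (i % N))) (N * N), mask_lt _ _, fun s hs t ht => ?_⟩
  have hlt : s * N + t < N * N :=
    calc s * N + t < s * N + N := Nat.add_lt_add_left ht _
      _ = (s + 1) * N := by ring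
      _ ≤ N * N := Nat.mul_le_mul_right _ hs
  have hN : 0 < N := by omega
  rw [testBit_mask, mul_comm s N, Nat.mul_add_div hN, Nat.mul_add_mod, Nat.div_eq_of_lt ht,
    Nat.mod_eq_of_lt ht, mul_comm N s]
  simp [hlt]

section

variable (c : A ≃ Fin k)

/-- `u'` stands for all `a`-successors of `u` together: a trace `b :: w` of `u'` starts with a
transition of one of them, which is where the trace of `u` continues. For the empty rest `u'` says
nothing, whence the separate clause that `u` has an `a`-successor. -/
theorem mem_traces_of_witness {N E : ℕ} (hE : TraceInclWitness k N E) {w : List A} {t u : Fin N}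
    (htu : E.testBit (t * N + u)) (hw : w ∈ (natLTS c N).traces t) :
    w ∈ (natLTS c N).traces u := by
  induction w generalizing t u with
  | nil => exact (natLTS c N).nil_mem_traces u
  | cons a w ih =>
    obtain ⟨t', ht', hw⟩ := (natLTS c N).cons_mem_traces.1 hw
    obtain ⟨⟨x, hx, hux⟩, u', hu', htu', hm⟩ :=
      hE t t.isLt u u.isLt htu (c a) (c a).isLt t' t'.isLt ht'
    have hw' := ih (u := ⟨u', hu'⟩) htu' hw
    rw [(natLTS c N).cons_mem_traces]
    cases w with
    | nil => exact ⟨⟨x, hx⟩, hux, (natLTS c N).nil_mem_traces _⟩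
    | cons b w =>
      obtain ⟨v, hv, hw'⟩ := (natLTS c N).cons_mem_traces.1 hw'
      obtain ⟨u'', hu'', h₁, h₂⟩ := hm (c b) (c b).isLt v v.isLt hv
      exact ⟨⟨u'', hu''⟩, h₁, (natLTS c N).cons_mem_traces.2 ⟨v, h₂, hw'⟩⟩

/-- The union of the `a`-successors of a process. -/
theorem exists_merge {n N : ℕ} (hN : N = univSize k n) (u : Fin N) (a : ℕ) :
    ∃ u' : Fin N, ∀ i, u'.val.testBit i = true ↔
      ∃ s < N, u.val.testBit (k * s + a) = true ∧ s.testBit i = true := by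
  subst hN
  cases n with
  | zero =>
    refine ⟨u, fun i => ?_⟩
    have hu : u.val = 0 := by
      have := u.isLt
      simp only [univSize] at this
      omega
    simp [hu]
  | succ n =>
    refine ⟨⟨mask (fun i => decide (∃ s < univSize k (n + 1), u.val.testBit (k * s + a) = true ∧
      s.testBit i = true)) (k * univSize k n), mask_lt _ _⟩, fun i => ?_⟩
    simp only [testBit_mask, Bool.and_eq_true, decide_eq_true_eq, and_iff_right_iff_imp]
    -- Digits of numbers below `2 ^ (k * univSize k n)` lie below the exponent, so the mask
    -- truncates nothing and the union stays in the universe.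
    rintro ⟨s, hs, -, hi⟩
    have h₁ : 2 ^ i < 2 ^ (k * univSize k n) := (Nat.ge_two_pow_of_testBit hi).trans_lt hs
    exact (Nat.pow_lt_pow_iff_right (by norm_num)).1 h₁

/-- Trace inclusion is no simulation, but it becomes one once the right-hand side is made
deterministic by merging its `a`-successors. The hypothesis on `N` ensures that the universe is
closed under merging. -/
theorem natTraceIncl_iff {n N : ℕ} (hN : N = univSize k n) (t u : Fin N) :
    NatTraceIncl k N t u ↔ (natLTS c N).traces t ⊆ (natLTS c N).traces u := by
  constructor
  · rintro ⟨E, -, htu, hE⟩ w hw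
    exact mem_traces_of_witness c hE htu hw
  · intro h
    obtain ⟨E, hEN, hE⟩ := exists_relCode (N := N) fun t u => ∃ (ht : t < N) (hu : u < N),
      (natLTS c N).traces ⟨t, ht⟩ ⊆ (natLTS c N).traces ⟨u, hu⟩
    refine ⟨E, hEN, (hE t t.isLt u u.isLt).2 ⟨t.isLt, u.isLt, h⟩, ?_⟩
    intro t ht u hu htu a ha t' ht' htt'
    obtain ⟨_, _, h⟩ := (hE t ht u hu).1 htu
    obtain ⟨b, rfl⟩ : ∃ b, a = c b := ⟨c.symm ⟨a, ha⟩, by simp⟩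
    have hs : ∀ w ∈ (natLTS c N).traces ⟨t', ht'⟩,
        ∃ q, (natLTS c N).tr ⟨u, hu⟩ b q ∧ w ∈ (natLTS c N).traces q := fun w hw =>
      (natLTS c N).cons_mem_traces.1 (h ((natLTS c N).cons_mem_traces.2 ⟨⟨t', ht'⟩, htt', hw⟩))
    obtain ⟨u', hu'⟩ := exists_merge hN ⟨u, hu⟩ (c b)
    refine ⟨?_, u', u'.isLt, (hE t' ht' u' u'.isLt).2 ⟨ht', u'.isLt, fun w hw => ?_⟩, ?_⟩
    · obtain ⟨q, hq, -⟩ := hs [] ((natLTS c N).nil_mem_traces _)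
      exact ⟨q, q.isLt, hq⟩
    · cases w with
      | nil => exact (natLTS c N).nil_mem_traces _
      | cons e w =>
        obtain ⟨q, hq, hw⟩ := hs _ hw
        obtain ⟨v, hv, hw⟩ := (natLTS c N).cons_mem_traces.1 hw
        exact (natLTS c N).cons_mem_traces.2 ⟨v, (hu' _).2 ⟨q, q.isLt, hq, hv⟩, hw⟩
    · intro e _ v _ hv
      exact (hu' _).1 hv

theorem natSim_iff {n N : ℕ} (hN : N = univSize k n) (p q : Fin N) :
    NatSim k N p q ↔ TraceSimulated (natProc c p) (natProc c q) := by
  constructor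
  · rintro ⟨R, -, hpq, hR⟩
    refine ⟨fun s t : Fin N => R.testBit (s * N + t) = true, hpq, fun (s t : Fin N) hst => ?_⟩
    -- Simulation alone gives one inclusion of traces; `SimWitness` asks only for the other.
    have hsim : ∀ s t : Fin N, R.testBit (s * N + t) = true → ∀ w,
        w ∈ (natLTS c N).traces s → w ∈ (natLTS c N).traces t := by
      intro s t hst w
      induction w generalizing s t with
      | nil => exact fun _ => (natLTS c N).nil_mem_traces t
      | cons a w ih =>
        intro hw
        obtain ⟨s', hs', hw⟩ := (natLTS c N).cons_mem_traces.1 hw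
        obtain ⟨t', ht', h₁, h₂⟩ :=
          (hR s s.isLt t t.isLt hst).1 (c a) (c a).isLt s' s'.isLt hs'
        exact (natLTS c N).cons_mem_traces.2 ⟨⟨t', ht'⟩, h₁, ih s' ⟨t', ht'⟩ h₂ hw⟩
    refine ⟨fun a (s' : Fin N) hs' => ?_, Set.Subset.antisymm (hsim s t hst)
      ((natTraceIncl_iff c hN t s).1 (hR s s.isLt t t.isLt hst).2)⟩
    obtain ⟨t', ht', h₁, h₂⟩ := (hR s s.isLt t t.isLt hst).1 (c a) (c a).isLt s' s'.isLt hs'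
    exact ⟨⟨t', ht'⟩, h₁, h₂⟩
  · rintro ⟨r, hpq, hr⟩
    obtain ⟨R, hRN, hR⟩ := exists_relCode (N := N) fun s t => ∃ (hs : s < N) (ht : t < N),
      r ⟨s, hs⟩ ⟨t, ht⟩
    refine ⟨R, hRN, (hR p p.isLt q q.isLt).2 ⟨p.isLt, q.isLt, hpq⟩, ?_⟩
    intro s hs t ht hst
    obtain ⟨_, _, hst⟩ := (hR s hs t ht).1 hst
    obtain ⟨h₁, h₂⟩ := hr _ _ hst
    refine ⟨fun a ha s' hs' hss' => ?_, (natTraceIncl_iff c hN ⟨t, ht⟩ ⟨s, hs⟩).2 h₂.ge⟩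
    obtain ⟨b, rfl⟩ : ∃ b, a = c b := ⟨c.symm ⟨a, ha⟩, by simp⟩
    obtain ⟨t', htt', hr'⟩ := h₁ b ⟨s', hs'⟩ hss'
    exact ⟨t'.val, t'.isLt, htt', (hR s' hs' t'.val t'.isLt).2 ⟨hs', t'.isLt, hr'⟩⟩

end

/-! ### The decision criteria as predicates of the set of models -/

/-- The set `m` of models is nonempty. -/
def SatPred (k d m : ℕ) : Prop := ∃ t < univSize k (d + 1), m.testBit t

/-- The set `m` of models has a least element, of depth at most `d`. -/
def LeastPred (k d m : ℕ) : Prop :=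
  ∃ t < univSize k d, m.testBit t ∧
    ∀ s < univSize k (d + 1), m.testBit s → NatSim k (univSize k (d + 1)) t s

/-- The set `m` of models is empty or has a least element. -/
def PrimePred (k d m : ℕ) : Prop := ¬ SatPred k d m ∨ LeastPred k d m

variable (c : A ≃ Fin k)

theorem satPred_iff (hk : 1 ≤ k) (φ : HML A) :
    SatPred k φ.md (valMask (formVal c φ.md φ)) ↔ Satisfiable φ := by
  rw [satisfiable_iff c hk (Nat.le_succ φ.md)]
  exact ⟨fun ⟨t, ht, h⟩ => ⟨⟨t, ht⟩, (testBit_valMask_formVal c _ φ _).1 h⟩,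
    fun ⟨t, h⟩ => ⟨t, t.isLt, (testBit_valMask_formVal c _ φ _).2 h⟩⟩

theorem leastPred_iff [Fintype A] (hk : 1 ≤ k) (φ : HML A) :
    LeastPred k φ.md (valMask (formVal c φ.md φ)) ↔ Satisfiable φ ∧ PrimeIn (LTS A) φ := by
  rw [satisfiable_prime_iff_nat c hk]
  constructor
  · rintro ⟨t, htd, ht, h⟩
    have ht' := htd.trans_le (univSize_le_succ hk φ.md)
    refine ⟨⟨t, ht'⟩, htd, (testBit_valMask_formVal c _ φ ⟨t, ht'⟩).1 ht, fun s hs => ?_⟩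
    exact (natSim_iff c rfl _ _).1 (h s s.isLt ((testBit_valMask_formVal c _ φ s).2 hs))
  · rintro ⟨t, htd, ht, h⟩
    refine ⟨t, htd, (testBit_valMask_formVal c _ φ t).2 ht, fun s hsN hs => ?_⟩
    exact (natSim_iff c rfl t ⟨s, hsN⟩).2 (h _ ((testBit_valMask_formVal c _ φ ⟨s, hsN⟩).1 hs))

theorem primePred_iff [Fintype A] (hk : 1 ≤ k) (φ : HML A) :
    PrimePred k φ.md (valMask (formVal c φ.md φ)) ↔ PrimeIn (LTS A) φ := by
  rw [PrimePred, satPred_iff c hk, leastPred_iff c hk, ← primeIn_iff_or]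

/-! ### Primitive recursiveness -/

section Primrec

attribute [fun_prop] Primrec
attribute [fun_prop] Primrec.const

variable {α β γ : Type*} [Primcodable α] [Primcodable β] [Primcodable γ]

@[fun_prop] theorem primrec_id : Primrec fun a : α => a := Primrec.id

@[fun_prop] theorem primrec_comp {g : β → γ} {f : α → β} (hg : Primrec g) (hf : Primrec f) :
    Primrec fun a => g (f a) := hg.comp hf

@[fun_prop] theorem primrec_fst {f : α → β × γ} (h : Primrec f) : Primrec fun a => (f a).1 :=
  Primrec.fst.comp h

@[fun_prop] theorem primrec_snd {f : α → β × γ} (h : Primrec f) : Primrec fun a => (f a).2 :=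
  Primrec.snd.comp h

@[fun_prop] theorem primrec_pair {f : α → β} {g : α → γ} (hf : Primrec f) (hg : Primrec g) :
    Primrec fun a => (f a, g a) := hf.pair hg

@[fun_prop] theorem primrec_add {f g : α → ℕ} (hf : Primrec f) (hg : Primrec g) :
    Primrec fun a => f a + g a := Primrec.nat_add.comp hf hg

@[fun_prop] theorem primrec_mul {f g : α → ℕ} (hf : Primrec f) (hg : Primrec g) :
    Primrec fun a => f a * g a := Primrec.nat_mul.comp hf hg

@[fun_prop] theorem primrec_min {f g : α → ℕ} (hf : Primrec f) (hg : Primrec g) :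
    Primrec fun a => min (f a) (g a) := Primrec.nat_min.comp hf hg

@[fun_prop] theorem primrec_max {f g : α → ℕ} (hf : Primrec f) (hg : Primrec g) :
    Primrec fun a => max (f a) (g a) := Primrec.nat_max.comp hf hg

@[fun_prop] theorem primrec_two_pow {f : α → ℕ} (hf : Primrec f) : Primrec fun a => 2 ^ f a := by
  have : Primrec fun n : ℕ => 2 ^ n :=
    (Primrec.nat_rec₁ (f := fun _ m => 2 * m) 1
      (Primrec.nat_mul.comp (Primrec.const 2) Primrec.snd)).of_eq fun n => by
        induction n with
        | zero => rfl
        | succ n ih => simp only [pow_succ, mul_comm _ 2, ← ih]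
  exact this.comp hf

theorem primrecPred_testBit {f g : α → ℕ} (hf : Primrec f) (hg : Primrec g) :
    PrimrecPred fun a => (f a).testBit (g a) = true := by
  refine (Primrec.eq.comp (Primrec.nat_mod.comp (Primrec.nat_div.comp hf (primrec_two_pow hg))
    (Primrec.const 2)) (Primrec.const 1)).of_eq fun a => ?_
  rw [Nat.testBit_eq_decide_div_mod_eq, decide_eq_true_eq]

theorem primrecPred_imp {p q : α → Prop} (hp : PrimrecPred p) (hq : PrimrecPred q) :
    PrimrecPred fun a => p a → q a :=
  (hp.not.or hq).of_eq fun _ => imp_iff_not_or.symm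

/-- The criteria are built from digit tests by bounded quantification, so this rule and its dual for
`∀` make them primitive recursive, uniformly in the modal depth. -/
theorem primrecPred_exists_lt {f : α → ℕ} {p : α → ℕ → Prop} (hf : Primrec f)
    (hp : PrimrecPred fun z : α × ℕ => p z.1 z.2) : PrimrecPred fun a => ∃ x < f a, p a x := by
  have h : PrimrecRel fun x a => p a x := hp.comp (Primrec.snd.pair Primrec.fst)
  exact (h.exists_mem_list.comp (Primrec.list_range.comp hf) Primrec.id).of_eq (by simp)

theorem primrecPred_forall_lt {f : α → ℕ} {p : α → ℕ → Prop} (hf : Primrec f)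
    (hp : PrimrecPred fun z : α × ℕ => p z.1 z.2) : PrimrecPred fun a => ∀ x < f a, p a x := by
  have h : PrimrecRel fun x a => p a x := hp.comp (Primrec.snd.pair Primrec.fst)
  exact (h.forall_mem_list.comp (Primrec.list_range.comp hf) Primrec.id).of_eq (by simp)

theorem primrec_mask {f : α → ℕ} {b : α → ℕ → Bool} (hf : Primrec f)
    (hb : PrimrecPred fun z : α × ℕ => b z.1 z.2 = true) : Primrec fun a => mask (b a) (f a) := by
  have h₁ : Primrec fun z : α × ℕ => (b z.1 z.2).toNat :=
    (Primrec.ite hb (Primrec.const 1) (Primrec.const 0)).of_eq fun z => by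
      cases b z.1 z.2 <;> simp
  refine (Primrec.nat_rec' (h := fun a z => z.2 + (b a z.1).toNat * 2 ^ z.1) hf
    (Primrec.const 0) ?_).of_eq fun a => ?_
  · have h₂ : Primrec fun z : α × ℕ × ℕ => (b z.1 z.2.1).toNat :=
      h₁.comp (Primrec.fst.pair (Primrec.fst.comp Primrec.snd))
    change Primrec fun z : α × ℕ × ℕ => z.2.2 + (b z.1 z.2.1).toNat * 2 ^ z.2.1
    fun_prop
  · induction f a with
    | zero => rfl
    | succ n ih => simp only [ih, mask]

@[fun_prop] theorem primrec_univSize {f : α → ℕ} (hf : Primrec f) :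
    Primrec fun a => univSize k (f a) := by
  have : Primrec (univSize k) :=
    (Primrec.nat_rec₁ (f := fun _ m => 2 ^ (k * m)) 1
      (by change Primrec fun z : ℕ × ℕ => 2 ^ (k * z.2); fun_prop)).of_eq fun n => by
        induction n with
        | zero => rfl
        | succ n ih => simp only [univSize, ih]
  exact this.comp hf

theorem primrecPred_traceInclWitness {f g : α → ℕ} (hf : Primrec f) (hg : Primrec g) :
    PrimrecPred fun a => TraceInclWitness k (f a) (g a) := by
  refine primrecPred_forall_lt hf <| primrecPred_forall_lt (by fun_prop) <| primrecPred_imp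
    (primrecPred_testBit (by fun_prop) (by fun_prop)) <|
    primrecPred_forall_lt (by fun_prop) <| primrecPred_forall_lt (by fun_prop) <| primrecPred_imp
      (primrecPred_testBit (by fun_prop) (by fun_prop)) <|
    .and (primrecPred_exists_lt (by fun_prop) <| primrecPred_testBit (by fun_prop) (by fun_prop)) <|
    primrecPred_exists_lt (by fun_prop) <| .and (primrecPred_testBit (by fun_prop) (by fun_prop)) <|
    primrecPred_forall_lt (by fun_prop) <| primrecPred_forall_lt (by fun_prop) <| primrecPred_imp
      (primrecPred_testBit (by fun_prop) (by fun_prop)) <|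
    primrecPred_exists_lt (by fun_prop) <| .and (primrecPred_testBit (by fun_prop) (by fun_prop))
      (primrecPred_testBit (by fun_prop) (by fun_prop))

theorem primrecPred_natTraceIncl {f g h : α → ℕ} (hf : Primrec f) (hg : Primrec g)
    (hh : Primrec h) : PrimrecPred fun a => NatTraceIncl k (f a) (g a) (h a) :=
  primrecPred_exists_lt (by fun_prop) <| .and (primrecPred_testBit (by fun_prop) (by fun_prop)) <|
    primrecPred_traceInclWitness (by fun_prop) (by fun_prop)

theorem primrecPred_simWitness {f g : α → ℕ} (hf : Primrec f) (hg : Primrec g) :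
    PrimrecPred fun a => SimWitness k (f a) (g a) :=
  primrecPred_forall_lt hf <| primrecPred_forall_lt (by fun_prop) <| primrecPred_imp
    (primrecPred_testBit (by fun_prop) (by fun_prop)) <| .and
    (primrecPred_forall_lt (by fun_prop) <| primrecPred_forall_lt (by fun_prop) <| primrecPred_imp
      (primrecPred_testBit (by fun_prop) (by fun_prop)) <|
    primrecPred_exists_lt (by fun_prop) <| .and (primrecPred_testBit (by fun_prop) (by fun_prop))
      (primrecPred_testBit (by fun_prop) (by fun_prop))) <|
    primrecPred_natTraceIncl (by fun_prop) (by fun_prop) (by fun_prop)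

theorem primrecPred_natSim {f g h : α → ℕ} (hf : Primrec f) (hg : Primrec g)
    (hh : Primrec h) : PrimrecPred fun a => NatSim k (f a) (g a) (h a) :=
  primrecPred_exists_lt (by fun_prop) <| .and (primrecPred_testBit (by fun_prop) (by fun_prop)) <|
    primrecPred_simWitness (by fun_prop) (by fun_prop)

theorem primrecPred_satPred : PrimrecPred fun z : ℕ × ℕ => SatPred k z.1 z.2 :=
  primrecPred_exists_lt (by fun_prop) <| primrecPred_testBit (by fun_prop) (by fun_prop)

theorem primrecPred_leastPred : PrimrecPred fun z : ℕ × ℕ => LeastPred k z.1 z.2 :=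
  primrecPred_exists_lt (by fun_prop) <| .and (primrecPred_testBit (by fun_prop) (by fun_prop)) <|
    primrecPred_forall_lt (by fun_prop) <| primrecPred_imp
      (primrecPred_testBit (by fun_prop) (by fun_prop)) <|
    primrecPred_natSim (by fun_prop) (by fun_prop) (by fun_prop)

theorem primrecPred_primePred : PrimrecPred fun z : ℕ × ℕ => PrimePred k z.1 z.2 :=
  primrecPred_satPred.not.or primrecPred_leastPred

@[fun_prop] theorem primrec_valMask {f : α → ℕ} (hf : Primrec f) :
    Primrec fun a => valMask (f a) := (Primrec.fst.comp Primrec.unpair).comp hf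

@[fun_prop] theorem primrec_valDepth {f : α → ℕ} (hf : Primrec f) :
    Primrec fun a => valDepth (f a) :=
  (Primrec.fst.comp (Primrec.unpair.comp (Primrec.snd.comp Primrec.unpair))).comp hf

@[fun_prop] theorem primrec_valRank {f : α → ℕ} (hf : Primrec f) :
    Primrec fun a => valRank (f a) :=
  (Primrec.snd.comp (Primrec.unpair.comp (Primrec.snd.comp Primrec.unpair))).comp hf

theorem primrec_mkVal {f g h : α → ℕ} (hf : Primrec f) (hg : Primrec g) (hh : Primrec h) :
    Primrec fun a => mkVal (f a) (g a) (h a) :=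
  Primrec₂.natPair.comp hf (Primrec₂.natPair.comp hg hh)

theorem primrecPred_acceptVal {P : ℕ → ℕ → Prop} (hP : PrimrecPred fun z : ℕ × ℕ => P z.1 z.2) :
    PrimrecPred fun z : ℕ × ℕ => AcceptVal P z.1 z.2 :=
  .and (Primrec.nat_le.comp (Primrec.const 1) (by fun_prop)) <|
    .and (Primrec.eq.comp (by fun_prop) (by fun_prop)) <|
    hP.comp (f := fun z : ℕ × ℕ => (z.1, valMask z.2)) (by fun_prop)

theorem primrec_valBound : Primrec (valBound k) :=
  primrec_mkVal (by fun_prop) (by fun_prop) (by fun_prop)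

/-- For every symbol, its operation on values is primitive recursive, also in the bound on the
modal depth. -/
theorem primrec_symbVal (s : Symb A) :
    Primrec fun z : ℕ × ℕ × ℕ => symbVal c z.1 s z.2.1 z.2.2 := by
  cases s with
  | tt =>
    refine primrec_mkVal (primrec_mask (by fun_prop) ?_) (by fun_prop) (by fun_prop)
    exact (Primrec.eq.comp (Primrec.const 0) (Primrec.const 0)).of_eq (by simp)
  | ff => exact Primrec.const _
  | and =>
    refine primrec_mkVal (primrec_mask (by fun_prop) ?_) (by fun_prop) (by fun_prop)
    simp only [Bool.and_eq_true]
    exact .and (primrecPred_testBit (by fun_prop) (by fun_prop))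
      (primrecPred_testBit (by fun_prop) (by fun_prop))
  | or =>
    refine primrec_mkVal (primrec_mask (by fun_prop) ?_) (by fun_prop) (by fun_prop)
    simp only [Bool.or_eq_true]
    exact .or (primrecPred_testBit (by fun_prop) (by fun_prop))
      (primrecPred_testBit (by fun_prop) (by fun_prop))
  | dia a =>
    refine primrec_mkVal (primrec_mask (by fun_prop) ?_) (by fun_prop) (by fun_prop)
    simp only [decide_eq_true_eq]
    exact primrecPred_exists_lt (by fun_prop) <| .and
      (primrecPred_testBit (by fun_prop) (by fun_prop))
      (primrecPred_testBit (by fun_prop) (by fun_prop))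
  | box a =>
    refine primrec_mkVal (primrec_mask (by fun_prop) ?_) (by fun_prop) ?_
    · simp only [decide_eq_true_eq]
      exact primrecPred_forall_lt (by fun_prop) <| primrecPred_imp
        (primrecPred_testBit (by fun_prop) (by fun_prop))
        (primrecPred_testBit (by fun_prop) (by fun_prop))
    · exact Primrec.ite (Primrec.eq.comp (by fun_prop) (Primrec.const 2)) (Primrec.const 2)
        (Primrec.const 0)
  | neg =>
    refine primrec_mkVal (primrec_mask (by fun_prop) ?_) (by fun_prop) (by fun_prop)
    simp only [Bool.not_eq_true', ← Bool.not_eq_true]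
    exact (primrecPred_testBit (by fun_prop) (by fun_prop)).not

end Primrec

end TraceSim

namespace TraceSim

/-! ### Fragments of Turing machines -/

open Turing

/-- The stacks of the machines: input, reversed input, values, output, and counters. -/
inductive Stk (R : Type) where
  | inp : Stk R
  | rev : Stk R
  | vals : Stk R
  | out : Stk R
  | reg : R → Stk R
  deriving DecidableEq

variable {G V R : Type}

instance [Finite R] : Finite (Stk R) :=
  Finite.of_injective (β := Fin 4 ⊕ R)
    (fun | .inp => .inl 0 | .rev => .inl 1 | .vals => .inl 2 | .out => .inl 3 | .reg r => .inr r)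
    (by rintro (_ | _ | _ | _ | _) (_ | _ | _ | _ | _) <;> simp)

/-- The stack alphabets. -/
abbrev Stk.Alph (G V : Type) : Stk R → Type
  | .inp => G
  | .rev => G
  | .vals => V
  | .out => Bool
  | .reg _ => Unit

/-- The internal states of the machines. -/
@[ext] structure Mem (G V : Type) where
  flag : Bool
  sym : Option G
  fst : Option V
  snd : Option V

instance [Finite G] [Finite V] : Finite (Mem G V) :=
  Finite.of_injective (β := Bool × Option G × Option V × Option V)
    (fun z => (z.flag, z.sym, z.fst, z.snd)) fun z w h => by
      simp only [Prod.mk.injEq] at h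
      exact Mem.ext h.1 h.2.1 h.2.2.1 h.2.2.2

/-- The initial internal state. -/
def Mem.blank : Mem G V := ⟨false, none, none, none⟩

/-- The data of a configuration: internal state and stacks. -/
@[ext] structure Store (G V R : Type) where
  mem : Mem G V
  inp : List G
  rev : List G
  vals : List V
  out : List Bool
  reg : R → ℕ

/-- The stacks of a store. -/
def Store.stk (s : Store G V R) : ∀ x : Stk R, List (x.Alph G V)
  | .inp => s.inp
  | .rev => s.rev
  | .vals => s.vals
  | .out => s.out
  | .reg r => List.replicate (s.reg r) ()

section Update

variable [DecidableEq R] (s : Store G V R)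

theorem update_inp (l : List G) :
    Function.update s.stk .inp l = ({s with inp := l} : Store G V R).stk := by
  funext x
  cases x <;> simp [Function.update, Store.stk]

theorem update_rev (l : List G) :
    Function.update s.stk .rev l = ({s with rev := l} : Store G V R).stk := by
  funext x
  cases x <;> simp [Function.update, Store.stk]

theorem update_vals (l : List V) :
    Function.update s.stk .vals l = ({s with vals := l} : Store G V R).stk := by
  funext x
  cases x <;> simp [Function.update, Store.stk]

theorem update_out (l : List Bool) :
    Function.update s.stk .out l = ({s with out := l} : Store G V R).stk := by
  funext x
  cases x <;> simp [Function.update, Store.stk]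

theorem update_reg (r : R) (n : ℕ) :
    Function.update s.stk (.reg r) (List.replicate n ()) =
      ({s with reg := Function.update s.reg r n} : Store G V R).stk := by
  funext x
  cases x with
  | reg q =>
    by_cases h : q = r
    · subst h
      simp [Store.stk]
    · simp [Function.update, Store.stk, h]
  | _ => simp [Function.update, Store.stk]

end Update

/-- Statements of the machines. -/
abbrev Stm (G V R Λ : Type) := TM2.Stmt (Stk.Alph G V (R := R)) Λ (Mem G V)

/-- A piece of a Turing machine with one entry and one exit. -/
structure Frag (G V R : Type) where
  Lab : Type
  finite_lab : Finite Lab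
  entry : Lab
  -- The code is polymorphic in the labels of the surrounding machine; its arguments are the
  -- embedding of the own labels and the exit. Fragments can thus be combined without relabelling.
  code : ∀ {Λ : Type}, (Lab → Λ) → Λ → Lab → Stm G V R Λ

/-- `m` runs from `x` to `y` in `n` steps. -/
def Steps [DecidableEq R] {Λ : Type} (m : Λ → Stm G V R Λ) (n : ℕ)
    (x y : TM2.Cfg (Stk.Alph G V (R := R)) Λ (Mem G V)) : Prop :=
  (flip bind (TM2.step m))^[n] (some x) = some y

theorem Steps.trans [DecidableEq R] {Λ : Type} {m : Λ → Stm G V R Λ} {i j : ℕ}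
    {x y z : TM2.Cfg (Stk.Alph G V (R := R)) Λ (Mem G V)} (h₁ : Steps m i x y)
    (h₂ : Steps m j y z) : Steps m (i + j) x z := by
  rw [Steps, add_comm, Function.iterate_add_apply, h₁]
  exact h₂

/-- Whatever machine contains the fragment `F`, it runs from the store `s` at the entry to the store
`s'` at the exit in at most `t` steps. -/
def Runs [DecidableEq R] (F : Frag G V R) (s s' : Store G V R) (t : ℕ) : Prop :=
  ∀ (Λ : Type) (m : Λ → Stm G V R Λ) (e : F.Lab → Λ) (exit : Λ),
    (∀ l, m (e l) = F.code e exit l) →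
    ∃ n ≤ t, Steps m n ⟨some (e F.entry), s.mem, s.stk⟩ ⟨some exit, s'.mem, s'.stk⟩

namespace Frag

/-- A single instruction. -/
def instr (q : ∀ {Λ : Type}, Stm G V R Λ → Stm G V R Λ) : Frag G V R where
  Lab := Unit
  finite_lab := inferInstance
  entry := ()
  code _ exit _ := q (.goto fun _ => exit)

/-- One fragment after the other. -/
def seq (F H : Frag G V R) : Frag G V R where
  Lab := F.Lab ⊕ H.Lab
  finite_lab := by
    have := F.finite_lab
    have := H.finite_lab
    infer_instance
  entry := .inl F.entry
  code e exit
    | .inl l => F.code (fun l => e (.inl l)) (e (.inr H.entry)) l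
    | .inr l => H.code (fun l => e (.inr l)) exit l

/-- The fragment selected by the internal state. -/
def switch [Finite G] [Finite V] (P : Mem G V → Frag G V R) : Frag G V R where
  Lab := Option (Σ z, (P z).Lab)
  finite_lab := by
    have := fun z => (P z).finite_lab
    infer_instance
  entry := none
  code e exit
    | none => .goto fun z => e (some ⟨z, (P z).entry⟩)
    | some ⟨z, l⟩ => (P z).code (fun l => e (some ⟨z, l⟩)) exit l

/-- Repeats a fragment as long as the internal state satisfies `b`. -/
def loop (b : Mem G V → Bool) (F : Frag G V R) : Frag G V R where
  Lab := Option F.Lab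
  finite_lab := by
    have := F.finite_lab
    infer_instance
  entry := none
  code e exit
    | none => .branch b (.goto fun _ => e (some F.entry)) (.goto fun _ => exit)
    | some l => F.code (fun l => e (some l)) (e none) l

end Frag

section Runs

variable [DecidableEq R] {F H : Frag G V R} {s s' s'' : Store G V R} {t t' : ℕ}

theorem Runs.mono (h : Runs F s s' t) (ht : t ≤ t') : Runs F s s' t' := fun Λ m e exit he =>
  let ⟨n, hn, h⟩ := h Λ m e exit he
  ⟨n, hn.trans ht, h⟩

theorem runs_instr {q : ∀ {Λ : Type}, Stm G V R Λ → Stm G V R Λ}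
    (h : ∀ {Λ : Type} (p : Stm G V R Λ),
      TM2.stepAux (q p) s.mem s.stk = TM2.stepAux p s'.mem s'.stk) :
    Runs (Frag.instr q) s s' 1 := by
  intro Λ m e exit he
  refine ⟨1, le_rfl, ?_⟩
  change some (TM2.stepAux (m (e ())) s.mem s.stk) = _
  rw [he ()]
  exact congrArg some (h _)

theorem Runs.seq (h₁ : Runs F s s' t) (h₂ : Runs H s' s'' t') :
    Runs (F.seq H) s s'' (t + t') := by
  intro Λ m e exit he
  obtain ⟨n, hn, h₁⟩ := h₁ Λ m (fun l => e (.inl l)) (e (.inr H.entry)) fun l => he (.inl l)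
  obtain ⟨n', hn', h₂⟩ := h₂ Λ m (fun l => e (.inr l)) exit fun l => he (.inr l)
  exact ⟨n + n', by omega, h₁.trans h₂⟩

theorem runs_switch [Finite G] [Finite V] {P : Mem G V → Frag G V R}
    (h : Runs (P s.mem) s s' t) : Runs (Frag.switch P) s s' (t + 1) := by
  intro Λ m e exit he
  obtain ⟨n, hn, h⟩ := h Λ m (fun l => e (some ⟨s.mem, l⟩)) exit fun l => he (some ⟨s.mem, l⟩)
  refine ⟨1 + n, by omega, Steps.trans ?_ h⟩
  change some (TM2.stepAux (m (e none)) s.mem s.stk) = _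
  rw [he none]
  rfl

theorem runs_loop_exit {b : Mem G V → Bool} (hb : b s.mem = false) :
    Runs (Frag.loop b F) s s 1 := by
  intro Λ m e exit he
  refine ⟨1, le_rfl, ?_⟩
  change some (TM2.stepAux (m (e none)) s.mem s.stk) = _
  rw [he none]
  simp [Frag.loop, TM2.stepAux, hb]

theorem runs_loop_step {b : Mem G V → Bool} (hb : b s.mem = true) (h₁ : Runs F s s' t)
    (h₂ : Runs (Frag.loop b F) s' s'' t') : Runs (Frag.loop b F) s s'' (t + t' + 1) := by
  intro Λ m e exit he
  obtain ⟨n, hn, h₁⟩ := h₁ Λ m (fun l => e (some l)) (e none) fun l => he (some l)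
  obtain ⟨n', hn', h₂⟩ := h₂ Λ m e exit he
  refine ⟨1 + (n + n'), by omega, Steps.trans ?_ (h₁.trans h₂)⟩
  change some (TM2.stepAux (m (e none)) s.mem s.stk) = _
  rw [he none]
  simp [Frag.loop, TM2.stepAux, hb]

end Runs

/-! ### Counter programs -/

namespace Frag

/-- Does nothing. -/
def skip : Frag G V R := instr fun q => q

/-- Increments a counter. -/
def inc (x : R) : Frag G V R := instr fun q => .push (.reg x) (fun _ => ()) q

/-- Decrements a counter and records in the flag whether it was positive. -/
def dec (x : R) : Frag G V R :=
  instr fun q => .pop (.reg x) (fun z o => {z with flag := o.isSome}) q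

/-- Clears the flag. -/
def unflag : Frag G V R := instr fun q => .load (fun z => {z with flag := false}) q

/-- Counts `x` down to `0` and executes `F` after each decrement. -/
def countdown (x : R) (F : Frag G V R) : Frag G V R :=
  (dec x).seq (loop Mem.flag (unflag.seq (F.seq (dec x))))

/-- Sets a counter to `0`. -/
def clear (x : R) : Frag G V R := countdown x skip

/-- Adds `x` to `y` and sets `x` to `0`. -/
def move (x y : R) : Frag G V R := countdown x (inc y)

/-- Adds `x` to `y`, with an auxiliary counter `z`. -/
def copy (x y z : R) : Frag G V R := (countdown x ((inc y).seq (inc z))).seq (move z x)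

end Frag

/-- The fragment `F` changes the counters from `r` to `r'` in at most `t` steps, and nothing else. -/
def RegRuns [DecidableEq R] (F : Frag G V R) (r r' : R → ℕ) (t : ℕ) : Prop :=
  ∀ s : Store G V R, s.mem.flag = false → Runs F {s with reg := r} {s with reg := r'} t

section RegRuns

open Function (update)

variable [DecidableEq R] {F H : Frag G V R} {r r' r'' : R → ℕ} {t t' : ℕ}

theorem RegRuns.mono (h : RegRuns F r r' t) (ht : t ≤ t') : RegRuns F r r' t' :=
  fun s hs => (h s hs).mono ht

theorem RegRuns.congr {q q' : R → ℕ} (h : RegRuns F r r' t) (h₁ : q = r) (h₂ : r' = q')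
    (ht : t ≤ t') : RegRuns F q q' t' := by
  subst h₁ h₂
  exact h.mono ht

theorem RegRuns.seq (h₁ : RegRuns F r r' t) (h₂ : RegRuns H r' r'' t') :
    RegRuns (F.seq H) r r'' (t + t') := fun s hs => (h₁ s hs).seq (h₂ s hs)

theorem regRuns_skip : RegRuns (Frag.skip : Frag G V R) r r 1 := fun _ _ => runs_instr fun _ => rfl

theorem regRuns_inc (x : R) : RegRuns (Frag.inc x : Frag G V R) r (update r x (r x + 1)) 1 := by
  intro s hs
  refine runs_instr fun p => ?_
  rw [TM2.stepAux]
  congr 1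
  exact update_reg {s with reg := r} x (r x + 1)

theorem runs_dec (s : Store G V R) (x : R) :
    Runs (Frag.dec x) s {s with
      mem := {s.mem with flag := decide (s.reg x ≠ 0)}
      reg := update s.reg x (s.reg x - 1)} 1 := by
  refine runs_instr fun p => ?_
  rw [TM2.stepAux]
  congr 1
  · have : (s.stk (.reg x)).head?.isSome = decide (s.reg x ≠ 0) := by
      cases h : s.reg x <;> simp [Store.stk, h, List.replicate_succ]
    rw [this]
  · have : (s.stk (.reg x)).tail = List.replicate (s.reg x - 1) () := by simp [Store.stk]
    rw [this]
    exact update_reg s x _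

/-- Decrements a counter of a store. -/
def Store.decr (s : Store G V R) (x : R) : Store G V R :=
  {s with reg := update s.reg x (s.reg x - 1)}

/-- `ρ i` is the store before the decrement of round `i`. A round costs `3` beyond its body: the
branch, clearing the flag and the next decrement. The final `2` is the first decrement and the last
branch. The flag is cleared so that the body always starts with it unset. -/
theorem runs_countdown {x : R} {n : ℕ} {ρ : ℕ → Store G V R} {T : ℕ → ℕ}
    (hm : ∀ i ≤ n, (ρ i).mem.flag = false) (hρ : ∀ i ≤ n, (ρ i).reg x = n - i)
    (hF : ∀ i < n, Runs F ((ρ i).decr x) (ρ (i + 1)) (T i)) :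
    Runs (Frag.countdown x F) (ρ 0) (ρ n) (∑ i ∈ Finset.range n, (T i + 3) + 2) := by
  -- The loop is entered just after a decrement; `ρ` and `T` are generalized so that the induction
  -- can shift them by one round.
  have key : ∀ n (ρ : ℕ → Store G V R) (T : ℕ → ℕ), (∀ i ≤ n, (ρ i).mem.flag = false) →
      (∀ i ≤ n, (ρ i).reg x = n - i) → (∀ i < n, Runs F ((ρ i).decr x) (ρ (i + 1)) (T i)) →
      Runs (Frag.loop Mem.flag (Frag.unflag.seq (F.seq (Frag.dec x))))
        {(ρ 0).decr x with mem := {(ρ 0).mem with flag := decide ((ρ 0).reg x ≠ 0)}}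
        (ρ n) (∑ i ∈ Finset.range n, (T i + 3) + 1) := by
    intro n
    induction n with
    | zero =>
      intro ρ T hm hρ _
      have h0 : (ρ 0).reg x = 0 := by simpa using hρ 0 le_rfl
      have h₁ : ({(ρ 0).decr x with
          mem := {(ρ 0).mem with flag := decide ((ρ 0).reg x ≠ 0)}} : Store G V R) = ρ 0 :=
        Store.ext (Mem.ext (by simp [h0, hm 0 le_rfl]) rfl rfl rfl) rfl rfl rfl rfl
          (by simp [Store.decr, h0])
      rw [h₁]
      exact runs_loop_exit (hm 0 le_rfl)
    | succ n ih =>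
      intro ρ T hm hρ hF
      have h0 : (ρ 0).reg x = n + 1 := by simpa using hρ 0 (Nat.zero_le _)
      have hrest := ih (fun i => ρ (i + 1)) (fun i => T (i + 1))
        (fun i hi => hm (i + 1) (by omega))
        (fun i hi => by rw [hρ (i + 1) (by omega)]; omega) fun i hi => hF (i + 1) (by omega)
      have hun : Runs (Frag.unflag : Frag G V R) {(ρ 0).decr x with
          mem := {(ρ 0).mem with flag := decide ((ρ 0).reg x ≠ 0)}} ((ρ 0).decr x) 1 :=
        runs_instr fun p => by
          rw [TM2.stepAux]
          congr 1
          exact Mem.ext (hm 0 (Nat.zero_le _)).symm rfl rfl rfl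
      refine (runs_loop_step (decide_eq_true (by omega)) (hun.seq ((hF 0 (Nat.succ_pos n)).seq
        (runs_dec (ρ 1) x))) hrest).mono ?_
      rw [Finset.sum_range_succ' _ n]
      omega
  refine ((runs_dec (ρ 0) x).seq (key n ρ T hm hρ hF)).mono ?_
  omega

theorem regRuns_countdown {x : R} {n : ℕ} {ρ : ℕ → R → ℕ} {T : ℕ → ℕ}
    (hρ : ∀ i ≤ n, ρ i x = n - i)
    (hF : ∀ i < n, RegRuns F (update (ρ i) x (n - i - 1)) (ρ (i + 1)) (T i)) :
    RegRuns (Frag.countdown x F) (ρ 0) (ρ n) (∑ i ∈ Finset.range n, (T i + 3) + 2) := by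
  intro s hs
  refine runs_countdown (ρ := fun i => {s with reg := ρ i}) (fun _ _ => hs) hρ fun i hi => ?_
  have := hF i hi s hs
  rwa [← hρ i hi.le] at this

theorem regRuns_clear (x : R) :
    RegRuns (Frag.clear x : Frag G V R) r (update r x 0) (4 * r x + 2) := by
  have h := regRuns_countdown (F := (Frag.skip : Frag G V R)) (x := x) (n := r x)
    (ρ := fun i => update r x (r x - i)) (T := fun _ => 1) (by simp)
    fun i hi => by
      rw [Function.update_idem, Nat.sub_sub]
      exact regRuns_skip
  simp only [Nat.sub_zero, Function.update_eq_self, Nat.sub_self, Finset.sum_const,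
    Finset.card_range, smul_eq_mul] at h
  exact h.mono (by omega)

theorem regRuns_move {x y : R} (hxy : x ≠ y) :
    RegRuns (Frag.move x y : Frag G V R) r (update (update r x 0) y (r y + r x))
      (4 * r x + 2) := by
  have h := regRuns_countdown (F := (Frag.inc y : Frag G V R)) (x := x) (n := r x)
    (ρ := fun i => update (update r x (r x - i)) y (r y + i)) (T := fun _ => 1)
    (by simp [Function.update_of_ne hxy])
    fun i hi => by
      convert regRuns_inc (G := G) (V := V) y using 1
      funext z
      by_cases h₁ : z = y
      · subst h₁
        simp [Function.update_of_ne hxy.symm, add_assoc]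
      · by_cases h₂ : z = x
        · subst h₂
          simp [Function.update_of_ne h₁, Nat.sub_sub]
        · simp [Function.update_of_ne h₁, Function.update_of_ne h₂]
  simp only [Nat.sub_zero, Function.update_eq_self, Nat.sub_self, Finset.sum_const,
    Finset.card_range, smul_eq_mul, Nat.add_zero] at h
  exact h.mono (by omega)

/-- Counting down destroys `x`, so it is also saved in `z` and moved back: `5` steps per unit for
the copying, `4` for the restoration. -/
theorem regRuns_copy {x y z : R} (hxy : x ≠ y) (hxz : x ≠ z) (hyz : y ≠ z) (hz : r z = 0) :
    RegRuns (Frag.copy x y z : Frag G V R) r (update r y (r y + r x)) (9 * r x + 4) := by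
  have h := regRuns_countdown (F := ((Frag.inc y).seq (Frag.inc z) : Frag G V R)) (x := x)
    (n := r x) (ρ := fun i => update (update (update r x (r x - i)) y (r y + i)) z i)
    (T := fun _ => 2) (by simp [Function.update_of_ne hxy, Function.update_of_ne hxz])
    fun i hi => by
      convert (regRuns_inc (G := G) (V := V) y).seq (regRuns_inc z) using 1
      funext w
      by_cases h₁ : w = z
      · subst h₁
        simp [Function.update_of_ne hxz.symm, Function.update_of_ne hyz.symm]
      · by_cases h₂ : w = y
        · subst h₂
          simp [Function.update_of_ne hxy.symm, Function.update_of_ne hyz, add_assoc]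
        · by_cases h₃ : w = x
          · subst h₃
            simp [Function.update_of_ne h₁, Function.update_of_ne h₂, Nat.sub_sub]
          · simp [Function.update_of_ne h₁, Function.update_of_ne h₂, Function.update_of_ne h₃]
  refine (h.seq (regRuns_move hxz.symm)).congr ?_ ?_ ?_
  · rw [Nat.sub_zero, Nat.add_zero, Function.update_eq_self, Function.update_eq_self, eq_comm,
      Function.update_eq_self_iff, hz]
  · funext w
    by_cases h₁ : w = x
    · subst h₁
      simp [Function.update_of_ne hxy, Function.update_of_ne hxz]
    · by_cases h₂ : w = z
      · subst h₂
        simp [Function.update_of_ne hyz.symm, Function.update_of_ne h₁, hz]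
      · by_cases h₃ : w = y
        · subst h₃
          simp [Function.update_of_ne h₁, Function.update_of_ne h₂]
        · simp [Function.update_of_ne h₁, Function.update_of_ne h₂, Function.update_of_ne h₃]
  · simp only [Finset.sum_const, Finset.card_range, smul_eq_mul, Function.update_self]
    omega

end RegRuns

end TraceSim

namespace TraceSim

/-! ### Primitive recursive functions are computed by counter programs -/

open Function (update)

/-- The function `f` is computed by a counter program in time `t`: the arguments are left unchanged,
the output counter and the auxiliary counters are initially `0`, and the latter are so in the end. -/
def CounterComputable {n : ℕ} (f t : List.Vector ℕ n → ℕ) : Prop :=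
  ∃ (W : Type) (_ : Finite W), ∀ (G V R : Type) [DecidableEq R] (inp : Fin n → R) (out : R)
    (work : W → R), Function.Injective work → (∀ i, inp i ≠ out) → (∀ i w, inp i ≠ work w) →
    (∀ w, work w ≠ out) → ∃ F : Frag G V R, ∀ r : R → ℕ, r out = 0 → (∀ w, r (work w) = 0) →
      RegRuns F r (update r out (f (List.Vector.ofFn fun i => r (inp i))))
        (t (List.Vector.ofFn fun i => r (inp i)))

/-- The fragments `F i` for `i` in a list, one after the other. -/
def Frag.seqList {G V R ι : Type} (F : ι → Frag G V R) : List ι → Frag G V R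
  | [] => skip
  | i :: l => (F i).seq (seqList F l)

/-- Counter programs with disjoint outputs, one after the other. -/
theorem regRuns_seqList {G V R ι : Type} [DecidableEq R] {F : ι → Frag G V R} {o : ι → R}
    (ho : Function.Injective o) {val T : ι → ℕ} {r : R → ℕ} (l : List ι) (hl : l.Nodup)
    (q q' : R → ℕ) (hq : ∀ x, q x = if ∃ i ∈ l, o i = x then r x else q' x)
    (hq' : ∀ i ∈ l, q' (o i) = val i)
    (hF : ∀ i (p : R → ℕ), (∀ x, (∀ j, x ≠ o j) → p x = q' x) → p (o i) = r (o i) →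
      RegRuns (F i) p (update p (o i) (val i)) (T i)) :
    RegRuns (Frag.seqList F l) q q' ((l.map T).sum + 1) := by
  -- The invariant is that outputs still to be treated hold their old values `r` and all other
  -- counters already hold the final ones `q'`.
  induction l generalizing q with
  | nil => exact regRuns_skip.congr (by funext x; simp [hq]) rfl (by simp)
  | cons i l ih =>
    have h₁ := hF i q
      (fun x hx => by rw [hq, if_neg (by rintro ⟨j, -, rfl⟩; exact hx j rfl)])
      (by rw [hq, if_pos ⟨i, by simp, rfl⟩])
    refine (h₁.seq (ih hl.of_cons _ (fun x => ?_) fun j hj => hq' j (by simp [hj]))).mono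
      (by simp; omega)
    by_cases hx : x = o i
    · subst hx
      rw [Function.update_self, if_neg, hq' i (by simp)]
      rintro ⟨j, hj, h⟩
      rw [ho h] at hj
      exact (List.nodup_cons.1 hl).1 hj
    · rw [Function.update_of_ne hx, hq]
      simp [Ne.symm hx]

theorem counterComputable_zero : CounterComputable (n := 0) (fun _ => 0) (fun _ => 1) := by
  refine ⟨Empty, inferInstance, fun G V R _ inp out work _ _ _ _ => ⟨Frag.skip, fun r h _ => ?_⟩⟩
  exact regRuns_skip.congr rfl (by rw [eq_comm, Function.update_eq_self_iff, h]) le_rfl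

theorem counterComputable_get {n : ℕ} (i : Fin n) :
    CounterComputable (fun v => v.get i) (fun v => 9 * v.get i + 4) := by
  refine ⟨Unit, inferInstance, fun G V R _ inp out work _ h₁ h₂ h₃ =>
    ⟨Frag.copy (inp i) out (work ()), fun r h hw => ?_⟩⟩
  exact (regRuns_copy (h₁ i) (h₂ i ()) (h₃ ()).symm (hw ())).congr rfl (by simp [h]) (by simp)

theorem counterComputable_succ :
    CounterComputable (n := 1) (fun v => v.head.succ) (fun v => 9 * v.head + 5) := by
  refine ⟨Unit, inferInstance, fun G V R _ inp out work _ h₁ h₂ h₃ =>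
    ⟨(Frag.copy (inp 0) out (work ())).seq (Frag.inc out), fun r h hw => ?_⟩⟩
  exact ((regRuns_copy (h₁ 0) (h₂ 0 ()) (h₃ ()).symm (hw ())).seq (regRuns_inc out)).congr rfl
    (by simp [h]) (by simp)

/-- Each inner function has its own output counter among the auxiliary ones, and disjoint auxiliary
counters. These outputs are the inputs of the outer program and are cleared at the end. -/
theorem counterComputable_comp {m n : ℕ} {f t : List.Vector ℕ n → ℕ}
    {g u : Fin n → List.Vector ℕ m → ℕ} (hf : CounterComputable f t)
    (hg : ∀ i, CounterComputable (g i) (u i)) :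
    CounterComputable (fun v => f (List.Vector.ofFn fun i => g i v)) (fun v =>
      ∑ i, u i v + t (List.Vector.ofFn fun i => g i v) + ∑ i, (4 * g i v + 2) + 2) := by
  obtain ⟨Wf, _, hf⟩ := hf
  choose Wg _ hg using hg
  refine ⟨Fin n ⊕ Wf ⊕ Σ i, Wg i, inferInstance,
    fun G V R _ inp out work hw h₁ h₂ h₃ => ?_⟩
  set o : Fin n → R := fun i => work (.inl i) with ho
  have hoi : Function.Injective o := fun i j h => Sum.inl_injective (hw h)
  choose Fg hFg using fun i => hg i G V R inp (o i) (fun w => work (.inr (.inr ⟨i, w⟩)))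
    (fun a b h => by simpa using hw h) (fun j => h₂ j _) (fun j w => h₂ j _)
    (fun w h => by simpa using hw h)
  obtain ⟨Ff, hFf⟩ := hf G V R o out (fun w => work (.inr (.inl w)))
    (fun a b h => by simpa using hw h) (fun i => h₃ _) (fun i w h => by simpa using hw h)
    (fun w => h₃ _)
  refine ⟨(Frag.seqList Fg (List.finRange n)).seq
    (Ff.seq (Frag.seqList (fun i => Frag.clear (o i)) (List.finRange n))), fun r hr hrw => ?_⟩
  set v := List.Vector.ofFn fun i => r (inp i) with hv
  have hpre : ∀ q : R → ℕ, (∀ x, (∀ j, x ≠ o j) → q x = r x) →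
      (List.Vector.ofFn fun i => q (inp i)) = v := fun q hq => by
    rw [hv]
    congr 1
    funext i
    exact hq _ fun j => h₂ i _
  -- The counters once all inner values are present.
  let q₁ : R → ℕ := fun x => by classical exact if h : ∃ i, o i = x then g h.choose v else r x
  have hq₁ : ∀ i, q₁ (o i) = g i v := fun i => by
    have h : ∃ j, o j = o i := ⟨i, rfl⟩
    simp only [q₁, dif_pos h]
    rw [hoi h.choose_spec]
  have hq₁' : ∀ x, (∀ j, x ≠ o j) → q₁ x = r x := fun x hx =>
    dif_neg fun ⟨i, h⟩ => hx i h.symm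
  have hout : ∀ j, out ≠ o j := fun j => (h₃ _).symm
  have s₁ : RegRuns (Frag.seqList Fg (List.finRange n)) r q₁ (((List.finRange n).map
      fun i => u i v).sum + 1) := by
    refine regRuns_seqList hoi (r := r) _ (List.nodup_finRange n) r q₁ (fun x => ?_)
      (fun i _ => hq₁ i) (fun i p hp hpi => ?_)
    · split_ifs with h
      · rfl
      · exact (hq₁' x fun j hj => h ⟨j, by simp, hj.symm⟩).symm
    · have hp' : ∀ x, (∀ j, x ≠ o j) → p x = r x := fun x hx => (hp x hx).trans (hq₁' x hx)
      have := hFg i p (hpi.trans (hrw _)) fun w =>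
        (hp' _ fun j h => by simpa using hw h).trans (hrw _)
      rwa [hpre p hp'] at this
  have s₂ := hFf q₁ ((hq₁' out hout).trans hr) fun w =>
    (hq₁' _ fun j h => by simpa using hw h).trans (hrw _)
  simp only [hq₁] at s₂
  have s₃ : RegRuns (Frag.seqList (fun i => (Frag.clear (o i) : Frag G V R)) (List.finRange n))
      (update q₁ out (f (List.Vector.ofFn fun i => g i v)))
      (update r out (f (List.Vector.ofFn fun i => g i v)))
      (((List.finRange n).map fun i => 4 * g i v + 2).sum + 1) := by
    refine regRuns_seqList hoi (r := q₁) (val := fun _ => 0) _ (List.nodup_finRange n) _ _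
      (fun x => ?_) (fun i _ => ?_) fun i p hp hpi => ?_
    · split_ifs with h
      · obtain ⟨i, -, rfl⟩ := h
        rw [Function.update_of_ne (hout i).symm]
      · by_cases hx : x = out
        · subst hx
          simp
        · rw [Function.update_of_ne hx, Function.update_of_ne hx]
          exact hq₁' x fun j hj => h ⟨j, by simp, hj.symm⟩
    · rw [Function.update_of_ne (hout i).symm]
      exact hrw _
    · have := regRuns_clear (G := G) (V := V) (r := p) (o i)
      rwa [hpi, hq₁] at this
  refine (s₁.seq (s₂.seq s₃)).mono ?_
  change _ ≤ ∑ i, u i v + t (List.Vector.ofFn fun i => g i v) + ∑ i, (4 * g i v + 2) + 2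
  rw [← List.ofFn_eq_map, ← List.ofFn_eq_map, List.sum_ofFn, List.sum_ofFn]
  omega

/-- The value of a primitive recursion. -/
def precVal {n : ℕ} (f : List.Vector ℕ n → ℕ) (g : List.Vector ℕ (n + 2) → ℕ)
    (v : List.Vector ℕ n) (i : ℕ) : ℕ :=
  i.rec (f v) fun y IH => g (y ::ᵥ IH ::ᵥ v)

/-- The counter `out` holds the current value of the recursion, `cnt` the remaining rounds, `y` the
index and `acc` the next value, which then replaces `out`; `tmp` serves the copying of the recursion
argument into `cnt`. -/
theorem counterComputable_prec {n : ℕ} {f t : List.Vector ℕ n → ℕ}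
    {g u : List.Vector ℕ (n + 2) → ℕ} (hf : CounterComputable f t) (hg : CounterComputable g u) :
    CounterComputable (fun v : List.Vector ℕ (n + 1) =>
        v.head.rec (f v.tail) fun y IH => g (y ::ᵥ IH ::ᵥ v.tail))
      (fun v => t v.tail + (13 * v.head + 8) + ∑ i ∈ Finset.range v.head,
        (u (i ::ᵥ precVal f g v.tail i ::ᵥ v.tail) + 4 * precVal f g v.tail i +
          4 * precVal f g v.tail (i + 1) + 8)) := by
  obtain ⟨Wf, _, hf⟩ := hf
  obtain ⟨Wg, _, hg⟩ := hg
  refine ⟨Fin 4 ⊕ Wf ⊕ Wg, inferInstance, fun G V R _ inp out work hw h₁ h₂ h₃ => ?_⟩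
  have hwn : ∀ {a b}, a ≠ b → work a ≠ work b := fun h h' => h (hw h')
  set cnt := work (.inl 0) with hcnt
  set y := work (.inl 1) with hy
  set acc := work (.inl 2) with hacc
  set tmp := work (.inl 3) with htmp
  have hcy : cnt ≠ y := hwn (by simp)
  have hca : cnt ≠ acc := hwn (by simp)
  have hct : cnt ≠ tmp := hwn (by simp)
  have hya : y ≠ acc := hwn (by simp)
  have hco : cnt ≠ out := h₃ _
  have hyo : y ≠ out := h₃ _
  have hao : acc ≠ out := h₃ _
  obtain ⟨Ff, hFf⟩ := hf G V R (fun i => inp i.succ) out (fun w => work (.inr (.inl w)))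
    (fun a b h => by simpa using hw h) (fun i => h₁ _) (fun i w => h₂ _ _) (fun w => h₃ _)
  obtain ⟨Fg, hFg⟩ := hg G V R (Fin.cons y (Fin.cons out fun i => inp i.succ)) acc
    (fun w => work (.inr (.inr w))) (fun a b h => by simpa using hw h)
    (fun i => by
      refine Fin.cases hya (fun i => ?_) i
      refine Fin.cases hao.symm (fun i => ?_) i
      exact h₂ _ _)
    (fun i w => by
      refine Fin.cases (hwn (by simp)) (fun i => ?_) i
      refine Fin.cases (h₃ _).symm (fun i => ?_) i
      exact h₂ _ _)
    (fun w => hwn (by simp))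
  refine ⟨Ff.seq ((Frag.copy (inp 0) cnt tmp).seq ((Frag.countdown cnt (Fg.seq ((Frag.clear out).seq
    ((Frag.move acc out).seq (Frag.inc y))))).seq (Frag.clear y))), fun r hr hrw => ?_⟩
  set v := List.Vector.ofFn fun i => r (inp i) with hv
  have hhead : v.head = r (inp 0) := by simp [hv, ← List.Vector.get_zero]
  have htail : v.tail = List.Vector.ofFn fun i => r (inp i.succ) := by
    rw [hv, List.Vector.ofFn]
    rfl
  set N := v.head with hN
  let P := precVal f g v.tail
  -- The counters at the start of round `i`.
  let ρ : ℕ → R → ℕ := fun i => update (update (update r out (P i)) cnt (N - i)) y i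
  have hP0 : P 0 = f v.tail := rfl
  have s₁ := hFf r hr fun w => hrw _
  rw [← htail, ← hP0] at s₁
  have s₂ : RegRuns (Frag.copy (inp 0) cnt tmp : Frag G V R) (update r out (P 0)) (ρ 0)
      (9 * N + 4) := by
    refine (regRuns_copy (y := cnt) (z := tmp) (h₂ _ _) (h₂ _ _) hct ?_).congr rfl ?_ ?_
    · rw [Function.update_of_ne (h₃ _)]
      exact hrw _
    · simp only [ρ, Function.update_of_ne hco, Function.update_of_ne (h₁ 0), ← hhead]
      rw [hcnt, hrw, Nat.zero_add, Nat.sub_zero, eq_comm, Function.update_eq_self_iff,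
        Function.update_of_ne hcy.symm, Function.update_of_ne hyo]
      exact (hrw _).symm
    · rw [Function.update_of_ne (h₁ 0), ← hhead]
  have s₃ : RegRuns (Frag.countdown cnt (Fg.seq ((Frag.clear out).seq
      ((Frag.move acc out).seq (Frag.inc y)))) : Frag G V R) (ρ 0) (ρ N)
      (∑ i ∈ Finset.range N, (u (i ::ᵥ P i ::ᵥ v.tail) + 4 * P i + 4 * P (i + 1) + 5 + 3) + 2) := by
    refine regRuns_countdown (T := fun i => u (i ::ᵥ P i ::ᵥ v.tail) + 4 * P i + 4 * P (i + 1) + 5)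
      (fun i _ => ?_) fun i hi => ?_
    · simp [ρ, Function.update_of_ne hcy]
    · set q := update (ρ i) cnt (N - i - 1) with hq
      have hqy : q y = i := by simp [hq, ρ, Function.update_of_ne hcy.symm]
      have hqo : q out = P i := by
        simp [hq, ρ, Function.update_of_ne hco.symm, Function.update_of_ne hyo.symm]
      have hqx : ∀ x, x ≠ cnt → x ≠ y → x ≠ out → q x = r x := fun x h₁ h₂ h₃ => by
        simp [hq, ρ, Function.update_of_ne h₁, Function.update_of_ne h₂, Function.update_of_ne h₃]
      have hvec : (List.Vector.ofFn fun j => q ((Fin.cons y (Fin.cons out fun i => inp i.succ) :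
          Fin (n + 2) → R) j)) = i ::ᵥ P i ::ᵥ v.tail := by
        rw [List.Vector.ofFn, List.Vector.ofFn, htail]
        simp only [Fin.cons_zero, Fin.cons_succ, hqy, hqo]
        congr 3
        funext j
        exact hqx _ (h₂ _ _) (h₂ _ _) (h₁ _)
      have hqa : q acc = 0 := (hqx _ hca.symm hya.symm hao).trans (hrw _)
      have b₁ := hFg q hqa fun w =>
        (hqx _ (hwn (by simp)) (hwn (by simp)) (h₃ _)).trans (hrw _)
      rw [hvec] at b₁
      have hP1 : g (i ::ᵥ P i ::ᵥ v.tail) = P (i + 1) := rfl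
      rw [hP1] at b₁
      refine (b₁.seq ((regRuns_clear out).seq ((regRuns_move hao).seq (regRuns_inc y)))).congr rfl
        ?_ ?_
      · funext x
        by_cases hx₁ : x = y
        · subst hx₁
          simp [ρ, Function.update_of_ne hya, Function.update_of_ne hyo, hqy]
        · by_cases hx₂ : x = out
          · subst hx₂
            simp [ρ, Function.update_of_ne hx₁, Function.update_of_ne hco.symm,
              Function.update_of_ne hao]
          · by_cases hx₃ : x = acc
            · subst hx₃
              simp only [ρ, Function.update_of_ne hx₁, Function.update_of_ne hx₂,
                Function.update_self, Function.update_of_ne hca.symm]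
              exact (hrw _).symm
            · by_cases hx₄ : x = cnt
              · subst hx₄
                simp [ρ, hq, Function.update_of_ne hx₁, Function.update_of_ne hx₂,
                  Function.update_of_ne hx₃, Nat.sub_sub]
              · simp [ρ, Function.update_of_ne hx₁, Function.update_of_ne hx₂,
                  Function.update_of_ne hx₃, Function.update_of_ne hx₄, hqx x hx₄ hx₁ hx₂]
      · simp only [Function.update_self, Function.update_of_ne hao, Function.update_of_ne hao.symm,
          hqo]
        omega
  have s₄ : RegRuns (Frag.clear y : Frag G V R) (ρ N) (update r out (P N)) (4 * N + 2) := by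
    refine (regRuns_clear y).congr rfl ?_ (by simp [ρ])
    funext x
    by_cases hx₁ : x = y
    · subst hx₁
      simp only [Function.update_self, Function.update_of_ne hyo]
      exact (hrw _).symm
    · by_cases hx₂ : x = cnt
      · subst hx₂
        simp only [ρ, Function.update_self, Function.update_of_ne hco, Function.update_of_ne hx₁,
          Nat.sub_self]
        exact (hrw _).symm
      · simp [ρ, Function.update_of_ne hx₁, Function.update_of_ne hx₂]
  refine (s₁.seq (s₂.seq (s₃.seq s₄))).mono ?_
  change _ ≤ t v.tail + (13 * N + 8) + ∑ i ∈ Finset.range N,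
    (u (i ::ᵥ P i ::ᵥ v.tail) + 4 * P i + 4 * P (i + 1) + 8)
  simp only [Nat.add_assoc, Nat.reduceAdd]
  omega

theorem primrec_sum_range {α : Type*} [Primcodable α] {f : α → ℕ} {g : α → ℕ → ℕ}
    (hf : Primrec f) (hg : Primrec₂ g) : Primrec fun a => ∑ i ∈ Finset.range (f a), g a i := by
  refine (Primrec.nat_rec' (h := fun a z => z.2 + g a z.1) hf (Primrec.const 0) ?_).of_eq
    fun a => ?_
  · have : Primrec fun z : α × ℕ × ℕ => g z.1 z.2.1 :=
      hg.comp Primrec.fst (Primrec.fst.comp Primrec.snd)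
    exact primrec_add (by fun_prop) this
  · induction f a with
    | zero => rfl
    | succ n ih => rw [Finset.sum_range_succ, ← ih]

theorem primrec_finset_sum {α ι : Type*} [Primcodable α] (s : Finset ι) {f : ι → α → ℕ}
    (hf : ∀ i, Primrec (f i)) : Primrec fun a => ∑ i ∈ s, f i a := by
  classical
  induction s using Finset.induction_on with
  | empty => exact (Primrec.const 0).of_eq fun a => by simp
  | insert i s hi ih =>
    exact (primrec_add (hf i) ih).of_eq fun a => by rw [Finset.sum_insert hi]

/-- Every primitive recursive function is computed by a counter program in primitive recursive
time. -/
theorem exists_counterComputable {n : ℕ} {f : List.Vector ℕ n → ℕ} (hf : Nat.Primrec' f) :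
    ∃ t : List.Vector ℕ n → ℕ, Primrec t ∧ CounterComputable f t := by
  induction hf with
  | zero => exact ⟨_, Primrec.const _, counterComputable_zero⟩
  | succ =>
    have := Primrec.vector_head (α := ℕ) (n := 0)
    exact ⟨_, by fun_prop, counterComputable_succ⟩
  | get i =>
    have : Primrec fun v : List.Vector ℕ _ => v.get i := Primrec.vector_get.comp .id (.const i)
    exact ⟨_, by fun_prop, counterComputable_get i⟩
  | @comp m n f g hf hg ihf ihg =>
    obtain ⟨t, ht, hft⟩ := ihf
    choose u hu hgu using ihg
    refine ⟨_, ?_, counterComputable_comp hft hgu⟩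
    have h₁ : Primrec fun v => ∑ i, u i v := primrec_finset_sum _ hu
    have h₂ : Primrec fun v => t (List.Vector.ofFn fun i => g i v) :=
      ht.comp (Primrec.vector_ofFn fun i => (hg i).to_prim)
    have h₃ : Primrec fun v => ∑ i, (4 * g i v + 2) := primrec_finset_sum _ fun i => by
      have := (hg i).to_prim
      fun_prop
    exact primrec_add (primrec_add (primrec_add h₁ h₂) h₃) (Primrec.const 2)
  | @prec n f g hf hg ihf ihg =>
    obtain ⟨t, ht, hft⟩ := ihf
    obtain ⟨u, hu, hgu⟩ := ihg
    refine ⟨_, ?_, counterComputable_prec hft hgu⟩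
    have hh := Primrec.vector_head (α := ℕ) (n := n)
    have htl := Primrec.vector_tail (α := ℕ) (n := n + 1)
    have htl' : Primrec fun z : List.Vector ℕ (n + 1) × ℕ => z.1.tail := htl.comp Primrec.fst
    -- The running time sums over the rounds and involves the intermediate values, so these must be
    -- primitive recursive in the index as well.
    have hP : Primrec fun z : List.Vector ℕ (n + 1) × ℕ => precVal f g z.1.tail z.2 := by
      refine Primrec.nat_rec' (h := fun z w => g (w.1 ::ᵥ w.2 ::ᵥ z.1.tail)) Primrec.snd
        (hf.to_prim.comp htl') ?_
      exact hg.to_prim.comp (Primrec.vector_cons.comp (Primrec.fst.comp Primrec.snd)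
        (Primrec.vector_cons.comp (Primrec.snd.comp Primrec.snd) (htl'.comp Primrec.fst)))
    have hP' : Primrec fun z : List.Vector ℕ (n + 1) × ℕ => precVal f g z.1.tail (z.2 + 1) :=
      hP.comp (Primrec.fst.pair (Primrec.succ.comp Primrec.snd))
    have hu' : Primrec fun z : List.Vector ℕ (n + 1) × ℕ =>
        u (z.2 ::ᵥ precVal f g z.1.tail z.2 ::ᵥ z.1.tail) :=
      hu.comp (Primrec.vector_cons.comp Primrec.snd (Primrec.vector_cons.comp hP htl'))
    have ht' : Primrec fun v : List.Vector ℕ (n + 1) => t v.tail := ht.comp htl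
    refine primrec_add (by fun_prop) (primrec_sum_range hh ?_)
    exact primrec_add (primrec_add (primrec_add hu' (primrec_mul (Primrec.const 4) hP))
      (primrec_mul (Primrec.const 4) hP')) (Primrec.const 8)

end TraceSim

namespace TraceSim

/-! ### Machines that fold over their input -/

open Turing

section Fold

variable {G V R : Type}

namespace Frag

/-- Restores the initial internal state. -/
def reset : Frag G V R := instr fun q => .load (fun _ => Mem.blank) q

/-- Pops a symbol of the input. -/
def popInp : Frag G V R := instr fun q => .pop .inp (fun z o => {z with sym := o}) q

/-- Pops a symbol of the reversed input. -/
def popRev : Frag G V R := instr fun q => .pop .rev (fun z o => {z with sym := o}) q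

/-- Pops an entry of the stack of values. -/
def popVals : Frag G V R := instr fun q => .pop .vals (fun z o => {z with fst := o}) q

/-- Reverses the input. -/
def reverse [Inhabited G] : Frag G V R :=
  popInp.seq (loop (fun z => z.sym.isSome)
    ((instr fun q => .push .rev (fun z => z.sym.getD default) q).seq popInp))

/-- Executes the fragment that belongs to each symbol of the reversed input. -/
def fold [Finite G] [Finite V] (F : G → Frag G V R) : Frag G V R :=
  popRev.seq (loop (fun z => z.sym.isSome)
    ((switch fun z => match z.sym with
      | none => skip
      | some g => reset.seq (F g)).seq popRev))

end Frag

section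

variable [DecidableEq R]

theorem runs_reset (s : Store G V R) : Runs Frag.reset s {s with mem := Mem.blank} 1 :=
  runs_instr fun _ => rfl

theorem runs_popInp (s : Store G V R) :
    Runs Frag.popInp s {s with mem := {s.mem with sym := s.inp.head?}, inp := s.inp.tail} 1 :=
  runs_instr fun p => by
    rw [TM2.stepAux]
    congr 1
    exact update_inp s _

theorem runs_popRev (s : Store G V R) :
    Runs Frag.popRev s {s with mem := {s.mem with sym := s.rev.head?}, rev := s.rev.tail} 1 :=
  runs_instr fun p => by
    rw [TM2.stepAux]
    congr 1
    exact update_rev s _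

theorem runs_popVals (s : Store G V R) :
    Runs Frag.popVals s {s with mem := {s.mem with fst := s.vals.head?}, vals := s.vals.tail} 1 :=
  runs_instr fun p => by
    rw [TM2.stepAux]
    congr 1
    exact update_vals s _

theorem runs_reverse [Inhabited G] (s : Store G V R) (hs : s.mem.sym = none) :
    Runs Frag.reverse s {s with inp := [], rev := s.inp.reverse ++ s.rev} (3 * s.inp.length + 2) := by
  have key : ∀ (x y : List G),
      Runs (Frag.loop (fun z => z.sym.isSome)
        ((Frag.instr fun q => .push .rev (fun z => z.sym.getD default) q).seq Frag.popInp))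
        {s with mem := {s.mem with sym := x.head?}, inp := x.tail, rev := y}
        {s with inp := [], rev := x.reverse ++ y} (3 * x.length + 1) := by
    intro x
    induction x with
    | nil =>
      intro y
      have h : ({s.mem with sym := none} : Mem G V) = s.mem := Mem.ext rfl hs.symm rfl rfl
      simp only [List.head?_nil, List.tail_nil, List.reverse_nil, List.nil_append, h]
      exact runs_loop_exit (by simp [hs])
    | cons g x ih =>
      intro y
      have h₁ : Runs (Frag.instr fun q => .push .rev (fun z => z.sym.getD default) q)
          {s with mem := {s.mem with sym := (g :: x).head?}, inp := (g :: x).tail, rev := y}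
          {s with mem := {s.mem with sym := (g :: x).head?}, inp := x, rev := g :: y} 1 :=
        runs_instr fun p => by
          rw [TM2.stepAux]
          congr 1
          exact update_rev {s with mem := {s.mem with sym := some g}, inp := x, rev := y} _
      have := runs_loop_step rfl (h₁.seq (runs_popInp _)) (ih (g :: y))
      rw [List.reverse_cons, List.append_assoc, List.singleton_append]
      exact this.mono (by simp; omega)
  exact ((runs_popInp s).seq (key s.inp s.rev)).mono (by omega)

/-- The store at rest with reversed input `y`, values `v` and counters `r`. -/
def restStore (y : List G) (v : List V) (r : R → ℕ) : Store G V R := ⟨Mem.blank, [], y, v, [], r⟩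

/-- The time bound for a fold with costs `T`. -/
def foldCost {D : Type} (op : G → D → D) (T : G → D → ℕ) : List G → D → ℕ
  | [], _ => 1
  | g :: y, δ => T g δ + 4 + foldCost op T y (op g δ)

/-- The abstract datum `δ` is realized by a stack and counters. The overhead of `4` per symbol is
the branch, the switch, the reset and the next pop; the reset lets each fragment start from the
blank state. -/
theorem runs_fold [Finite G] [Finite V] {F : G → Frag G V R} {D : Type} {op : G → D → D}
    {T : G → D → ℕ} {vals : D → List V} {reg : D → R → ℕ}
    (hF : ∀ g δ y, Runs (F g) (restStore y (vals δ) (reg δ))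
      (restStore y (vals (op g δ)) (reg (op g δ))) (T g δ)) (y : List G) (δ : D) :
    Runs (Frag.fold F) (restStore y (vals δ) (reg δ))
      (restStore [] (vals (y.foldl (fun δ g => op g δ) δ)) (reg (y.foldl (fun δ g => op g δ) δ)))
      (foldCost op T y δ + 1) := by
  have key : ∀ (y : List G) (δ : D),
      Runs (Frag.loop (fun z => z.sym.isSome) ((Frag.switch fun z => match z.sym with
        | none => Frag.skip
        | some g => Frag.reset.seq (F g)).seq Frag.popRev))
        ⟨⟨false, y.head?, none, none⟩, [], y.tail, vals δ, [], reg δ⟩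
        (restStore [] (vals (y.foldl (fun δ g => op g δ) δ)) (reg (y.foldl (fun δ g => op g δ) δ)))
        (foldCost op T y δ) := by
    intro y
    induction y with
    | nil => exact fun δ => runs_loop_exit rfl
    | cons g y ih =>
      intro δ
      have h₁ := runs_reset (⟨⟨false, some g, none, none⟩, [], y, vals δ, [], reg δ⟩ :
        Store G V R)
      have h₂ := runs_switch (s := ⟨⟨false, some g, none, none⟩, [], y, vals δ, [], reg δ⟩)
        (P := fun z => match z.sym with
          | none => Frag.skip
          | some g => Frag.reset.seq (F g)) (h₁.seq (hF g δ y))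
      refine (runs_loop_step rfl (h₂.seq (runs_popRev _)) (ih (op g δ))).mono ?_
      simp only [foldCost]
      omega
  exact ((runs_popRev _).seq (key y δ)).mono (by omega)

end

/-! ### From fragments to machines -/

/-- The machine that executes a fragment and halts. -/
noncomputable def Frag.machine [Finite G] [Finite V] [Finite R] [DecidableEq R]
    (F : Frag G V R) : TM2ComputableAux G Bool where
  tm :=
    { K := Stk R
      kFin := Fintype.ofFinite _
      k₀ := .inp
      k₁ := .out
      Γ := Stk.Alph G V
      Λ := Option F.Lab
      main := some F.entry
      ΛFin := by
        have := F.finite_lab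
        exact Fintype.ofFinite _
      σ := Mem G V
      initialState := Mem.blank
      σFin := Fintype.ofFinite _
      Γk₀Fin := Fintype.ofFinite G
      m := fun
        | none => .halt
        | some l => F.code some none l }
  inputAlphabet := Equiv.refl G
  outputAlphabet := Equiv.refl Bool

theorem finite_machine_alphabet [Finite G] [Finite V] [Finite R] [DecidableEq R]
    (F : Frag G V R) : ∀ x, Finite (F.machine.tm.Γ x)
  | .inp => inferInstanceAs (Finite G)
  | .rev => inferInstanceAs (Finite G)
  | .vals => inferInstanceAs (Finite V)
  | .out => inferInstanceAs (Finite Bool)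
  | .reg _ => inferInstanceAs (Finite Unit)

/-- The additional step is the halting statement at label `none`. A halting configuration must have
all stacks but the output empty, which is why the fragments clean up. -/
theorem machine_outputs [Finite G] [Finite V] [Finite R] [DecidableEq R] {F : Frag G V R}
    {x : List G} {b : Bool} {t : ℕ}
    (h : Runs F ⟨Mem.blank, x, [], [], [], fun _ => 0⟩ ⟨Mem.blank, [], [], [], [b], fun _ => 0⟩ t) :
    Nonempty (TM2OutputsInTime F.machine.tm (x.map F.machine.inputAlphabet.symm)
      (some [F.machine.outputAlphabet.symm b]) (t + 1)) := by
  obtain ⟨n, hn, h⟩ := h (Option F.Lab) F.machine.tm.m some none fun l => rfl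
  refine ⟨⟨⟨n + 1, ?_⟩, Nat.succ_le_succ hn⟩⟩
  have hstart : initList F.machine.tm (x.map F.machine.inputAlphabet.symm) =
      ⟨some (some F.entry), Mem.blank,
        (⟨Mem.blank, x, [], [], [], fun _ => 0⟩ : Store G V R).stk⟩ := by
    have hx : x.map F.machine.inputAlphabet.symm = x := List.map_id x
    rw [hx]
    unfold initList
    congr 1
    funext k
    cases k <;> rfl
  have hhalt : haltList F.machine.tm [F.machine.outputAlphabet.symm b] =
      ⟨none, Mem.blank, (⟨Mem.blank, [], [], [], [b], fun _ => 0⟩ : Store G V R).stk⟩ := by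
    unfold haltList
    congr 1
    funext k
    cases k <;> rfl
  rw [hstart, Option.map_some, hhalt, Function.iterate_succ_apply']
  exact (congrArg (flip bind (TM2.step F.machine.tm.m)) h).trans rfl

/-- A machine that folds over its input decides a language. -/
theorem decidesInTime_fold {I D : Type} [Finite G] [Inhabited G] [Finite V] [Finite R]
    [DecidableEq R] {F : G → Frag G V R} {E : Frag G V R} {op : G → D → D} {T : G → D → ℕ}
    {vals : D → List V} {reg : D → R → ℕ} {enc : I → List G} {L : Set I} {δ₀ : D}
    {acc : D → Bool} {T' : D → ℕ} {t : I → ℕ} (hv : vals δ₀ = []) (hreg : reg δ₀ = fun _ => 0)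
    (hF : ∀ g δ y, Runs (F g) (restStore y (vals δ) (reg δ))
      (restStore y (vals (op g δ)) (reg (op g δ))) (T g δ))
    (hE : ∀ δ, Runs E (restStore [] (vals δ) (reg δ))
      ⟨Mem.blank, [], [], [], [acc δ], fun _ => 0⟩ (T' δ))
    (hL : ∀ i, acc ((enc i).foldr op δ₀) = true ↔ i ∈ L)
    (ht : ∀ i, 3 * (enc i).length + foldCost op T (enc i).reverse δ₀ +
      T' ((enc i).foldr op δ₀) + 4 ≤ t i) :
    DecidesInTime ((Frag.reverse.seq ((Frag.fold F).seq E)).machine) enc L t := by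
  refine ⟨finite_machine_alphabet _, fun i => ⟨_, hL i, ?_⟩⟩
  have h₁ := runs_reverse (⟨Mem.blank, enc i, [], [], [], fun _ => 0⟩ : Store G V R) rfl
  rw [List.append_nil] at h₁
  -- Folding over the reversed input is a right fold, hence evaluation from right to left.
  have hfold : (enc i).reverse.foldl (fun δ g => op g δ) δ₀ = (enc i).foldr op δ₀ :=
    List.foldl_reverse
  have h₂ := runs_fold hF (enc i).reverse δ₀
  rw [hv, hreg, hfold] at h₂
  obtain ⟨h⟩ := machine_outputs (h₁.seq (h₂.seq (hE ((enc i).foldr op δ₀))))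
  refine ⟨⟨h.toEvalsTo, h.steps_le_m.trans (le_trans ?_ (ht i))⟩⟩
  simp only
  omega

/-- Clears the stack of values. -/
theorem runs_drain [DecidableEq R] (s : Store G V R) (l : List V) :
    Runs (Frag.loop (fun m => m.fst.isSome) Frag.popVals)
      {s with mem := {s.mem with fst := l.head?}, vals := l.tail}
      {s with mem := {s.mem with fst := none}, vals := []} (2 * l.length + 1) := by
  induction l with
  | nil => exact runs_loop_exit rfl
  | cons v l ih =>
    refine (runs_loop_step rfl (runs_popVals _) ih).mono ?_
    simp only [List.length_cons]
    omega

end Fold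

/-! ### Evaluation with values as stack symbols -/

section Linear

variable {G V : Type} (z : V)

namespace Frag

/-- Applies an operator to the stack of values. -/
def opVals (n : Fin 3) (f : V → V → V) : Frag G V Empty :=
  match n with
  | 0 => instr fun q => .push .vals (fun _ => f z z) q
  | 1 => instr fun q => .pop .vals (fun m o => {m with fst := o})
      (.push .vals (fun m => f (m.fst.getD z) z) (.load (fun _ => Mem.blank) q))
  | 2 => instr fun q => .pop .vals (fun m o => {m with fst := o})
      (.pop .vals (fun m o => {m with snd := o})
      (.push .vals (fun m => f (m.fst.getD z) (m.snd.getD z)) (.load (fun _ => Mem.blank) q)))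

/-- Outputs whether there is just one value and it is accepted, and clears the stack of values. -/
def acceptVals (acc : V → Bool) : Frag G V Empty :=
  (instr fun q => .pop .vals (fun m o => {m with snd := o})
    (.pop .vals (fun m o => {m with fst := o})
    (.push .out (fun m => m.fst.isNone && acc (m.snd.getD z)) q))).seq
  ((loop (fun m => m.fst.isSome) popVals).seq reset)

end Frag

theorem runs_opVals (n : Fin 3) (f : V → V → V) (y : List G) (l : List V) (r : Empty → ℕ) :
    Runs (Frag.opVals z n f) (restStore y l r) (restStore y (applyOp z n f l) r) 1 := by
  match n with
  | 0 =>
    refine runs_instr fun p => ?_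
    simp only [TM2.stepAux]
    congr 1
    exact update_vals (restStore y l r) _
  | 1 =>
    refine runs_instr fun p => ?_
    simp only [TM2.stepAux]
    congr 1
    rw [update_vals, update_vals]
    cases l <;> rfl
  | 2 =>
    refine runs_instr fun p => ?_
    simp only [TM2.stepAux]
    congr 1
    rw [update_vals, update_vals, update_vals]
    rcases l with _ | ⟨_, _ | _⟩ <;> rfl

/-- The top value goes to `snd`, so that `fst` shows whether a second value exists and then controls
the emptying of the stack. -/
theorem runs_acceptVals (acc : V → Bool) (l : List V) (r : Empty → ℕ) :
    Runs (Frag.acceptVals z acc : Frag G V Empty) (restStore [] l r)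
      ⟨Mem.blank, [], [], [], [l.tail.isEmpty && acc (l.headD z)], r⟩ (2 * l.length + 3) := by
  have h₁ : Runs (Frag.instr fun q => .pop .vals (fun m o => {m with snd := o})
      (.pop .vals (fun m o => {m with fst := o})
      (.push .out (fun m => m.fst.isNone && acc (m.snd.getD z)) q)) : Frag G V Empty)
      (restStore [] l r) ⟨⟨false, none, l.tail.head?, l.head?⟩, [], [], l.tail.tail,
        [l.tail.isEmpty && acc (l.headD z)], r⟩ 1 := by
    refine runs_instr fun p => ?_
    simp only [TM2.stepAux]
    congr 1
    rw [update_vals, update_vals, update_out]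
    rcases l with _ | ⟨_, _ | _⟩ <;> rfl
  have h₂ := runs_drain (⟨⟨false, none, none, l.head?⟩, [], [], [],
    [l.tail.isEmpty && acc (l.headD z)], r⟩ : Store G V Empty) l.tail
  refine (h₁.seq (h₂.seq (runs_reset _))).mono ?_
  rw [List.length_tail]
  omega

end Linear

/-! ### Linear time for fixed modal depth -/

instance {A : Type} [Finite A] : Finite (Symb A) :=
  Finite.of_injective (β := Fin 5 ⊕ A ⊕ A)
    (fun | .tt => .inl 0 | .ff => .inl 1 | .and => .inl 2 | .or => .inl 3 | .neg => .inl 4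
         | .dia a => .inr (.inl a) | .box a => .inr (.inr a))
    (by rintro (_ | _ | _ | _ | _ | _ | _) (_ | _ | _ | _ | _ | _ | _) <;> simp)

instance {A : Type} : Inhabited (Symb A) := ⟨.tt⟩

theorem foldCost_const {G D : Type} (op : G → D → D) (b : ℕ) (y : List G) (δ : D) :
    foldCost op (fun _ _ => b) y δ = (b + 4) * y.length + 1 := by
  induction y generalizing δ with
  | nil => simp [foldCost]
  | cons g y ih =>
    rw [foldCost, ih, List.length_cons]
    ring

/-- A property of formulae that depends only on the models of depth at most the modal depth plus one
is decided in linear time for each modal depth. -/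
theorem decidableInTime_tsLanguage {A : Type} [Finite A] {k : ℕ} (c : A ≃ Fin k)
    {P : ℕ → ℕ → Prop} {Q : HML A → Prop}
    (hP : ∀ φ, IsTS φ → (P φ.md (valMask (formVal c φ.md φ)) ↔ Q φ)) (d : ℕ) :
    ∃ M : TM2ComputableAux (Symb A) Bool,
      DecidesInTime M id (tsLanguage d Q) fun x => 10 * x.length + 8 := by
  classical
  let z : Fin (valBound k d) := ⟨0, valBound_pos k d⟩
  -- Values are stack symbols here, so this table and the acceptance test belong to the finite
  -- control and cost one step each.
  let f : Symb A → Fin (valBound k d) → Fin (valBound k d) → Fin (valBound k d) := fun s v w =>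
    ⟨symbVal c d s v w, symbVal_lt c d s v w⟩
  let op : Symb A → List (Fin (valBound k d)) → List (Fin (valBound k d)) :=
    fun s => applyOp z s.arity (f s)
  have hop : ∀ x : List (Symb A), (x.foldr op []).map Fin.val = evalStack c d x := fun x => by
    induction x with
    | nil => rfl
    | cons s x ih =>
      rw [List.foldr_cons, map_applyOp Fin.val z s.arity (f' := symbVal c d s) fun _ _ => rfl, ih]
      rfl
  refine ⟨_, decidesInTime_fold (F := fun s => Frag.opVals z s.arity (f s))
    (E := Frag.acceptVals z fun v => decide (AcceptVal P d v)) (op := op) (T := fun _ _ => 1)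
    (vals := id) (reg := fun _ _ => 0) (δ₀ := []) (T' := fun l => 2 * l.length + 3)
    (acc := fun l => l.tail.isEmpty && decide (AcceptVal P d (l.headD z))) rfl rfl
    (fun s l y => runs_opVals z _ _ y l _) (fun l => runs_acceptVals z _ l _) (fun x => ?_)
    fun x => ?_⟩
  · have h := acceptVal_evalStack_iff c hP d x
    rw [← hop x, ← List.map_tail, List.map_eq_nil_iff] at h
    have h0 : ((x.foldr op []).map Fin.val).headD 0 = ((x.foldr op []).headD z).val :=
      map_headD Fin.val z _
    rw [h0] at h
    rw [Bool.and_eq_true, List.isEmpty_iff, decide_eq_true_eq]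
    exact h
  -- With `n` symbols, reversal and halting overhead give `3 * n + 4`, the fold `5 * n + 1`,
  -- acceptance at most `2 * n + 3`.
  · have h := length_evalStack_le c d x
    rw [← hop x, List.length_map] at h
    rw [foldCost_const, List.length_reverse]
    simp only [id]
    omega

end TraceSim

namespace TraceSim

/-! ### Evaluation with values as unary numbers -/

open Turing

section Unary

variable {G W : Type}

/-- Four named counters and auxiliary counters that are `0`. -/
def fourRegs (d a b e : ℕ) : Fin 4 ⊕ W → ℕ := Sum.elim ![d, a, b, e] fun _ => 0

section

variable [DecidableEq W] (d a b e x : ℕ)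

theorem update_fourRegs_zero :
    Function.update (fourRegs d a b e : Fin 4 ⊕ W → ℕ) (.inl 0) x = fourRegs x a b e := by
  funext r
  rcases r with i | w
  · fin_cases i <;> simp [Function.update, fourRegs]
  · simp [fourRegs]

theorem update_fourRegs_one :
    Function.update (fourRegs d a b e : Fin 4 ⊕ W → ℕ) (.inl 1) x = fourRegs d x b e := by
  funext r
  rcases r with i | w
  · fin_cases i <;> simp [Function.update, fourRegs]
  · simp [fourRegs]

theorem update_fourRegs_two :
    Function.update (fourRegs d a b e : Fin 4 ⊕ W → ℕ) (.inl 2) x = fourRegs d a x e := by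
  funext r
  rcases r with i | w
  · fin_cases i <;> simp [Function.update, fourRegs]
  · simp [fourRegs]

theorem update_fourRegs_three :
    Function.update (fourRegs d a b e : Fin 4 ⊕ W → ℕ) (.inl 3) x = fourRegs d a b x := by
  funext r
  rcases r with i | w
  · fin_cases i <;> simp [Function.update, fourRegs]
  · simp [fourRegs]

end

/-- A ternary primitive recursive function is computed from the first three counters into the
fourth, with a finite set of auxiliary counters. -/
theorem exists_call {f : ℕ → ℕ → ℕ → ℕ} (hf : Primrec fun z : ℕ × ℕ × ℕ => f z.1 z.2.1 z.2.2) :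
    ∃ (U : Type) (_ : Finite U) (t : ℕ × ℕ × ℕ → ℕ), Primrec t ∧
      ∀ (G V W : Type) [DecidableEq W] (work : U → W), Function.Injective work →
        ∃ F : Frag G V (Fin 4 ⊕ W), ∀ d a b,
          RegRuns F (fourRegs d a b 0) (fourRegs d a b (f d a b)) (t (d, a, b)) := by
  have hf' : Nat.Primrec' fun v : List.Vector ℕ 3 => f (v.get 0) (v.get 1) (v.get 2) := by
    refine Nat.Primrec'.of_prim (hf.comp (f := fun z : ℕ × ℕ × ℕ => f z.1 z.2.1 z.2.2)
      (g := fun v : List.Vector ℕ 3 => (v.get 0, v.get 1, v.get 2)) ?_)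
    exact (Primrec.vector_get.comp .id (.const 0)).pair
      ((Primrec.vector_get.comp .id (.const 1)).pair (Primrec.vector_get.comp .id (.const 2)))
  obtain ⟨t, ht, U, hU, h⟩ := exists_counterComputable hf'
  refine ⟨U, hU, fun z => t (List.Vector.ofFn ![z.1, z.2.1, z.2.2]), ?_,
    fun G V W _ work hw => ?_⟩
  · refine ht.comp (Primrec.vector_ofFn fun i => ?_)
    fin_cases i
    · exact Primrec.fst
    · exact Primrec.fst.comp Primrec.snd
    · exact Primrec.snd.comp Primrec.snd
  · obtain ⟨F, hF⟩ := h G V (Fin 4 ⊕ W) (fun i => .inl i.castSucc) (.inl 3)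
      (fun u => .inr (work u)) (Sum.inr_injective.comp hw)
      (fun i h => by
        have := congrArg Fin.val (Sum.inl_injective h)
        have := i.isLt
        simp at *
        omega) (fun i w => by simp) (fun w => by simp)
    refine ⟨F, fun d a b => ?_⟩
    have hv : (List.Vector.ofFn fun i : Fin 3 =>
        (fourRegs d a b 0 : Fin 4 ⊕ W → ℕ) (.inl i.castSucc)) = List.Vector.ofFn ![d, a, b] := by
      congr 1
      funext i
      fin_cases i <;> rfl
    have := hF (fourRegs d a b 0) rfl fun _ => rfl
    rw [hv, update_fourRegs_three] at this
    simpa using this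

/-- A list of numbers in unary. -/
def unaryList (l : List ℕ) : List Bool := l.flatMap fun v => List.replicate v true ++ [false]

theorem unaryList_cons (v : ℕ) (l : List ℕ) :
    unaryList (v :: l) = List.replicate v true ++ false :: unaryList l := by
  simp [unaryList]

theorem length_unaryList_le {l : List ℕ} {B : ℕ} (h : ∀ v ∈ l, v < B) :
    (unaryList l).length ≤ l.length * B := by
  induction l with
  | nil => simp [unaryList]
  | cons v l ih =>
    have h₁ := h v (by simp)
    have h₂ := ih fun w hw => h w (by simp [hw])
    rw [unaryList_cons, List.length_append, List.length_replicate, List.length_cons,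
      List.length_cons, Nat.succ_mul]
    omega

namespace Frag

variable {R : Type}

/-- Adds the number on top of the stack of values to a counter and removes it. -/
def popNum (x : R) : Frag G Bool R :=
  popVals.seq ((loop (fun m => m.fst.getD false) ((inc x).seq popVals)).seq reset)

/-- Moves a counter to the stack of values. -/
def pushNum (x : R) : Frag G Bool R :=
  (instr fun q => .push .vals (fun _ => false) q).seq
    (countdown x (instr fun q => .push .vals (fun _ => true) q))

end Frag

section

variable {R : Type} [DecidableEq R]

/-- On the empty stack the loop ends at once and adds `0`, in agreement with the default argument of
`applyOp`. -/
theorem runs_popNum (x : R) (y : List G) (l : List ℕ) (r : R → ℕ) :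
    Runs (Frag.popNum x) (restStore y (unaryList l) r)
      (restStore y (unaryList l.tail) (Function.update r x (r x + l.headD 0)))
      (3 * l.headD 0 + 3) := by
  have key : ∀ (v : ℕ) (l : List Bool) (r : R → ℕ),
      Runs (Frag.loop (fun m => m.fst.getD false) ((Frag.inc x).seq Frag.popVals))
        ⟨⟨false, none, (List.replicate v true ++ false :: l).head?, none⟩, [], y,
          (List.replicate v true ++ false :: l).tail, [], r⟩
        ⟨⟨false, none, some false, none⟩, [], y, l, [], Function.update r x (r x + v)⟩
        (3 * v + 1) := by
    intro v l
    induction v with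
    | zero =>
      intro r
      rw [Nat.add_zero, Function.update_eq_self]
      exact runs_loop_exit rfl
    | succ v ih =>
      intro r
      have h₁ := regRuns_inc (r := r) x (⟨⟨false, none, some true, none⟩, [], y,
        List.replicate v true ++ false :: l, [], r⟩ : Store G Bool R) rfl
      have h₂ := ih (Function.update r x (r x + 1))
      rw [Function.update_idem, Function.update_self, add_assoc, add_comm 1 v] at h₂
      exact (runs_loop_step rfl (h₁.seq (runs_popVals _)) h₂).mono (by omega)
  cases l with
  | nil =>
    have h₁ : Runs (Frag.loop (fun m => m.fst.getD false) ((Frag.inc x).seq Frag.popVals))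
        (restStore y [] r : Store G Bool R) (restStore y [] r) 1 := runs_loop_exit rfl
    rw [List.headD_nil, Nat.add_zero, Function.update_eq_self]
    exact (runs_popVals (restStore y [] r)).seq (h₁.seq (runs_reset _))
  | cons v l =>
    rw [unaryList_cons]
    exact ((runs_popVals _).seq ((key v (unaryList l) r).seq (runs_reset _))).mono
      (by simp only [List.headD_cons]; omega)

theorem runs_pushNum (x : R) (y : List G) (l : List ℕ) (r : R → ℕ) :
    Runs (Frag.pushNum x) (restStore y (unaryList l) r)
      (restStore y (unaryList (r x :: l)) (Function.update r x 0)) (4 * r x + 3) := by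
  have h₁ : Runs (Frag.instr fun q => .push .vals (fun _ => false) q)
      (restStore y (unaryList l) r) (restStore y (false :: unaryList l) r) 1 :=
    runs_instr fun p => by
      simp only [TM2.stepAux]
      congr 1
      exact update_vals (restStore y (unaryList l) r) _
  have h₂ := runs_countdown (F := (Frag.instr fun q => .push .vals (fun _ => true) q :
    Frag G Bool R)) (x := x) (n := r x) (ρ := fun i => restStore y
      (List.replicate i true ++ false :: unaryList l) (Function.update r x (r x - i)))
    (T := fun _ => 1) (fun _ _ => rfl) (fun i _ => by simp [restStore])
    fun i hi => runs_instr fun p => by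
      simp only [TM2.stepAux]
      congr 1
      rw [update_vals]
      simp only [Store.decr, restStore, Function.update_idem, Function.update_self,
        List.replicate_succ, List.cons_append, Nat.sub_sub]
      rfl
  simp only [List.replicate_zero, List.nil_append, Nat.sub_zero, Function.update_eq_self,
    Nat.sub_self, ← unaryList_cons] at h₂
  refine (h₁.seq h₂).mono ?_
  simp
  omega

end

/-- The arguments of an operator on a stack of values. -/
def opArgs (n : Fin 3) (l : List ℕ) : ℕ × ℕ :=
  match n with
  | 0 => (0, 0)
  | 1 => (l.headD 0, 0)
  | 2 => (l.headD 0, l.tail.headD 0)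

namespace Frag

/-- Pops `n` numbers. -/
def popArgs (n : Fin 3) : Frag G Bool (Fin 4 ⊕ W) :=
  match n with
  | 0 => skip
  | 1 => popNum (.inl 1)
  | 2 => (popNum (.inl 1)).seq (popNum (.inl 2))

/-- Replaces `n` numbers on the stack of values by the number that `F` computes from them. -/
def opNum (n : Fin 3) (F : Frag G Bool (Fin 4 ⊕ W)) : Frag G Bool (Fin 4 ⊕ W) :=
  (popArgs n).seq (F.seq ((clear (.inl 1)).seq ((clear (.inl 2)).seq (pushNum (.inl 3)))))

/-- Outputs whether there is just one number on the stack of values and `F` computes `1` from it, and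
clears everything else. -/
def acceptNum [Finite G] (F : Frag G Bool (Fin 4 ⊕ W)) : Frag G Bool (Fin 4 ⊕ W) :=
  (popNum (.inl 1)).seq (popVals.seq (switch fun m => match m.fst with
    | some _ => (loop (fun m => m.fst.isSome) popVals).seq (reset.seq ((clear (.inl 1)).seq
        ((clear (.inl 0)).seq (instr fun q => .push .out (fun _ => false) q))))
    | none => F.seq ((clear (.inl 1)).seq ((clear (.inl 0)).seq ((dec (.inl 3)).seq
        (instr fun q => .push .out Mem.flag (.load (fun _ => Mem.blank) q)))))))

end Frag

variable [DecidableEq W]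

theorem RegRuns.runs_rest {R : Type} [DecidableEq R] {F : Frag G Bool R} {r r' : R → ℕ} {t : ℕ}
    (h : RegRuns F r r' t) (y : List G) (l : List Bool) :
    Runs F (restStore y l r) (restStore y l r') t :=
  h ⟨Mem.blank, [], y, l, [], r⟩ rfl

theorem runs_popArgs (n : Fin 3) (y : List G) (d : ℕ) (l : List ℕ) :
    Runs (Frag.popArgs n : Frag G Bool (Fin 4 ⊕ W)) (restStore y (unaryList l) (fourRegs d 0 0 0))
      (restStore y (unaryList (l.drop n)) (fourRegs d (opArgs n l).1 (opArgs n l).2 0))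
      (3 * (opArgs n l).1 + 3 * (opArgs n l).2 + 6) := by
  match n with
  | 0 => exact (regRuns_skip.runs_rest y _).mono (by omega)
  | 1 =>
    have h := runs_popNum (.inl 1 : Fin 4 ⊕ W) y l (fourRegs d 0 0 0)
    rw [update_fourRegs_one] at h
    have e₁ : (fourRegs d 0 0 0 : Fin 4 ⊕ W → ℕ) (.inl 1) = 0 := rfl
    have e₂ : l.drop ((1 : Fin 3) : ℕ) = l.tail := by simp
    rw [e₁, Nat.zero_add] at h
    rw [e₂]
    exact h.mono (by simp only [opArgs]; omega)
  | 2 =>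
    have h₁ := runs_popNum (.inl 1 : Fin 4 ⊕ W) y l (fourRegs d 0 0 0)
    have h₂ := runs_popNum (.inl 2 : Fin 4 ⊕ W) y l.tail (fourRegs d (l.headD 0) 0 0)
    rw [update_fourRegs_one] at h₁
    rw [update_fourRegs_two] at h₂
    have e₁ : (fourRegs d 0 0 0 : Fin 4 ⊕ W → ℕ) (.inl 1) = 0 := rfl
    have e₂ : (fourRegs d (l.headD 0) 0 0 : Fin 4 ⊕ W → ℕ) (.inl 2) = 0 := rfl
    rw [e₁, Nat.zero_add] at h₁
    rw [e₂, Nat.zero_add] at h₂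
    have e₃ : l.drop ((2 : Fin 3) : ℕ) = l.tail.tail := by
      rcases l with _ | ⟨_, _ | _⟩ <;> rfl
    rw [e₃]
    exact (h₁.seq h₂).mono (by simp only [opArgs]; omega)

theorem applyOp_eq (n : Fin 3) (f : ℕ → ℕ → ℕ) (l : List ℕ) :
    applyOp 0 n f l = f (opArgs n l).1 (opArgs n l).2 :: l.drop n := by
  match n with
  | 0 => rfl
  | 1 => cases l <;> rfl
  | 2 => rcases l with _ | ⟨_, _ | _⟩ <;> rfl

/-- Each argument costs `3` per unit to pop and `4` to clear, the result `4` per unit to push. -/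
theorem runs_opNum {F : Frag G Bool (Fin 4 ⊕ W)} {f : ℕ → ℕ → ℕ → ℕ} {t : ℕ × ℕ × ℕ → ℕ}
    (hF : ∀ d a b, RegRuns F (fourRegs d a b 0) (fourRegs d a b (f d a b)) (t (d, a, b)))
    (n : Fin 3) (y : List G) (d : ℕ) (l : List ℕ) :
    Runs (Frag.opNum n F) (restStore y (unaryList l) (fourRegs d 0 0 0))
      (restStore y (unaryList (applyOp 0 n (f d) l)) (fourRegs d 0 0 0))
      (t (d, opArgs n l) + 7 * (opArgs n l).1 + 7 * (opArgs n l).2 +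
        4 * f d (opArgs n l).1 (opArgs n l).2 + 13) := by
  rw [applyOp_eq]
  have h₁ := runs_popArgs (W := W) n y d l
  generalize opArgs n l = q at h₁ ⊢
  obtain ⟨a, b⟩ := q
  have h₂ := (hF d a b).runs_rest y (unaryList (l.drop n))
  have h₃ := (regRuns_clear (G := G) (V := Bool) (r := fourRegs d a b (f d a b))
    (.inl 1 : Fin 4 ⊕ W)).runs_rest y (unaryList (l.drop n))
  rw [update_fourRegs_one] at h₃
  have h₄ := (regRuns_clear (G := G) (V := Bool) (r := fourRegs d 0 b (f d a b))
    (.inl 2 : Fin 4 ⊕ W)).runs_rest y (unaryList (l.drop n))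
  rw [update_fourRegs_two] at h₄
  have h₅ := runs_pushNum (.inl 3 : Fin 4 ⊕ W) y (l.drop n) (fourRegs d 0 0 (f d a b))
  rw [update_fourRegs_three] at h₅
  refine (h₁.seq (h₂.seq (h₃.seq (h₄.seq h₅)))).mono ?_
  have e₁ : (fourRegs d a b (f d a b) : Fin 4 ⊕ W → ℕ) (.inl 1) = a := rfl
  have e₂ : (fourRegs d 0 b (f d a b) : Fin 4 ⊕ W → ℕ) (.inl 2) = b := rfl
  have e₃ : (fourRegs d 0 0 (f d a b) : Fin 4 ⊕ W → ℕ) (.inl 3) = f d a b := rfl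
  rw [e₁, e₂, e₃]
  simp only
  omega

theorem runs_acceptNum [Finite G] {F : Frag G Bool (Fin 4 ⊕ W)} {p : ℕ → ℕ → Bool}
    {t : ℕ × ℕ × ℕ → ℕ} (hF : ∀ d a b, RegRuns F (fourRegs d a b 0)
      (fourRegs d a b (p d a).toNat) (t (d, a, b))) (d : ℕ) (l : List ℕ) :
    Runs (Frag.acceptNum F) (restStore [] (unaryList l) (fourRegs d 0 0 0))
      ⟨Mem.blank, [], [], [], [l.tail.isEmpty && p d (l.headD 0)], fun _ => 0⟩
      (t (d, l.headD 0, 0) + 7 * l.headD 0 + 4 * d + 2 * (unaryList l.tail).length + 13) := by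
  have h₁ := runs_popNum (.inl 1 : Fin 4 ⊕ W) ([] : List G) l (fourRegs d 0 0 0)
  rw [update_fourRegs_one] at h₁
  have e₁ : (fourRegs d 0 0 0 : Fin 4 ⊕ W → ℕ) (.inl 1) = 0 := rfl
  rw [e₁, Nat.zero_add] at h₁
  generalize l.headD 0 = a at h₁ ⊢
  have hz : (fun _ => 0 : Fin 4 ⊕ W → ℕ) = fourRegs 0 0 0 0 := by
    funext r
    rcases r with i | w
    · fin_cases i <;> rfl
    · rfl
  have hc : ∀ e, RegRuns (Frag.clear (.inl 1) : Frag G Bool (Fin 4 ⊕ W)) (fourRegs d a 0 e)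
      (fourRegs d 0 0 e) (4 * a + 2) := fun e => by
    have := regRuns_clear (G := G) (V := Bool) (r := fourRegs d a 0 e) (.inl 1 : Fin 4 ⊕ W)
    rwa [update_fourRegs_one] at this
  have hc' : ∀ e, RegRuns (Frag.clear (.inl 0) : Frag G Bool (Fin 4 ⊕ W)) (fourRegs d 0 0 e)
      (fourRegs 0 0 0 e) (4 * d + 2) := fun e => by
    have := regRuns_clear (G := G) (V := Bool) (r := fourRegs d 0 0 e) (.inl 0 : Fin 4 ⊕ W)
    rwa [update_fourRegs_zero] at this
  rw [hz]
  -- Every number occupies at least its terminator, so popping one more symbol decides whether a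
  -- second number is present.
  rcases hl : l.tail with _ | ⟨v, l'⟩
  · rw [hl] at h₁
    have hd := runs_dec (restStore [] [] (fourRegs 0 0 0 (p d a).toNat) :
      Store G Bool (Fin 4 ⊕ W)) (.inl 3)
    have ho : Runs (Frag.instr fun q => .push .out Mem.flag (.load (fun _ => Mem.blank) q))
        (⟨⟨p d a, none, none, none⟩, [], [], [], [], fourRegs 0 0 0 0⟩ :
          Store G Bool (Fin 4 ⊕ W))
        ⟨Mem.blank, [], [], [], [p d a], fourRegs 0 0 0 0⟩ 1 := runs_instr fun q => by
      simp only [TM2.stepAux]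
      congr 1
      exact update_out (⟨⟨p d a, none, none, none⟩, [], [], [], [], fourRegs 0 0 0 0⟩ :
          Store G Bool (Fin 4 ⊕ W)) _
    have e₂ : (restStore [] [] (fourRegs 0 0 0 (p d a).toNat) :
        Store G Bool (Fin 4 ⊕ W)).reg (.inl 3) = (p d a).toNat := rfl
    have e₃ : (p d a).toNat - 1 = 0 := by cases p d a <;> rfl
    have e₄ : decide ((p d a).toNat ≠ 0) = p d a := by cases p d a <;> rfl
    rw [e₂, e₃, e₄] at hd
    have e₅ : Function.update (restStore [] [] (fourRegs 0 0 0 (p d a).toNat) :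
        Store G Bool (Fin 4 ⊕ W)).reg (.inl 3) 0 = fourRegs 0 0 0 0 :=
      update_fourRegs_three _ _ _ _ _
    rw [e₅] at hd
    have hs := runs_switch (s := (restStore [] [] (fourRegs d a 0 0) :
        Store G Bool (Fin 4 ⊕ W))) (P := fun m => match m.fst with
      | some _ => (Frag.loop (fun m => m.fst.isSome) Frag.popVals).seq (Frag.reset.seq
          ((Frag.clear (.inl 1)).seq ((Frag.clear (.inl 0)).seq
          (Frag.instr fun q => .push .out (fun _ => false) q))))
      | none => F.seq ((Frag.clear (.inl 1)).seq ((Frag.clear (.inl 0)).seq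
          ((Frag.dec (.inl 3)).seq
          (Frag.instr fun q => .push .out Mem.flag (.load (fun _ => Mem.blank) q))))))
      (((hF d a 0).runs_rest [] []).seq (((hc _).runs_rest [] []).seq
        (((hc' _).runs_rest [] []).seq (hd.seq ho))))
    refine (h₁.seq ((runs_popVals _).seq hs)).mono ?_
    omega
  · rw [hl] at h₁
    have hd := runs_drain (restStore [] [] (fourRegs d a 0 0) :
      Store G Bool (Fin 4 ⊕ W)) (unaryList (v :: l'))
    have ho : Runs (Frag.instr fun q => .push .out (fun _ => false) q)
        (restStore [] [] (fourRegs 0 0 0 0) : Store G Bool (Fin 4 ⊕ W))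
        ⟨Mem.blank, [], [], [], [false], fourRegs 0 0 0 0⟩ 1 := runs_instr fun q => by
      simp only [TM2.stepAux]
      congr 1
      exact update_out (restStore [] [] (fourRegs 0 0 0 0) : Store G Bool (Fin 4 ⊕ W)) _
    obtain ⟨g, rest, hg⟩ : ∃ g rest, unaryList (v :: l') = g :: rest := by
      rw [unaryList_cons]
      cases v
      · exact ⟨_, _, rfl⟩
      · exact ⟨_, _, rfl⟩
    rw [hg] at hd h₁ ⊢
    have hs := runs_switch (s := (⟨⟨false, none, some g, none⟩, [], [], rest, [],
        fourRegs d a 0 0⟩ : Store G Bool (Fin 4 ⊕ W))) (P := fun m => match m.fst with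
      | some _ => (Frag.loop (fun m => m.fst.isSome) Frag.popVals).seq (Frag.reset.seq
          ((Frag.clear (.inl 1)).seq ((Frag.clear (.inl 0)).seq
          (Frag.instr fun q => .push .out (fun _ => false) q))))
      | none => F.seq ((Frag.clear (.inl 1)).seq ((Frag.clear (.inl 0)).seq
          ((Frag.dec (.inl 3)).seq
          (Frag.instr fun q => .push .out Mem.flag (.load (fun _ => Mem.blank) q))))))
      (hd.seq ((runs_reset _).seq (((hc _).runs_rest [] []).seq
        (((hc' _).runs_rest [] []).seq ho))))
    refine (h₁.seq ((runs_popVals _).seq hs)).mono ?_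
    omega

end Unary

end TraceSim

namespace TraceSim

/-! ### Fixed-parameter tractability -/

open Turing

theorem foldCost_le {G D : Type} {op : G → D → D} {T : G → D → ℕ} {Inv : D → Prop} {b : ℕ}
    (y : List G) (hop : ∀ g ∈ y, ∀ δ, Inv δ → Inv (op g δ))
    (hT : ∀ g ∈ y, ∀ δ, Inv δ → T g δ ≤ b) {δ : D} (hδ : Inv δ) :
    foldCost op T y δ ≤ (b + 4) * y.length + 1 := by
  induction y generalizing δ with
  | nil => simp [foldCost]
  | cons g y ih =>
    have h₁ := ih (fun g hg => hop g (by simp [hg])) (fun g hg => hT g (by simp [hg]))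
      (hop g (by simp) δ hδ)
    have h₂ := hT g (by simp) δ hδ
    rw [foldCost, List.length_cons, mul_add_one]
    omega

theorem headD_lt {l : List ℕ} {B : ℕ} (hB : 0 < B) (h : ∀ v ∈ l, v < B) : l.headD 0 < B := by
  cases l with
  | nil => exact hB
  | cons v l => exact h v (by simp)

theorem opArgs_lt {l : List ℕ} {B : ℕ} (hB : 0 < B) (h : ∀ v ∈ l, v < B) (n : Fin 3) :
    (opArgs n l).1 < B ∧ (opArgs n l).2 < B := by
  have h₁ := headD_lt hB h
  have h₂ := headD_lt hB fun v hv => h v (List.mem_of_mem_tail hv)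
  match n with
  | 0 => exact ⟨hB, hB⟩
  | 1 => exact ⟨h₁, hB⟩
  | 2 => exact ⟨h₁, h₂⟩

section FPT

variable {A : Type} {k : ℕ} (c : A ≃ Fin k)

/-- The effect of an input symbol on the modal depth read so far and the stack of values. -/
def readSymb : Symb A ⊕ Unit → ℕ × List ℕ → ℕ × List ℕ
  | .inl s, δ => (δ.1, applyOp 0 s.arity (symbVal c δ.1 s) δ.2)
  | .inr _, δ => (δ.1 + 1, δ.2)

/-- The units of the parameter stand at the right end and are read first, so `d` is known before any
symbol of the formula is evaluated. -/
theorem foldr_readSymb (z : List (Symb A) × List Unit) :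
    (encodePair z).foldr (readSymb c) (0, []) =
      (z.2.length, evalStack c z.2.length z.1) := by
  obtain ⟨x, y⟩ := z
  rw [encodePair, List.foldr_append]
  have h₁ : (y.map Sum.inr : List (Symb A ⊕ Unit)).foldr (readSymb c) (0, []) = (y.length, []) := by
    induction y with
    | nil => rfl
    | cons u y ih => rw [List.map_cons, List.foldr_cons, ih]; rfl
  simp only [h₁]
  induction x with
  | nil => rfl
  | cons s x ih => rw [List.map_cons, List.foldr_cons, ih]; rfl

/-- The time to process an input symbol, where `t s` is the time to compute the operation of the
symbol `s` on values. -/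
def readCost (t : Symb A → ℕ × ℕ × ℕ → ℕ) : Symb A ⊕ Unit → ℕ × List ℕ → ℕ
  | .inl s, δ => t s (δ.1, opArgs s.arity δ.2) + 7 * (opArgs s.arity δ.2).1 +
      7 * (opArgs s.arity δ.2).2 +
      4 * symbVal c δ.1 s (opArgs s.arity δ.2).1 (opArgs s.arity δ.2).2 + 13
  | .inr _, _ => 1

theorem foldCost_units (t : Symb A → ℕ × ℕ × ℕ → ℕ) (y : List Unit) (w : List (Symb A ⊕ Unit))
    (d : ℕ) (l : List ℕ) :
    foldCost (readSymb c) (readCost c t) (y.map Sum.inr ++ w) (d, l) =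
      5 * y.length + foldCost (readSymb c) (readCost c t) w (d + y.length, l) := by
  induction y generalizing d with
  | nil => simp
  | cons u y ih =>
    rw [List.map_cons, List.cons_append, foldCost]
    simp only [readSymb, readCost, ih, List.length_cons]
    rw [show d + 1 + y.length = d + (y.length + 1) by omega]
    ring

/-- A bound for the time to process a symbol. -/
def symbolBound [Fintype (Symb A)] (t : Symb A → ℕ × ℕ × ℕ → ℕ) (d : ℕ) : ℕ :=
  ∑ s, ∑ v ∈ Finset.range (valBound k d), ∑ w ∈ Finset.range (valBound k d), t s (d, v, w) +
    18 * valBound k d + 13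

/-- `t` need not be monotone, so it is bounded by its sum over all symbols and values; the factor
`18` is `7 + 7 + 4` from `runs_opNum`. -/
theorem readCost_le [Fintype (Symb A)] (t : Symb A → ℕ × ℕ × ℕ → ℕ) (s : Symb A) {d : ℕ}
    {l : List ℕ} (hl : ∀ v ∈ l, v < valBound k d) :
    readCost c t (.inl s) (d, l) ≤ symbolBound (k := k) t d := by
  have h := opArgs_lt (valBound_pos k d) hl s.arity
  have h₁ := symbVal_lt c d s (opArgs s.arity l).1 (opArgs s.arity l).2
  simp only [readCost, symbolBound]
  generalize opArgs s.arity l = q at h h₁ ⊢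
  obtain ⟨v, w⟩ := q
  have h₂ : t s (d, v, w) ≤ ∑ w ∈ Finset.range (valBound k d), t s (d, v, w) :=
    Finset.single_le_sum (f := fun w => t s (d, v, w)) (fun _ _ => Nat.zero_le _)
      (Finset.mem_range.2 h.2)
  have h₃ := Finset.single_le_sum
    (f := fun v => ∑ w ∈ Finset.range (valBound k d), t s (d, v, w)) (fun _ _ => Nat.zero_le _)
    (Finset.mem_range.2 h.1)
  have h₄ := Finset.single_le_sum (f := fun s => ∑ v ∈ Finset.range (valBound k d),
    ∑ w ∈ Finset.range (valBound k d), t s (d, v, w)) (fun _ _ => Nat.zero_le _)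
    (Finset.mem_univ s)
  simp only at h h₁ h₃ h₄ ⊢
  omega

theorem primrec_symbolBound [Fintype (Symb A)] {t : Symb A → ℕ × ℕ × ℕ → ℕ}
    (ht : ∀ s, Primrec (t s)) : Primrec (symbolBound (k := k) t) := by
  have hB : Primrec (valBound k) := primrec_valBound
  have hs : Primrec fun d => ∑ s, ∑ v ∈ Finset.range (valBound k d),
      ∑ w ∈ Finset.range (valBound k d), t s (d, v, w) := by
    refine primrec_finset_sum _ fun s => primrec_sum_range hB ?_
    refine primrec_sum_range (hB.comp Primrec.fst) ?_
    exact (ht s).comp ((Primrec.fst.comp Primrec.fst).pair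
      ((Primrec.snd.comp Primrec.fst).pair Primrec.snd))
  exact primrec_add (primrec_add hs (primrec_mul (Primrec.const 18) hB)) (Primrec.const 13)

/-- A property of formulae that depends primitive recursively on the models of depth at most the
modal depth plus one is fixed-parameter tractable. -/
theorem isFPT_tsParameterized [Finite A] {P : ℕ → ℕ → Prop} {Q : HML A → Prop}
    (hP : ∀ φ, IsTS φ → (P φ.md (valMask (formVal c φ.md φ)) ↔ Q φ))
    (hprim : PrimrecPred fun z : ℕ × ℕ => P z.1 z.2) : IsFPT (tsParameterized Q) := by
  classical
  have := Fintype.ofFinite (Symb A)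
  have hB : Primrec (valBound k) := primrec_valBound
  choose U hU t ht hcall using fun s => exists_call (f := fun d v w => symbVal c d s v w)
    (primrec_symbVal c s)
  have hacc : Primrec fun z : ℕ × ℕ × ℕ => (decide (AcceptVal P z.1 z.2.1)).toNat :=
    (Primrec.ite ((primrecPred_acceptVal hprim).comp
      (Primrec.fst.pair (Primrec.fst.comp Primrec.snd))) (Primrec.const 1)
      (Primrec.const 0)).of_eq fun z => by
        by_cases h : AcceptVal P z.1 z.2.1 <;> simp [h]
  obtain ⟨U', hU', t', ht', hcall'⟩ := exists_call (f := fun d v _ =>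
    (decide (AcceptVal P d v)).toNat) hacc
  -- Disjoint auxiliary counters for the program of each symbol and for the acceptance test; their
  -- number does not depend on the modal depth.
  let W := (Σ s, U s) ⊕ U'
  choose F hF using fun s => hcall s (Symb A ⊕ Unit) Bool W (fun u => .inl ⟨s, u⟩)
    fun a b h => by cases h; rfl
  obtain ⟨F', hF'⟩ := hcall' (Symb A ⊕ Unit) Bool W .inr Sum.inr_injective
  let E : ℕ → ℕ := fun d => ∑ v ∈ Finset.range (valBound k d), t' (d, v, 0)
  have hE : Primrec E := primrec_sum_range hB (ht'.comp (Primrec.fst.pair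
    (Primrec.snd.pair (Primrec.const 0))))
  let f : ℕ → ℕ := fun d => symbolBound (k := k) t d + E d + 9 * valBound k d + 12 * d + 30
  have hf : Primrec f := primrec_add (primrec_add (primrec_add (primrec_add
    (primrec_symbolBound ht) hE) (primrec_mul (Primrec.const 9) hB))
    (primrec_mul (Primrec.const 12) primrec_id)) (Primrec.const 30)
  refine ⟨_, f, 1, hf.to_comp, decidesInTime_fold (V := Bool) (R := Fin 4 ⊕ W)
    (F := fun g => match g with
      | .inl s => Frag.opNum s.arity (F s)
      | .inr _ => Frag.inc (.inl 0))
    (E := Frag.acceptNum F') (op := readSymb c) (T := readCost c t)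
    (vals := fun δ => unaryList δ.2) (reg := fun δ => fourRegs δ.1 0 0 0) (δ₀ := (0, []))
    (T' := fun δ => t' (δ.1, δ.2.headD 0, 0) + 7 * δ.2.headD 0 + 4 * δ.1 +
      2 * (unaryList δ.2.tail).length + 13)
    (acc := fun δ => δ.2.tail.isEmpty && decide (AcceptVal P δ.1 (δ.2.headD 0))) rfl ?_ ?_
    (fun δ => runs_acceptNum (p := fun d v => decide (AcceptVal P d v)) hF' δ.1 δ.2) ?_ ?_⟩
  · funext r
    rcases r with i | w
    · fin_cases i <;> rfl
    · rfl
  · rintro (s | u) ⟨d, l⟩ y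
    · exact runs_opNum (hF s) s.arity y d l
    · have h := (regRuns_inc (G := Symb A ⊕ Unit) (V := Bool) (r := fourRegs d 0 0 0)
        (.inl 0 : Fin 4 ⊕ W)).runs_rest y (unaryList l)
      rw [update_fourRegs_zero] at h
      exact h
  · rintro z
    have h := acceptVal_evalStack_iff c hP z.2.length z.1
    simp only [foldr_readSymb, Bool.and_eq_true, List.isEmpty_iff, decide_eq_true_eq, h]
    constructor
    · rintro ⟨φ, hts, hd, hq, hx⟩
      exact ⟨φ, hts, hq, hx, by rw [hd]; exact List.eq_replicate_length.2 fun _ _ => rfl⟩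
    · rintro ⟨φ, hts, hq, hx, hd⟩
      exact ⟨φ, hts, by rw [hd, List.length_replicate], hq, hx⟩
  · rintro ⟨x, y⟩
    have hlt := evalStack_lt c y.length x
    have hlen := length_evalStack_le c y.length x
    have h₁ : foldCost (readSymb c) (readCost c t) (encodePair (x, y)).reverse (0, []) ≤
        5 * y.length + ((symbolBound (k := k) t y.length + 4) * x.length + 1) := by
      rw [encodePair, List.reverse_append, ← List.map_reverse, foldCost_units,
        List.length_reverse, Nat.zero_add]
      refine Nat.add_le_add_left ?_ _
      have := foldCost_le (op := readSymb c) (T := readCost c t) (x.map Sum.inl).reverse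
        -- While the formula is read, the depth counter is constant and all values stay below
        -- `valBound`, so a single bound applies to every symbol.
        (Inv := fun δ => δ.1 = y.length ∧ ∀ v ∈ δ.2, v < valBound k y.length)
        (b := symbolBound (k := k) t y.length) ?_ ?_ (δ := (y.length, [])) ⟨rfl, by simp⟩
      · simpa using this
      · intro g hg δ hδ
        obtain ⟨s, -, rfl⟩ := List.mem_map.1 (List.mem_reverse.1 hg)
        refine ⟨hδ.1, ?_⟩
        simp only [readSymb, hδ.1]
        exact applyOp_lt (symbVal_lt c _ s) hδ.2
      · rintro g hg ⟨d, l⟩ ⟨rfl, hl⟩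
        obtain ⟨s, -, rfl⟩ := List.mem_map.1 (List.mem_reverse.1 hg)
        exact readCost_le c t s hl
    have h₂ := headD_lt (valBound_pos k y.length) hlt
    have h₃ : t' (y.length, (evalStack c y.length x).headD 0, 0) ≤ E y.length :=
      Finset.single_le_sum (f := fun v => t' (y.length, v, 0)) (fun _ _ => Nat.zero_le _)
        (Finset.mem_range.2 h₂)
    have h₄ : (unaryList (evalStack c y.length x).tail).length ≤ x.length * valBound k y.length :=
      (length_unaryList_le fun v hv => hlt v (List.mem_of_mem_tail hv)).trans
        (Nat.mul_le_mul_right _ (by rw [List.length_tail]; omega))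
    have h₅ : (encodePair (x, y)).length = x.length + y.length := by simp [encodePair]
    rw [foldr_readSymb, h₅, pow_one]
    simp only [f]
    generalize foldCost (readSymb c) (readCost c t) (encodePair (x, y)).reverse (0, []) = X₁ at *
    generalize t' (y.length, (evalStack c y.length x).headD 0, 0) = X₂ at *
    generalize (evalStack c y.length x).headD 0 = X₃ at *
    generalize (unaryList (evalStack c y.length x).tail).length = X₄ at *
    generalize symbolBound (k := k) t y.length = S at *
    generalize E y.length = E' at *
    generalize valBound k y.length = B at *
    generalize x.length = n at *
    generalize y.length = d at *
    calc 3 * (n + d) + X₁ + (X₂ + 7 * X₃ + 4 * d + 2 * X₄ + 13) + 4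
        ≤ 3 * (n + d) + (5 * d + ((S + 4) * n + 1)) + (E' + 7 * B + 4 * d + 2 * (n * B) + 13) + 4 := by
          omega
      _ ≤ (S + E' + 9 * B + 12 * d + 30) * (n + 1) := by
          nlinarith [Nat.zero_le (E' * n), Nat.zero_le (B * n), Nat.zero_le (d * n),
            Nat.zero_le S, Nat.zero_le (S * n)]

end FPT

end TraceSim

/-! ### Assembly of the three claims -/

theorem mainTheorem11 :
    -- linear time for fixed `k` and `d`; the machine depends on `A` and `d`, the constant `C` does
    -- not, and the summand `1` is for the empty input
    (∃ C : ℕ, ∀ (A : Type) [Fintype A] (k d : ℕ), Fintype.card A = k → 1 ≤ k →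
      DecidableInTime (tsLanguage (A := A) d (fun φ => Satisfiable φ ∧ PrimeIn (LTS A) φ))
        (fun n => C * (2 ^ (2 * k ^ (d + 1)) * k ^ (d + 1) * n + 1)) ∧
      DecidableInTime (tsLanguage (A := A) d Satisfiable)
        (fun n => C * (2 ^ (2 * k ^ (d + 1)) * k ^ (d + 1) * n + 1)) ∧
      DecidableInTime (tsLanguage (A := A) d (PrimeIn (LTS A)))
        (fun n => C * (2 ^ (2 * k ^ (d + 1)) * k ^ (d + 1) * n + 1)) ∧
      DecidableInTime (tsLanguage (A := A) d (CharacteristicIn (LTS A)))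
        (fun n => C * (2 ^ (2 * k ^ (d + 1)) * k ^ (d + 1) * n + 1))) ∧
    -- satisfiability together with primality depends only on the processes of depth at most `d + 1`
    (∀ (A : Type) [Fintype A] (k d : ℕ), Fintype.card A = k → 1 ≤ k →
      ∀ φ ∈ LTS A, φ.md = d →
        ((Satisfiable φ ∧ PrimeIn (LTS A) φ) ↔
          ∃ p : Proc A, p.depth ≤ d ∧ p.Sat φ ∧
            ∀ q : Proc A, q.depth ≤ d + 1 → q.Sat φ → TraceSimulated p q)) ∧
    -- fixed-parameter tractability, one machine for all modal depths
    (∀ (A : Type) [Fintype A] (k : ℕ), Fintype.card A = k → 1 ≤ k →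
      IsFPT (tsParameterized (A := A) Satisfiable) ∧
      IsFPT (tsParameterized (A := A) (PrimeIn (LTS A))) ∧
      IsFPT (tsParameterized (A := A) (CharacteristicIn (LTS A)))) := by
  refine ⟨⟨10, fun A _ k d hA hk => ?_⟩, fun A _ k d hA hk φ _ hd => ?_, fun A _ k hA hk => ?_⟩
  · have c : A ≃ Fin k := Fintype.equivFinOfCardEq hA
    have key : ∀ (P : ℕ → ℕ → Prop) (Q : HML A → Prop),
        (∀ φ, IsTS φ → (P φ.md (valMask (formVal c φ.md φ)) ↔ Q φ)) →
        DecidableInTime (tsLanguage d Q)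
          (fun n => 10 * (2 ^ (2 * k ^ (d + 1)) * k ^ (d + 1) * n + 1)) := by
      intro P Q hP
      obtain ⟨M, hM, h⟩ := decidableInTime_tsLanguage c hP d
      refine ⟨M, hM, fun x => ?_⟩
      obtain ⟨b, hb, ⟨h⟩⟩ := h x
      refine ⟨b, hb, ⟨⟨h.toEvalsTo, h.steps_le_m.trans ?_⟩⟩⟩
      -- The machine already runs in `10 * n + 8` steps, so it suffices that the factor depending on
      -- `k` and `d` is at least `1`.
      have h₁ : 1 ≤ 2 ^ (2 * k ^ (d + 1)) * k ^ (d + 1) := by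
        have : 0 < k := hk
        exact Nat.succ_le_of_lt (by positivity)
      have h₂ := Nat.le_mul_of_pos_left x.length h₁
      simp only
      omega
    exact ⟨key (LeastPred k) _ fun φ _ => leastPred_iff c hk φ,
      key (SatPred k) _ fun φ _ => satPred_iff c hk φ,
      key (PrimePred k) _ fun φ _ => primePred_iff c hk φ,
      -- Within the logic, characteristic means satisfiable and prime, so the same test applies.
      key (LeastPred k) _ fun φ hφ =>
        (leastPred_iff c hk φ).trans (characteristicIn_iff c hk hφ).symm⟩
  · subst hd
    exact satisfiable_prime_iff_bounded (Fintype.equivFinOfCardEq hA) hk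
  · have c : A ≃ Fin k := Fintype.equivFinOfCardEq hA
    exact ⟨isFPT_tsParameterized c (fun φ _ => satPred_iff c hk φ) primrecPred_satPred,
      isFPT_tsParameterized c (fun φ _ => primePred_iff c hk φ) primrecPred_primePred,
      isFPT_tsParameterized c (fun φ hφ =>
        (leastPred_iff c hk φ).trans (characteristicIn_iff c hk hφ).symm) primrecPred_leastPred⟩
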